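/- Let $M$ be a connected, non-compact smooth manifold (without boundary) of dimension $n$, and let $F\colon TM\to[0,\infty)$ be a Finsler metric on $M$, not assumed to be absolutely homogeneous: $F$ is smooth off the zero section, positive on nonzero vectors, satisfies $F(x,\lambda y)=\lambda F(x,y)$ for $\lambda\ge 0$, and its fundamental tensor $g_{ij}(x,y)=\tfrac12\,\partial^2F^2/\partial y^i\partial y^j$ is positive definite for $y\neq 0$. Geodesics of $(M,F)$ are the projections to $M$ of the integral curves of the geodesic spray $$S=y^i\frac{\partial}{\partial x^i}-2G^i(x,y)\frac{\partial}{\partial y^i},\qquad G^i=\tfrac14\,g^{il}\Bigl(\frac{\partial^2F^2}{\partial x^k\partial y^l}\,y^k-\frac{\partial F^2}{\partial x^l}\Bigr).$$ Assume that $(M,F)$ is forward complete, i.e. for every tangent vector $v\in TM$ the geodesic with initial velocity $v$ is defined on all of $[0,\infty)$, and that its Holmes–Thompson volume $$\mathrm{vol}_{HT}(M,F)=\int_M\sigma_{HT}(x)\,dx^1\cdots dx^n,\qquad \sigma_{HT}(x)=\frac{1}{\mathrm{Vol}(\mathbb B^n(1))}\int_{\{y\,:\,F(x,y)<1\}}\det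 g_{ij}(x,y)\,dy,$$ is finite, where $\mathrm{Vol}(\mathbb B^n(1))$ is the volume of the Euclidean unit ball. Then every function $f\colon M\to\mathbb R$ that is convex, i.e. such that $f\circ\gamma\colon[a,b]\to\mathbb R$ is a convex function for every geodesic $\gamma\colon[a,b]\to M$, is constant. -/

import Mathlib

open scoped Manifold ContDiff
open MeasureTheory Set

noncomputable section

namespace Finsler

/-- The coordinate space `ℝⁿ`. -/
abbrev Coord (n : ℕ) : Type := EuclideanSpace ℝ (Fin n)

/-- A (smooth, not necessarily absolutely homogeneous) Finsler metric on a smooth `n`-manifold: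
a function on the tangent bundle, smooth off the zero section, positive on nonzero vectors,
positively homogeneous of degree one on each tangent space, and strongly convex: the Hessian
`g_v(w, w) = (d²/ds²) F²(v + s w) / 2` at `s = 0` is positive definite for every `v ≠ 0`. -/
structure FinslerMetric (n : ℕ) (M : Type*) [TopologicalSpace M] [ChartedSpace (Coord n) M]
    [IsManifold (𝓡 n) ∞ M] where
  toFun : TangentBundle (𝓡 n) M → ℝ
  smooth : ContMDiffOn (𝓡 n).tangent 𝓘(ℝ, ℝ) ∞ toFun {u | u.2 ≠ 0}
  pos : ∀ (x : M) (v : TangentSpace (𝓡 n) x), v ≠ 0 → 0 < toFun ⟨x, v⟩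
  homogeneous : ∀ (x : M) (v : TangentSpace (𝓡 n) x) (c : ℝ), 0 ≤ c →
    toFun ⟨x, c • v⟩ = c * toFun ⟨x, v⟩
  strongly_convex : ∀ (x : M) (v w : TangentSpace (𝓡 n) x), v ≠ 0 → w ≠ 0 →
    0 < iteratedDeriv 2 (fun s : ℝ => toFun ⟨x, v + s • w⟩ ^ 2 / 2) 0

/-- `∂h/∂xⁱ` for a function `h` of the coordinates `(x, y)` of the tangent bundle. -/
def partialX {n : ℕ} (i : Fin n) (h : Coord n × Coord n → ℝ) (p : Coord n × Coord n) : ℝ :=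
  fderiv ℝ h p (EuclideanSpace.single i 1, 0)

/-- `∂h/∂yⁱ` for a function `h` of the coordinates `(x, y)` of the tangent bundle. -/
def partialY {n : ℕ} (i : Fin n) (h : Coord n × Coord n → ℝ) (p : Coord n × Coord n) : ℝ :=
  fderiv ℝ h p (0, EuclideanSpace.single i 1)

namespace FinslerMetric

variable {n : ℕ} {M : Type*} [TopologicalSpace M] [ChartedSpace (Coord n) M]
  [IsManifold (𝓡 n) ∞ M]

/-- `F` in the coordinates `(x, y)` of `TM` which are induced by the chart of `M` at `x₀`. -/
def coord (F : FinslerMetric n M) (x₀ : M) (p : Coord n × Coord n) : ℝ :=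
  F.toFun ((extChartAt (𝓡 n).tangent (⟨x₀, 0⟩ : TangentBundle (𝓡 n) M)).symm p)

/-- The fundamental tensor `g_ij(x, y) = ½ ∂²F²/∂yⁱ∂yʲ` in the chart at `x₀`. -/
def fundamentalTensor (F : FinslerMetric n M) (x₀ : M) (p : Coord n × Coord n) :
    Matrix (Fin n) (Fin n) ℝ :=
  Matrix.of fun i j => (1 / 2) * partialY i (partialY j fun q => F.coord x₀ q ^ 2) p

/-- The spray coefficients
`Gⁱ(x, y) = ¼ gⁱˡ (∂²F²/∂xᵏ∂yˡ yᵏ - ∂F²/∂xˡ)` in the chart at `x₀`. -/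
def sprayCoeff (F : FinslerMetric n M) (x₀ : M) (p : Coord n × Coord n) : Coord n :=
  WithLp.toLp 2 fun i => (1 / 4) * ∑ l, (F.fundamentalTensor x₀ p)⁻¹ i l *
    ((∑ k, partialX k (partialY l fun q => F.coord x₀ q ^ 2) p * p.2 k) -
      partialX l (fun q => F.coord x₀ q ^ 2) p)

/-- The geodesic spray `S = yⁱ ∂/∂xⁱ - 2 Gⁱ ∂/∂yⁱ`, a vector field on the tangent bundle.
Mathlib represents a tangent vector of `TM` at `u` by its components in the coordinates `(x, y)`
which are induced by the preferred chart of `M` at the base point of `u`; these are the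
coordinates used here. -/
def spray (F : FinslerMetric n M) (u : TangentBundle (𝓡 n) M) :
    TangentSpace (𝓡 n).tangent u :=
  let y : Coord n := u.2
  ((y, (-2 : ℝ) • F.sprayCoeff u.1 (extChartAt (𝓡 n) u.1 u.1, y)) : Coord n × Coord n)

/-- `γ` restricted to the interval `s` is a geodesic: it is the projection to `M` of an integral
curve of the geodesic spray (which is then the velocity field of `γ`). -/
def IsGeodesicOn (F : FinslerMetric n M) (γ : ℝ → M) (s : Set ℝ) : Prop :=
  ∃ u : ℝ → TangentBundle (𝓡 n) M, IsMIntegralCurveOn u F.spray s ∧ ∀ t ∈ s, (u t).1 = γ t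

/-- Forward completeness: for every tangent vector `u₀` the geodesic with initial velocity `u₀`
is defined on all of `[0, ∞)`. -/
def ForwardComplete (F : FinslerMetric n M) : Prop :=
  ∀ u₀ : TangentBundle (𝓡 n) M, ∃ u : ℝ → TangentBundle (𝓡 n) M,
    u 0 = u₀ ∧ IsMIntegralCurveOn u F.spray (Ici 0)

/-- A function is convex if it is convex along every geodesic `γ : [a, b] → M`. -/
def IsConvex (F : FinslerMetric n M) (f : M → ℝ) : Prop :=
  ∀ (γ : ℝ → M) (a b : ℝ), a ≤ b → F.IsGeodesicOn γ (Icc a b) → ConvexOn ℝ (Icc a b) (f ∘ γ)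

/-- The Holmes–Thompson density
`σ(x) = Vol(𝔹ⁿ)⁻¹ ∫_{F(x, y) < 1} det g_ij(x, y) dy` in the chart at `x₀`. -/
def htDensity (F : FinslerMetric n M) (x₀ : M) (x : Coord n) : ENNReal :=
  (∫⁻ y in {y : Coord n | F.coord x₀ (x, y) < 1},
      ENNReal.ofReal (F.fundamentalTensor x₀ (x, y)).det) /
    volume (Metric.ball (0 : Coord n) 1)

/-- The Holmes–Thompson measure `σ(x) dx¹ ⋯ dxⁿ` on the domain of the chart at `x₀`, as a measure
on `M` that vanishes outside of this domain. -/
def htChartMeasure [MeasurableSpace M] (F : FinslerMetric n M) (x₀ : M) : Measure M :=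
  Measure.map (extChartAt (𝓡 n) x₀).symm
    ((volume.restrict (extChartAt (𝓡 n) x₀).target).withDensity (F.htDensity x₀))

/-- The Holmes–Thompson measure of `(M, F)`. The measures in the charts agree on the overlaps of
their domains; the measure glued from them is their supremum. -/
def htMeasure [MeasurableSpace M] (F : FinslerMetric n M) : Measure M :=
  ⨆ x₀ : M, F.htChartMeasure x₀

/-- The Holmes–Thompson volume of `(M, F)`. -/
def htVolume [MeasurableSpace M] (F : FinslerMetric n M) : ENNReal :=
  F.htMeasure univ

end FinslerMetric

end Finsler

end

/-! The nonzero vectors of length less than one form a set `F.unitBallBundle` whose Liouville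
measure (`det g dx dy` in every chart) is at most the Holmes–Thompson volume times the volume of the
Euclidean unit ball, since integrating `det g` over a fibre is what defines the Holmes–Thompson
density (`liouville_lt_top`). The geodesic flow keeps the length of a vector and preserves this
measure, so its time-one map is a measure-preserving map of a finite measure space
(`measurePreserving_timeOne`). By Poincaré recurrence almost every vector returns arbitrarily close
to itself at arbitrarily late times. Along such a geodesic a continuous convex `f` returns
arbitrarily close to its initial value, and a convex function on `[0, ∞)` that does so is constant
(`eq_of_convexOn_of_frequently`). Thus `f` takes equal values at times 0 and 1 of almost every
geodesic, and by continuity of every geodesic of speed less than one (`apply_flow_one_eq`). Such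
geodesics join a point to all nearby points, so `f` is locally constant, hence constant.

Two ingredients take most of the work. The first is invariance of the measure. In coordinates the
spray `S` of `E = F²` is characterised by the Euler–Lagrange identity `E''(S, (0, w)) = E'(w, 0)`.
This identity makes `S` independent of the chart, and its derivative gives `div (det g · S) = 0`
(`divergence_sprayOf`). Liouville's theorem for a local flow
(`exists_local_flow_preserving_density`) then gives local invariance, which is propagated along
orbits by compactness and to measurable sets by countable covers.

The second is continuity of convex functions (`IsConvex.continuous`). The metric need not be
reversible, and the spray is smooth only off the zero section; homogeneity of degree two still makes
its vertical part Lipschitz with small constant near zero vectors. Short geodesics are therefore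
small Lipschitz perturbations of straight lines (`IsAlmostLinear`). Joining the vertices of a small
cube successively by such curves gives a perturbed cube that still covers a ball, and on it `f` is
at most its maximum over the vertices. A local upper bound and convexity then give continuity, as in
a vector space. -/

noncomputable section

open scoped Topology NNReal

set_option linter.unusedSectionVars false

namespace Finsler

/-! ### Derivatives of determinants. -/

section Det

variable {ι : Type*} [Fintype ι] [DecidableEq ι]

/-- Jacobi's formula for the derivative of a determinant. -/
lemma hasDerivWithinAt_det {A : ℝ → Matrix ι ι ℝ} {A' : Matrix ι ι ℝ} {s : Set ℝ} {t : ℝ}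
    (h : ∀ i j, HasDerivWithinAt (fun r => A r i j) (A' i j) s t) :
    HasDerivWithinAt (fun r => (A r).det) (((A t).adjugate * A').trace) s t := by
  have h1 : ∀ σ : Equiv.Perm ι, HasDerivWithinAt (fun r => ∏ i, A r (σ i) i)
      (∑ i, (∏ j ∈ Finset.univ.erase i, A t (σ j) j) • A' (σ i) i) s t := fun σ => by
    have := HasDerivWithinAt.fun_finsetProd (u := Finset.univ) (f := fun i r => A r (σ i) i)
      (f' := fun i => A' (σ i) i) (fun i _ => h (σ i) i)
    exact this
  have h2 : HasDerivWithinAt (fun r => (A r).det) (∑ σ : Equiv.Perm ι,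
      ((Equiv.Perm.sign σ : ℤ) : ℝ) * ∑ i, (∏ j ∈ Finset.univ.erase i, A t (σ j) j) • A' (σ i) i)
      s t := by
    simp only [Matrix.det_apply']
    exact HasDerivWithinAt.fun_sum fun σ _ => (h1 σ).const_mul _
  convert h2 using 1
  have h3 : ∀ i, ∑ σ : Equiv.Perm ι, ((Equiv.Perm.sign σ : ℤ) : ℝ) *
      ((∏ j ∈ Finset.univ.erase i, A t (σ j) j) • A' (σ i) i) =
      ((A t).updateCol i (fun k => A' k i)).det := fun i => by
    rw [Matrix.det_apply']
    refine Finset.sum_congr rfl fun σ _ => ?_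
    rw [← Finset.mul_prod_erase _ _ (Finset.mem_univ i)]
    have h4 : ∏ j ∈ Finset.univ.erase i, (A t).updateCol i (fun k => A' k i) (σ j) j =
        ∏ j ∈ Finset.univ.erase i, A t (σ j) j :=
      Finset.prod_congr rfl fun j hj => by
        rw [Matrix.updateCol_ne (Finset.ne_of_mem_erase hj)]
    rw [h4]
    simp only [Matrix.updateCol_self, smul_eq_mul]
    ring
  simp only [Finset.mul_sum]
  rw [Finset.sum_comm]
  simp only [h3]
  rw [Matrix.trace]
  refine Finset.sum_congr rfl fun i _ => ?_
  rw [← Matrix.cramer_apply, Matrix.cramer_eq_adjugate_mulVec]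
  rfl

variable {V : Type*} [NormedAddCommGroup V] [NormedSpace ℝ V] [FiniteDimensional ℝ V]

/-- Liouville's formula for a linear equation: in Jacobi's formula `adj W · A W` has the same trace
as `A · W adj W = det W · A`. -/
lemma hasDerivWithinAt_det_of_linear_ode {W : ℝ → V →L[ℝ] V} {A : V →L[ℝ] V} {s : Set ℝ} {t : ℝ}
    (h : HasDerivWithinAt W (A.comp (W t)) s t) :
    HasDerivWithinAt (fun r => (W r).det) (LinearMap.trace ℝ V A * (W t).det) s t := by
  classical
  set b := Module.finBasis ℝ V
  have h1 := hasDerivWithinAt_det (A := fun r => LinearMap.toMatrix b b (W r))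
    (A' := LinearMap.toMatrix b b (A.comp (W t))) (s := s) (t := t) fun i j => by
      simp only [LinearMap.toMatrix_apply]
      have h2 : HasDerivWithinAt (fun r => W r (b j)) ((A.comp (W t)) (b j)) s t :=
        ((ContinuousLinearMap.apply ℝ V (b j)).hasFDerivAt.comp_hasDerivWithinAt t h)
      exact ((LinearMap.toContinuousLinearMap (b.coord i)).hasFDerivAt.comp_hasDerivWithinAt t h2)
  have h3 : ∀ r, (LinearMap.toMatrix b b (W r)).det = (W r).det := fun r => by
    rw [LinearMap.det_toMatrix]
  simp only [h3] at h1
  convert h1 using 1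
  have h4 : LinearMap.toMatrix b b (A.comp (W t) : V →L[ℝ] V) =
      LinearMap.toMatrix b b A * LinearMap.toMatrix b b (W t) := by
    rw [← LinearMap.toMatrix_comp]; rfl
  rw [h4, ← Matrix.mul_assoc, Matrix.trace_mul_comm, ← Matrix.mul_assoc, Matrix.mul_adjugate,
    h3, Matrix.smul_mul, Matrix.one_mul, Matrix.trace_smul, smul_eq_mul, mul_comm,
    LinearMap.trace_eq_matrix_trace ℝ b]

end Det

/-! ### Solutions of differential equations on a closed time interval. -/

section ODE

variable {V : Type*} [NormedAddCommGroup V] [NormedSpace ℝ V] [CompleteSpace V]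

/-- Picard–Lindelöf on `[0, T]`, with control of the image of the solutions. -/
lemma exists_solutions_mem_closedBall {S : ℝ → V → V} {p : V} {a r L T : ℝ} {K : ℝ≥0}
    (hr : 0 ≤ r) (hL : 0 ≤ L) (hT : 0 ≤ T)
    (hK : ∀ t ∈ Icc 0 T, LipschitzOnWith K (S t) (Metric.closedBall p a))
    (hcont : ∀ x ∈ Metric.closedBall p a, ContinuousOn (S · x) (Icc 0 T))
    (hbound : ∀ t ∈ Icc 0 T, ∀ x ∈ Metric.closedBall p a, ‖S t x‖ ≤ L) (hLT : L * T ≤ a - r) :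
    ∃ α : V → ℝ → V, ∀ x ∈ Metric.closedBall p r, α x 0 = x ∧ ∀ t ∈ Icc 0 T,
      HasDerivWithinAt (α x) (S t (α x t)) (Icc 0 T) t ∧ α x t ∈ Metric.closedBall p a := by
  have ha : 0 ≤ a := by nlinarith [mul_nonneg hL hT]
  lift a to ℝ≥0 using ha
  lift r to ℝ≥0 using hr
  lift L to ℝ≥0 using hL
  have h0 : (0 : ℝ) ∈ Icc 0 T := ⟨le_rfl, hT⟩
  have hpl : IsPicardLindelof S (tmin := 0) (tmax := T) ⟨0, h0⟩ p a r L K :=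
    { lipschitzOnWith := hK
      continuousOn := hcont
      norm_le := hbound
      mul_max_le := by
        simp only [sub_zero, sub_self, max_eq_left hT]
        exact hLT }
  have key : ∀ x ∈ Metric.closedBall p r, ∃ α : ℝ → V, α 0 = x ∧ ∀ t ∈ Icc 0 T,
      HasDerivWithinAt α (S t (α t)) (Icc 0 T) t ∧ α t ∈ Metric.closedBall p a := fun x hx => by
    obtain ⟨α, hα⟩ := ODE.FunSpace.exists_isFixedPt_next hpl (x := x) hx
    refine ⟨α.compProj, ?_, fun t ht => ⟨?_, α.compProj_mem_closedBall hpl.mul_max_le⟩⟩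
    · have : α.compProj ((⟨0, h0⟩ : Icc (0 : ℝ) T) : ℝ) = x := by
        rw [ODE.FunSpace.compProj_val, ← hα, ODE.FunSpace.next_apply₀]
      exact this
    · apply ODE.hasDerivWithinAt_picard_Icc (⟨0, h0⟩ : Icc (0 : ℝ) T).2
        hpl.continuousOn_uncurry
        α.continuous_compProj.continuousOn (fun _ ht' ↦ α.compProj_mem_closedBall hpl.mul_max_le)
        x ht |>.congr_of_mem _ ht
      intro t' ht'
      nth_rw 1 [← hα]
      rw [ODE.FunSpace.compProj_of_mem ht', ODE.FunSpace.next_apply]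
  choose! α hα using key
  exact ⟨α, hα⟩

lemma hasDerivWithinAt_Ici_of_Icc {V : Type*} [NormedAddCommGroup V] [NormedSpace ℝ V]
    {f : ℝ → V} {f' : V} {a b t : ℝ}
    (h : HasDerivWithinAt f f' (Icc a b) t) (ht : t ∈ Ico a b) : HasDerivWithinAt f f' (Ici t) t :=
  h.mono_of_mem_nhdsWithin (Icc_mem_nhdsGE_of_mem ht)

lemma hasDerivWithinAt_Iic_of_Icc {V : Type*} [NormedAddCommGroup V] [NormedSpace ℝ V]
    {f : ℝ → V} {f' : V} {a b t : ℝ}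
    (h : HasDerivWithinAt f f' (Icc a b) t) (ht : t ∈ Ioc a b) : HasDerivWithinAt f f' (Iic t) t :=
  h.mono_of_mem_nhdsWithin (Icc_mem_nhdsLE_of_mem ht)

end ODE

/-! ### Differentiability of a local flow and Liouville's theorem. -/

section LocalFlow

variable {V : Type*} [NormedAddCommGroup V] [NormedSpace ℝ V] [FiniteDimensional ℝ V]

/-- Uniform first order Taylor estimate for a `C¹` map on a compact ball. -/
lemma exists_uniform_taylor {S : V → V} {Ω : Set V} (hΩ : IsOpen Ω) (hS : ContDiffOn ℝ 1 S Ω)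
    {p : V} {a : ℝ} (ha : Metric.closedBall p a ⊆ Ω) {η : ℝ} (hη : 0 < η) :
    ∃ δ > 0, ∀ x ∈ Metric.closedBall p a, ∀ h : V, x + h ∈ Metric.closedBall p a → ‖h‖ < δ →
      ‖S (x + h) - S x - fderiv ℝ S x h‖ ≤ η * ‖h‖ := by
  have hcont : ContinuousOn (fderiv ℝ S) (Metric.closedBall p a) :=
    (hS.continuousOn_fderiv_of_isOpen hΩ le_rfl).mono ha
  have hu := (isCompact_closedBall p a).uniformContinuousOn_of_continuous hcont
  obtain ⟨δ, hδ, hδ'⟩ := Metric.uniformContinuousOn_iff.1 hu η hη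
  refine ⟨δ, hδ, fun x hx h hxh hh => ?_⟩
  have hconv : Convex ℝ (Metric.closedBall p a ∩ Metric.ball x δ) :=
    (convex_closedBall p a).inter (convex_ball x δ)
  have := hconv.norm_image_sub_le_of_norm_hasFDerivWithin_le' (f := S) (f' := fderiv ℝ S)
    (φ := fderiv ℝ S x) (C := η) (x := x) (y := x + h)
    (fun y hy => ((hS.differentiableOn one_ne_zero).differentiableAt
      (hΩ.mem_nhds (ha hy.1))).hasFDerivAt.hasFDerivWithinAt)
    (fun y hy => by
      rw [← dist_eq_norm]
      exact (hδ' y hy.1 x hx hy.2).le)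
    ⟨hx, Metric.mem_ball_self hδ⟩ ⟨hxh, by simpa [dist_eq_norm] using hh⟩
  simpa using this

/-- The flow of a `C¹` vector field is differentiable in the initial value; its derivative solves
the linearised equation. -/
lemma hasFDerivAt_flow {S : V → V} {Ω : Set V} (hΩ : IsOpen Ω) (hS : ContDiffOn ℝ 1 S Ω)
    {p : V} {a r T : ℝ} {K : ℝ≥0} (ha0 : 0 < a) (ha : Metric.closedBall p a ⊆ Ω) (hT : 0 ≤ T)
    (hK : LipschitzOnWith K S (Metric.closedBall p a))
    {α : V → ℝ → V} (hα : ∀ x ∈ Metric.ball p r, α x 0 = x ∧ ∀ t ∈ Icc 0 T,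
      HasDerivWithinAt (α x) (S (α x t)) (Icc 0 T) t ∧ α x t ∈ Metric.closedBall p (a / 2))
    {x : V} (hx : x ∈ Metric.ball p r) {W : ℝ → V →L[ℝ] V} (hW0 : W 0 = ContinuousLinearMap.id ℝ V)
    (hW : ∀ t ∈ Icc 0 T, HasDerivWithinAt W ((fderiv ℝ S (α x t)).comp (W t)) (Icc 0 T) t)
    (hW2 : ∀ t ∈ Icc 0 T, ‖W t‖ ≤ 2) {t : ℝ} (ht : t ∈ Icc 0 T) :
    HasFDerivAt (fun z => α z t) (W t) x := by
  have hcball : ∀ y, y ∈ Metric.closedBall p (a / 2) → y ∈ Metric.closedBall p a := fun y hy =>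
    Metric.closedBall_subset_closedBall (by linarith) hy
  rw [hasFDerivAt_iff_isLittleO_nhds_zero, Asymptotics.isLittleO_iff]
  intro c hc
  -- The curve `α x t + W t k` solves the equation up to an error `η · 2‖k‖`, with `η` from the
  -- Taylor estimate, and the Grönwall bound is linear in that error. Taking `K + 1` instead of `K`
  -- makes the constant nonzero, so that the closed form of the bound applies.
  set C := gronwallBound 0 (K + 1) 2 T with hC
  have hC0 : 0 ≤ C := by
    rw [hC, gronwallBound_of_K_ne_0 (by positivity)]
    have : 1 ≤ Real.exp ((K + 1) * T) := Real.one_le_exp (by positivity)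
    have h2 : (0 : ℝ) ≤ 2 / (K + 1) * (Real.exp ((K + 1) * T) - 1) :=
      mul_nonneg (by positivity) (by linarith)
    simpa using h2
  obtain ⟨δ, hδ, hδ'⟩ := exists_uniform_taylor hΩ hS ha (η := c / (C + 1)) (by positivity)
  have hev1 : ∀ᶠ k : V in 𝓝 0, x + k ∈ Metric.ball p r := by
    have : Filter.Tendsto (fun k : V => x + k) (𝓝 0) (𝓝 x) := by
      exact (continuous_const.add continuous_id).tendsto' (0 : V) x (add_zero x)
    exact this.eventually (Metric.isOpen_ball.mem_nhds hx)
  have hev2 : ∀ᶠ k : V in 𝓝 0, ‖k‖ < min (δ / 2) (a / 4) := by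
    have := Metric.ball_mem_nhds (0 : V) (ε := min (δ / 2) (a / 4)) (by positivity)
    filter_upwards [this] with k hk using by simpa using hk
  filter_upwards [hev1, hev2] with k hk1 hk2
  have hk3 : ‖k‖ < δ / 2 := hk2.trans_le (min_le_left _ _)
  have hk4 : ‖k‖ < a / 4 := hk2.trans_le (min_le_right _ _)
  have hWk : ∀ t ∈ Icc 0 T, ‖W t k‖ ≤ 2 * ‖k‖ := fun t ht =>
    ((W t).le_opNorm k).trans (mul_le_mul_of_nonneg_right (hW2 t ht) (norm_nonneg _))
  -- The flow uses up the radius `a / 2`; since `‖k‖ < a / 4` and `‖W t‖ ≤ 2`, the perturbation fits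
  -- into the other half.
  have hz : ∀ t ∈ Icc 0 T, α x t + W t k ∈ Metric.closedBall p a := fun t ht => by
    have h1 := ((hα x hx).2 t ht).2
    have h2 := hWk t ht
    rw [mem_closedBall_iff_norm] at h1 ⊢
    calc ‖α x t + W t k - p‖ = ‖(α x t - p) + W t k‖ := by congr 1; abel
      _ ≤ _ := norm_add_le _ _
      _ ≤ a := by linarith
  have hzd : ∀ t ∈ Icc 0 T, HasDerivWithinAt (fun t => α x t + W t k)
      (S (α x t) + fderiv ℝ S (α x t) (W t k)) (Icc 0 T) t := fun t ht =>
    ((hα x hx).2 t ht).1.add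
      ((ContinuousLinearMap.apply ℝ V k).hasFDerivAt.comp_hasDerivWithinAt t (hW t ht))
  have hmain := dist_le_of_approx_trajectories_ODE_of_mem (v := fun _ => S)
    (s := fun _ => Metric.closedBall p a) (K := K + 1) (a := 0) (b := T)
    (f := fun t => α (x + k) t) (f' := fun t => S (α (x + k) t)) (εf := 0)
    (g := fun t => α x t + W t k) (g' := fun t => S (α x t) + fderiv ℝ S (α x t) (W t k))
    (εg := c / (C + 1) * (2 * ‖k‖)) (δ := 0)
    (fun t _ => hK.weaken (by simp))
    (fun t ht => ((hα _ hk1).2 t ht).1.continuousWithinAt)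
    (fun t ht => hasDerivWithinAt_Ici_of_Icc ((hα _ hk1).2 t (Ico_subset_Icc_self ht)).1 ht)
    (fun t _ => by simp)
    (fun t ht => hcball _ ((hα _ hk1).2 t (Ico_subset_Icc_self ht)).2)
    (fun t ht => (hzd t ht).continuousWithinAt)
    (fun t ht => hasDerivWithinAt_Ici_of_Icc (hzd t (Ico_subset_Icc_self ht)) ht)
    (fun t ht => by
      have ht' := Ico_subset_Icc_self ht
      have h1 := hδ' (α x t) (hcball _ ((hα x hx).2 t ht').2) (W t k) (hz t ht')
        (by linarith [hWk t ht'])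
      rw [dist_comm, dist_eq_norm]
      calc _ = ‖S (α x t + W t k) - S (α x t) - fderiv ℝ S (α x t) (W t k)‖ := by
            congr 1; abel
        _ ≤ _ := h1
        _ ≤ _ := mul_le_mul_of_nonneg_left (hWk t ht') (by positivity))
    (fun t ht => hz t (Ico_subset_Icc_self ht))
    (by simp [(hα _ hk1).1, (hα _ hx).1, hW0]) t ht
  rw [dist_eq_norm] at hmain
  have hmono : gronwallBound 0 (↑(K + 1)) (0 + c / (C + 1) * (2 * ‖k‖)) (t - 0) ≤
      c / (C + 1) * ‖k‖ * C := by
    have hq : 0 ≤ c / (C + 1) := by positivity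
    generalize c / (C + 1) = q at hq
    rw [hC, gronwallBound_of_K_ne_0 (by positivity), gronwallBound_of_K_ne_0 (by positivity)]
    have h1 : Real.exp ((K + 1) * t) ≤ Real.exp ((K + 1) * T) :=
      Real.exp_le_exp.2 (mul_le_mul_of_nonneg_left ht.2 (by positivity))
    push_cast
    simp only [sub_zero, zero_mul, zero_add]
    have h2 : (0 : ℝ) ≤ q * ‖k‖ * (2 / (K + 1)) := by positivity
    calc _ = q * ‖k‖ * (2 / (K + 1)) * (Real.exp ((K + 1) * t) - 1) := by ring
      _ ≤ q * ‖k‖ * (2 / (K + 1)) * (Real.exp ((K + 1) * T) - 1) :=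
        mul_le_mul_of_nonneg_left (by linarith) h2
      _ = _ := by ring
  calc _ = ‖α (x + k) t - (α x t + W t k)‖ := by congr 1; abel
    _ ≤ _ := hmain
    _ ≤ _ := hmono
    _ = c * ‖k‖ * (C / (C + 1)) := by ring
    _ ≤ c * ‖k‖ * 1 := mul_le_mul_of_nonneg_left
      ((div_le_one (by positivity)).2 (by linarith)) (by positivity)
    _ = c * ‖k‖ := mul_one _

/-- **Liouville's theorem**, local form: the local flow of a vector field `S` with
`div (ρ S) = 0` preserves the density `ρ`. -/
theorem exists_local_flow_preserving_density [MeasurableSpace V] [BorelSpace V] (μ : Measure V)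
    [μ.IsAddHaarMeasure] {S : V → V} {ρ : V → ℝ} {Ω : Set V} (hΩ : IsOpen Ω)
    (hS : ContDiffOn ℝ 1 S Ω) (hρ : DifferentiableOn ℝ ρ Ω) (hpos : ∀ x ∈ Ω, 0 < ρ x)
    (hdiv : ∀ x ∈ Ω, fderiv ℝ ρ x (S x) + ρ x * LinearMap.trace ℝ V (fderiv ℝ S x) = 0)
    {p : V} (hp : p ∈ Ω) :
    ∃ r > 0, ∃ T > 0, ∃ α : V → ℝ → V,
      (∀ x ∈ Metric.ball p r, α x 0 = x ∧ ∀ t ∈ Icc 0 T,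
        HasDerivWithinAt (α x) (S (α x t)) (Icc 0 T) t ∧ α x t ∈ Ω) ∧
      ∀ t ∈ Icc 0 T, ContinuousOn (fun x => α x t) (Metric.ball p r) ∧
        ∀ A ⊆ Metric.ball p r, MeasurableSet A → MeasurableSet ((fun x => α x t) '' A) ∧
          ∫⁻ y in (fun x => α x t) '' A, ENNReal.ofReal (ρ y) ∂μ =
            ∫⁻ x in A, ENNReal.ofReal (ρ x) ∂μ := by
  obtain ⟨K, U, hU, hKU⟩ := (hS.contDiffAt (hΩ.mem_nhds hp)).exists_lipschitzOnWith
  obtain ⟨b, hb, hbU⟩ := Metric.mem_nhds_iff.1 (Filter.inter_mem hU (hΩ.mem_nhds hp))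
  set a := b / 2 with ha_def
  have ha : 0 < a := by positivity
  have hab : Metric.closedBall p a ⊆ Metric.ball p b := Metric.closedBall_subset_ball (by linarith)
  have haΩ : Metric.closedBall p a ⊆ Ω := fun x hx => (hbU (hab hx)).2
  have hKa : LipschitzOnWith K S (Metric.closedBall p a) := hKU.mono fun x hx => (hbU (hab hx)).1
  have hDK : ∀ x ∈ Metric.closedBall p a, ‖fderiv ℝ S x‖ ≤ K := fun x hx =>
    norm_fderiv_le_of_lipschitzOn ℝ (Metric.isOpen_ball.mem_nhds (hab hx))
      (hKU.mono fun x hx => (hbU hx).1)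
  obtain ⟨L, hL⟩ := (isCompact_closedBall p a).exists_bound_of_continuousOn
    (hS.continuousOn.mono haΩ)
  have hL0 : 0 ≤ L := (norm_nonneg _).trans (hL p (Metric.mem_closedBall_self ha.le))
  -- The first bound keeps solutions that start within `a / 4` of `p` inside the ball of radius `a /
  -- 2`. The second keeps the linearised solution within distance one of the identity, whence `‖W‖ ≤
  -- 2`.
  set T := min (a / (4 * (L + 1))) (1 / (2 * (K + 1))) with hT_def
  have hT : 0 < T := by positivity
  have hTL : L * T ≤ a / 2 - a / 4 := by
    have h1 : T ≤ a / (4 * (L + 1)) := min_le_left _ _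
    calc L * T ≤ L * (a / (4 * (L + 1))) := mul_le_mul_of_nonneg_left h1 hL0
      _ = a / 4 * (L / (L + 1)) := by field_simp
      _ ≤ a / 4 * 1 := mul_le_mul_of_nonneg_left
        ((div_le_one (by positivity)).2 (by linarith)) (by positivity)
      _ = _ := by ring
  have hTK : 2 * K * T ≤ 1 := by
    have h1 : T ≤ 1 / (2 * (K + 1)) := min_le_right _ _
    calc 2 * K * T ≤ 2 * K * (1 / (2 * (K + 1))) := mul_le_mul_of_nonneg_left h1 (by positivity)
      _ = (K : ℝ) / (K + 1) := by field_simp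
      _ ≤ 1 := (div_le_one (by positivity)).2 (by linarith)
  have hsub : Metric.closedBall p (a / 2) ⊆ Metric.closedBall p a :=
    Metric.closedBall_subset_closedBall (by linarith)
  obtain ⟨α, hα'⟩ := exists_solutions_mem_closedBall (S := fun _ => S) (p := p) (a := a / 2)
    (r := a / 4) (L := L) (T := T) (K := K) (by positivity) hL0 hT.le
    (fun _ _ => hKa.mono hsub) (fun _ _ => continuousOn_const)
    (fun _ _ x hx => hL x (hsub hx)) hTL
  have hα : ∀ x ∈ Metric.ball p (a / 4), α x 0 = x ∧ ∀ t ∈ Icc 0 T,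
      HasDerivWithinAt (α x) (S (α x t)) (Icc 0 T) t ∧ α x t ∈ Metric.closedBall p (a / 2) :=
    fun x hx => hα' x (Metric.ball_subset_closedBall hx)
  have hlin : ∀ x ∈ Metric.ball p (a / 4), ∃ W : ℝ → V →L[ℝ] V,
      W 0 = ContinuousLinearMap.id ℝ V ∧ ∀ t ∈ Icc 0 T,
        HasDerivWithinAt W ((fderiv ℝ S (α x t)).comp (W t)) (Icc 0 T) t ∧
          W t ∈ Metric.closedBall (ContinuousLinearMap.id ℝ V) 1 := fun x hx => by
    have hnorm : ∀ W ∈ Metric.closedBall (ContinuousLinearMap.id ℝ V) 1, ‖W‖ ≤ 2 := fun W hW => by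
      rw [mem_closedBall_iff_norm] at hW
      calc ‖W‖ = ‖(W - ContinuousLinearMap.id ℝ V) + ContinuousLinearMap.id ℝ V‖ := by simp
        _ ≤ _ := norm_add_le _ _
        _ ≤ 1 + 1 := add_le_add hW ContinuousLinearMap.norm_id_le
        _ = 2 := by norm_num
    obtain ⟨W, hW⟩ := exists_solutions_mem_closedBall (V := V →L[ℝ] V)
      (S := fun t W => (fderiv ℝ S (α x t)).comp W) (p := ContinuousLinearMap.id ℝ V) (a := 1)
      (r := 0) (L := 2 * K) (T := T) (K := K) le_rfl (by positivity) hT.le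
      (fun t ht => LipschitzOnWith.of_dist_le_mul fun W _ W' _ => by
        rw [dist_eq_norm, dist_eq_norm, ← ContinuousLinearMap.comp_sub]
        exact (ContinuousLinearMap.opNorm_comp_le _ _).trans (mul_le_mul_of_nonneg_right
          (hDK _ (hsub ((hα x hx).2 t ht).2)) (norm_nonneg _)))
      (fun W _ => by
        have h1 : ContinuousOn (fun t => fderiv ℝ S (α x t)) (Icc 0 T) :=
          ((hS.continuousOn_fderiv_of_isOpen hΩ le_rfl).mono haΩ).comp
            (fun t ht => ((hα x hx).2 t ht).1.continuousWithinAt)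
            (fun t ht => hsub ((hα x hx).2 t ht).2)
        exact h1.clm_comp continuousOn_const)
      (fun t ht W hW => by
        refine (ContinuousLinearMap.opNorm_comp_le _ _).trans ?_
        rw [mul_comm 2 (K : ℝ)]
        exact mul_le_mul (hDK _ (hsub ((hα x hx).2 t ht).2)) (hnorm W hW) (norm_nonneg _)
          (by positivity))
      (by linarith)
    exact ⟨W _, hW _ (Metric.mem_closedBall_self le_rfl)⟩
  choose! W hW0 hW using hlin
  have hW2 : ∀ x ∈ Metric.ball p (a / 4), ∀ t ∈ Icc 0 T, ‖W x t‖ ≤ 2 := fun x hx t ht => by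
    have hW := mem_closedBall_iff_norm.1 (hW x hx t ht).2
    calc ‖W x t‖ = ‖(W x t - ContinuousLinearMap.id ℝ V) + ContinuousLinearMap.id ℝ V‖ := by simp
      _ ≤ _ := norm_add_le _ _
      _ ≤ 1 + 1 := add_le_add hW ContinuousLinearMap.norm_id_le
      _ = 2 := by norm_num
  have hderiv : ∀ x ∈ Metric.ball p (a / 4), ∀ t ∈ Icc 0 T,
      HasFDerivAt (fun z => α z t) (W x t) x := fun x hx t ht =>
    hasFDerivAt_flow hΩ hS ha haΩ hT.le hKa hα hx (hW0 x hx) (fun t ht => (hW x hx t ht).1)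
      (hW2 x hx) ht
  -- The time derivative of density times Jacobian is the expression in `hdiv`, multiplied by the
  -- Jacobian.
  have hdet : ∀ x ∈ Metric.ball p (a / 4), ∀ t ∈ Icc 0 T,
      ρ (α x t) * (W x t).det = ρ x := fun x hx t ht => by
    have hd : ∀ t ∈ Icc 0 T, HasDerivWithinAt (fun t => ρ (α x t) * (W x t).det) 0 (Icc 0 T) t :=
      fun t ht => by
        have hΩt := haΩ (hsub ((hα x hx).2 t ht).2)
        have h1 := (hρ.differentiableAt (hΩ.mem_nhds hΩt)).hasFDerivAt.comp_hasDerivWithinAt t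
          ((hα x hx).2 t ht).1
        have h2 := hasDerivWithinAt_det_of_linear_ode (hW x hx t ht).1
        refine (h1.mul h2).congr_deriv ?_
        have h3 := hdiv _ hΩt
        have h4 : ∀ u v w d : ℝ, u + v * w = 0 → u * d + v * (w * d) = 0 := fun u v w d h => by
          linear_combination d * h
        exact h4 _ _ _ _ h3
    have := constant_of_has_deriv_right_zero (fun t ht => (hd t ht).continuousWithinAt)
      (fun t ht => hasDerivWithinAt_Ici_of_Icc (hd t (Ico_subset_Icc_self ht)) ht) t ht
    rw [this, (hα x hx).1, hW0 x hx, ContinuousLinearMap.det]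
    simp
  -- Uniqueness is applied backwards in time, from the common end point.
  have hinj : ∀ t ∈ Icc 0 T, InjOn (fun x => α x t) (Metric.ball p (a / 4)) :=
    fun t ht x hx y hy hxy => by
      have hIcc : Icc 0 t ⊆ Icc 0 T := Icc_subset_Icc_right ht.2
      have := ODE_solution_unique_of_mem_Icc_left (v := fun _ => S)
        (s := fun _ => Metric.closedBall p a) (K := K) (a := 0) (b := t) (f := α x) (g := α y)
        (fun _ _ => hKa)
        (fun s hs => (((hα x hx).2 s (hIcc hs)).1.mono hIcc).continuousWithinAt)
        (fun s hs => hasDerivWithinAt_Iic_of_Icc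
          (((hα x hx).2 s (hIcc (Ioc_subset_Icc_self hs))).1.mono hIcc) hs)
        (fun s hs => hsub ((hα x hx).2 s (hIcc (Ioc_subset_Icc_self hs))).2)
        (fun s hs => (((hα y hy).2 s (hIcc hs)).1.mono hIcc).continuousWithinAt)
        (fun s hs => hasDerivWithinAt_Iic_of_Icc
          (((hα y hy).2 s (hIcc (Ioc_subset_Icc_self hs))).1.mono hIcc) hs)
        (fun s hs => hsub ((hα y hy).2 s (hIcc (Ioc_subset_Icc_self hs))).2) hxy
      have h0 := this ⟨le_rfl, ht.1⟩
      simpa [(hα x hx).1, (hα y hy).1] using h0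
  refine ⟨a / 4, by positivity, T, hT, α, fun x hx => ⟨(hα x hx).1, fun t ht =>
    ⟨((hα x hx).2 t ht).1, haΩ (hsub ((hα x hx).2 t ht).2)⟩⟩, fun t ht =>
    ⟨fun x hx => (hderiv x hx t ht).continuousAt.continuousWithinAt, fun A hA hAm => ⟨?_, ?_⟩⟩⟩
  · exact measurable_image_of_fderivWithin hAm
      (fun x hx => (hderiv x (hA hx) t ht).hasFDerivWithinAt) ((hinj t ht).mono hA)
  · rw [lintegral_image_eq_lintegral_abs_det_fderiv_mul μ hAm
      (fun x hx => (hderiv x (hA hx) t ht).hasFDerivWithinAt) ((hinj t ht).mono hA)]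
    refine setLIntegral_congr_fun hAm fun x hx => ?_
    have h1 := hdet x (hA hx) t ht
    have h2 := hpos _ (haΩ (hsub ((hα x (hA hx)).2 t ht).2))
    have h3 : 0 < ρ x := hpos x (by
      have := haΩ (hsub ((hα x (hA hx)).2 0 ⟨le_rfl, hT.le⟩).2)
      rwa [(hα x (hA hx)).1] at this)
    have h4 : 0 ≤ (W x t).det := by
      by_contra hneg
      push Not at hneg
      nlinarith [mul_neg_of_pos_of_neg h2 hneg]
    rw [← ENNReal.ofReal_mul (abs_nonneg _), abs_of_nonneg h4, mul_comm, h1]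

end LocalFlow

/-! ### The spray of a squared metric in coordinates, and its behaviour under changes of
coordinates. -/

section Local

variable {n : ℕ}

/-- The matrix `½ ∂²E/∂yⁱ∂yʲ`. -/
def tensorOf (E : Coord n × Coord n → ℝ) (p : Coord n × Coord n) : Matrix (Fin n) (Fin n) ℝ :=
  Matrix.of fun i j => (1 / 2) * partialY i (partialY j E) p

/-- The spray coefficients of the squared metric `E`. -/
def sprayCoeffOf (E : Coord n × Coord n → ℝ) (p : Coord n × Coord n) : Coord n :=
  WithLp.toLp 2 fun i => (1 / 4) * ∑ l, (tensorOf E p)⁻¹ i l *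
    ((∑ k, partialX k (partialY l E) p * p.2 k) - partialX l E p)

/-- The spray of the squared metric `E`, as a vector field in the coordinates `(x, y)`. -/
def sprayOf (E : Coord n × Coord n → ℝ) (p : Coord n × Coord n) : Coord n × Coord n :=
  (p.2, (-2 : ℝ) • sprayCoeffOf E p)

/-- The second derivative of `E` at `p`. -/
abbrev hess (E : Coord n × Coord n → ℝ) (p : Coord n × Coord n) :
    Coord n × Coord n →L[ℝ] Coord n × Coord n →L[ℝ] ℝ :=
  fderiv ℝ (fderiv ℝ E) p

lemma sum_single (w : Coord n) : w = ∑ i, w i • EuclideanSpace.single i (1 : ℝ) := by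
  ext j
  simp [Pi.single_apply]

lemma prod_sum_right (w : Coord n) :
    ((0 : Coord n), w) = ∑ i, w i • ((0 : Coord n), EuclideanSpace.single i (1 : ℝ)) := by
  conv_lhs => rw [sum_single w]
  simp [Prod.ext_iff, Prod.fst_sum, Prod.snd_sum]

lemma prod_sum_left (w : Coord n) :
    (w, (0 : Coord n)) = ∑ i, w i • (EuclideanSpace.single i (1 : ℝ), (0 : Coord n)) := by
  conv_lhs => rw [sum_single w]
  simp [Prod.ext_iff, Prod.fst_sum, Prod.snd_sum]

variable {E : Coord n × Coord n → ℝ} {p : Coord n × Coord n}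

lemma differentiableAt_fderiv' {G : Type*} [NormedAddCommGroup G] [NormedSpace ℝ G]
    {φ : Coord n × Coord n → G} (hφ : ContDiffAt ℝ 2 φ p) : DifferentiableAt ℝ (fderiv ℝ φ) p :=
  (hφ.fderiv_right (m := 1) (by norm_num)).differentiableAt one_ne_zero

lemma differentiableAt_fderiv (hE : ContDiffAt ℝ 2 E p) : DifferentiableAt ℝ (fderiv ℝ E) p :=
  (hE.fderiv_right (m := 1) (by norm_num)).differentiableAt one_ne_zero

lemma hess_symm (hE : ContDiffAt ℝ 2 E p) (V W : Coord n × Coord n) :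
    hess E p V W = hess E p W V :=
  (hE.isSymmSndFDerivAt (by simp)).eq V W

lemma hasFDerivAt_fderiv_apply (hE : ContDiffAt ℝ 2 E p) (W : Coord n × Coord n) :
    HasFDerivAt (fun q => fderiv ℝ E q W) ((hess E p).flip W) p := by
  have := (differentiableAt_fderiv hE).hasFDerivAt.clm_apply (hasFDerivAt_const W p)
  simpa using this

lemma fderiv_fderiv_apply (hE : ContDiffAt ℝ 2 E p) (V W : Coord n × Coord n) :
    fderiv ℝ (fun q => fderiv ℝ E q W) p V = hess E p V W := by
  rw [(hasFDerivAt_fderiv_apply hE W).fderiv]; rfl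

lemma tensorOf_apply (hE : ContDiffAt ℝ 2 E p) (i j : Fin n) :
    tensorOf E p i j = 1 / 2 * hess E p (0, EuclideanSpace.single i 1)
      (0, EuclideanSpace.single j 1) := by
  rw [← fderiv_fderiv_apply hE]; rfl

lemma hess_right_apply (hE : ContDiffAt ℝ 2 E p) (v w : Coord n) :
    hess E p (0, v) (0, w) = 2 * ∑ i, ∑ j, v i * w j * tensorOf E p i j := by
  rw [prod_sum_right v, prod_sum_right w]
  simp only [map_sum, sum_apply, map_smul, smul_apply,
    smul_eq_mul, tensorOf_apply hE, Finset.mul_sum]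
  refine Finset.sum_comm.trans (Finset.sum_congr rfl fun i _ => Finset.sum_congr rfl fun j _ => ?_)
  ring

lemma tensorOf_symm (hE : ContDiffAt ℝ 2 E p) (i j : Fin n) :
    tensorOf E p i j = tensorOf E p j i := by
  rw [tensorOf_apply hE, tensorOf_apply hE, hess_symm hE]

lemma tensorOf_posDef (hE : ContDiffAt ℝ 2 E p)
    (hpos : ∀ w : Coord n, w ≠ 0 → 0 < hess E p (0, w) (0, w)) : (tensorOf E p).PosDef := by
  refine Matrix.PosDef.of_dotProduct_mulVec_pos ?_ fun w hw => ?_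
  · ext i j
    simp [Matrix.conjTranspose_apply, tensorOf_symm hE j i]
  · have h := hpos (WithLp.toLp 2 w) (by simpa using hw)
    rw [hess_right_apply hE] at h
    have h2 : star w ⬝ᵥ (tensorOf E p).mulVec w = ∑ i, ∑ j, w i * w j * tensorOf E p i j := by
      simp only [dotProduct, Matrix.mulVec, star_trivial, Finset.mul_sum]
      exact Finset.sum_congr rfl fun i _ => Finset.sum_congr rfl fun j _ => by ring
    rw [h2]
    simpa using h

/-- The Euler–Lagrange equation of `E`. On vertical vectors the Hessian is `2 g`, so the term `-2
Gⁱ` contributes `-4 g G`, which cancels the inverse matrix and the factor `1 / 4` in the spray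
coefficients. Later facts about the spray use this identity instead of the formula with `g⁻¹`. -/
lemma hess_sprayOf (hE : ContDiffAt ℝ 2 E p)
    (hpos : ∀ w : Coord n, w ≠ 0 → 0 < hess E p (0, w) (0, w)) (w : Coord n) :
    hess E p (sprayOf E p) (0, w) = fderiv ℝ E p (w, 0) := by
  have hdet : IsUnit (tensorOf E p).det := (tensorOf_posDef hE hpos).det_pos.ne'.isUnit
  have key : ∀ l, hess E p (sprayOf E p) (0, EuclideanSpace.single l 1) =
      fderiv ℝ E p (EuclideanSpace.single l 1, 0) := fun l => by
    set B : Fin n → ℝ := fun l =>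
      (∑ k, partialX k (partialY l E) p * p.2 k) - partialX l E p with hB
    have h1 : sprayOf E p = (p.2, 0) + (0, (-2 : ℝ) • sprayCoeffOf E p) := by
      simp [sprayOf]
    have h2 : hess E p (p.2, 0) (0, EuclideanSpace.single l 1) =
        ∑ k, partialX k (partialY l E) p * p.2 k := by
      rw [prod_sum_left p.2]
      simp only [map_sum, sum_apply, map_smul, smul_apply,
        smul_eq_mul]
      refine Finset.sum_congr rfl fun k _ => ?_
      rw [← fderiv_fderiv_apply hE, mul_comm]; rfl
    have h3 : hess E p (0, (-2 : ℝ) • sprayCoeffOf E p) (0, EuclideanSpace.single l 1) = - B l := by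
      rw [hess_right_apply hE]
      have h4 : ∑ i, sprayCoeffOf E p i * tensorOf E p l i = 1 / 4 * B l := by
        have h5 : (tensorOf E p * (tensorOf E p)⁻¹).mulVec B l = B l := by
          rw [Matrix.mul_nonsing_inv _ hdet, Matrix.one_mulVec]
        rw [← h5, ← Matrix.mulVec_mulVec]
        simp only [Matrix.mulVec, dotProduct, Finset.mul_sum, sprayCoeffOf, hB, Finset.sum_mul]
        refine Finset.sum_congr rfl fun i _ => Finset.sum_congr rfl fun j _ => ?_
        ring
      have h6 : ∀ i, ∑ j, ((-2 : ℝ) • sprayCoeffOf E p) i *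
          (EuclideanSpace.single l (1 : ℝ) : Coord n) j * tensorOf E p i j =
          -2 * (sprayCoeffOf E p i * tensorOf E p l i) := fun i => by
        rw [Finset.sum_eq_single l]
        · simp [tensorOf_symm hE l i, mul_assoc]
        · intro j _ hj
          simp [hj]
        · simp
      simp only [h6, ← Finset.mul_sum, h4]
      ring
    rw [h1, map_add, add_apply, h2, h3, hB]
    simp only [partialX]
    ring
  rw [prod_sum_right w, prod_sum_left w]
  simp only [map_sum, map_smul, key]

/-- Two solutions of the Euler–Lagrange identity with the same horizontal part differ by a vertical
vector that is null for the Hessian, which is definite there. -/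
lemma eq_sprayOf (hE : ContDiffAt ℝ 2 E p)
    (hpos : ∀ w : Coord n, w ≠ 0 → 0 < hess E p (0, w) (0, w)) {V : Coord n × Coord n}
    (hV : V.1 = p.2) (h : ∀ w : Coord n, hess E p V (0, w) = fderiv ℝ E p (w, 0)) :
    V = sprayOf E p := by
  have h1 : V - sprayOf E p = (0, V.2 - (sprayOf E p).2) := by
    ext1 <;> simp [hV, sprayOf]
  by_contra hne
  have h2 : V.2 - (sprayOf E p).2 ≠ 0 := fun h0 => hne (by
    rw [← sub_eq_zero, h1, h0]; rfl)
  have h3 := hpos _ h2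
  have h4 : hess E p (V - sprayOf E p) (0, V.2 - (sprayOf E p).2) = 0 := by
    rw [map_sub, sub_apply, h, hess_sprayOf hE hpos, sub_self]
  rw [h1] at h4
  exact h3.ne' h4

/-- The map of tangent spaces `(x, y) ↦ (ψ x, ψ'(x) y)` in coordinates. -/
def tangentLift (ψ : Coord n → Coord n) (q : Coord n × Coord n) : Coord n × Coord n :=
  (ψ q.1, fderiv ℝ ψ q.1 q.2)

lemma hasFDerivAt_tangentLift {ψ : Coord n → Coord n} {q : Coord n × Coord n}
    (hψ : ContDiffAt ℝ 2 ψ q.1) :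
    HasFDerivAt (tangentLift ψ)
      (((fderiv ℝ ψ q.1).comp (ContinuousLinearMap.fst ℝ (Coord n) (Coord n))).prod
        ((fderiv ℝ ψ q.1).comp (ContinuousLinearMap.snd ℝ (Coord n) (Coord n)) +
          ((fderiv ℝ (fderiv ℝ ψ) q.1).flip q.2).comp
            (ContinuousLinearMap.fst ℝ (Coord n) (Coord n)))) q := by
  have h1 := (hψ.differentiableAt two_ne_zero).hasFDerivAt.comp q hasFDerivAt_fst
  have h2 := ((hψ.fderiv_right (m := 1) (by norm_num)).differentiableAt
    one_ne_zero).hasFDerivAt.comp q hasFDerivAt_fst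
  exact h1.prodMk (h2.clm_apply hasFDerivAt_snd)

lemma fderiv_tangentLift_apply {ψ : Coord n → Coord n} {q : Coord n × Coord n}
    (hψ : ContDiffAt ℝ 2 ψ q.1) (a b : Coord n) :
    fderiv ℝ (tangentLift ψ) q (a, b) =
      (fderiv ℝ ψ q.1 a, fderiv ℝ ψ q.1 b + fderiv ℝ (fderiv ℝ ψ) q.1 a q.2) := by
  rw [(hasFDerivAt_tangentLift hψ).fderiv]
  rfl

lemma fderiv_comp_tangentLift {E E' : Coord n × Coord n → ℝ} {ψ : Coord n → Coord n}
    {p : Coord n × Coord n} (hψ : ContDiffAt ℝ 2 ψ p.1)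
    (hE' : ContDiffAt ℝ 2 E' (tangentLift ψ p)) (heq : E =ᶠ[𝓝 p] fun q => E' (tangentLift ψ q)) :
    fderiv ℝ E p = (fderiv ℝ E' (tangentLift ψ p)).comp (fderiv ℝ (tangentLift ψ) p) := by
  rw [heq.fderiv_eq]
  exact ((hE'.differentiableAt two_ne_zero).hasFDerivAt.comp p
    (hasFDerivAt_tangentLift hψ).differentiableAt.hasFDerivAt).fderiv

/-- The second term appears because the lifted vertical vector `(0, ψ'(x) w)` moves with `x`. -/
lemma hess_comp_tangentLift {E E' : Coord n × Coord n → ℝ} {ψ : Coord n → Coord n}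
    {p : Coord n × Coord n} (hψ : ContDiffAt ℝ 2 ψ p.1) (hE : ContDiffAt ℝ 2 E p)
    (hE' : ContDiffAt ℝ 2 E' (tangentLift ψ p)) (heq : E =ᶠ[𝓝 p] fun q => E' (tangentLift ψ q))
    (V : Coord n × Coord n) (w : Coord n) :
    hess E p V (0, w) =
      hess E' (tangentLift ψ p) (fderiv ℝ (tangentLift ψ) p V) (0, fderiv ℝ ψ p.1 w) +
      fderiv ℝ E' (tangentLift ψ p) (0, fderiv ℝ (fderiv ℝ ψ) p.1 V.1 w) := by
  have hψ1 : ∀ᶠ q : Coord n × Coord n in 𝓝 p, ContDiffAt ℝ 2 ψ q.1 :=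
    continuous_fst.continuousAt.eventually (hψ.eventually (by simp))
  have hτp := hasFDerivAt_tangentLift hψ
  have hE'ev : ∀ᶠ q in 𝓝 p, ContDiffAt ℝ 2 E' (tangentLift ψ q) :=
    hτp.continuousAt.eventually (hE'.eventually (by simp))
  have h1 : (fun q => fderiv ℝ E q (0, w)) =ᶠ[𝓝 p]
      fun q => fderiv ℝ E' (tangentLift ψ q) (0, fderiv ℝ ψ q.1 w) := by
    filter_upwards [heq.eventuallyEq_nhds, hE'ev, hψ1] with q h1 h2 h3
    rw [fderiv_comp_tangentLift h3 h2 h1, ContinuousLinearMap.comp_apply,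
      fderiv_tangentLift_apply h3]
    simp
  rw [← fderiv_fderiv_apply hE, h1.fderiv_eq]
  have h2 : HasFDerivAt (fun q => fderiv ℝ E' (tangentLift ψ q))
      ((hess E' (tangentLift ψ p)).comp (fderiv ℝ (tangentLift ψ) p)) p :=
    (differentiableAt_fderiv hE').hasFDerivAt.comp p hτp.differentiableAt.hasFDerivAt
  have h4 := ((hψ.fderiv_right (m := 1) (by norm_num)).differentiableAt
    one_ne_zero).hasFDerivAt.comp p hasFDerivAt_fst
  have h5 := (hasFDerivAt_const (0 : Coord n) p).prodMk (h4.clm_apply (hasFDerivAt_const w p))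
  have h6 : fderiv ℝ (fun q => fderiv ℝ E' (tangentLift ψ q) (0, fderiv ℝ ψ q.1 w)) p = _ :=
    (h2.clm_apply h5).fderiv
  rw [h6]
  simp [add_comm]

/-- The spray does not depend on the coordinates of the base manifold. -/
lemma fderiv_tangentLift_sprayOf {E E' : Coord n × Coord n → ℝ} {ψ : Coord n → Coord n}
    {p : Coord n × Coord n} (hψ : ContDiffAt ℝ 2 ψ p.1)
    (hψs : Function.Surjective (fderiv ℝ ψ p.1)) (hE : ContDiffAt ℝ 2 E p)
    (hpos : ∀ w : Coord n, w ≠ 0 → 0 < hess E p (0, w) (0, w))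
    (hE' : ContDiffAt ℝ 2 E' (tangentLift ψ p))
    (hpos' : ∀ w : Coord n, w ≠ 0 → 0 < hess E' (tangentLift ψ p) (0, w) (0, w))
    (heq : E =ᶠ[𝓝 p] fun q => E' (tangentLift ψ q)) :
    fderiv ℝ (tangentLift ψ) p (sprayOf E p) = sprayOf E' (tangentLift ψ p) := by
  refine eq_sprayOf hE' hpos' ?_ fun w' => ?_
  · rw [sprayOf, fderiv_tangentLift_apply hψ]; rfl
  · obtain ⟨w, rfl⟩ := hψs w'
    have h1 := hess_comp_tangentLift hψ hE hE' heq (sprayOf E p) w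
    have h2 : fderiv ℝ E p (w, 0) = fderiv ℝ E' (tangentLift ψ p) (fderiv ℝ ψ p.1 w, 0) +
        fderiv ℝ E' (tangentLift ψ p) (0, fderiv ℝ (fderiv ℝ ψ) p.1 w p.2) := by
      rw [fderiv_comp_tangentLift hψ hE' heq, ContinuousLinearMap.comp_apply,
        fderiv_tangentLift_apply hψ, ← map_add]
      simp
    -- The spray has horizontal part `y`, so the second-order terms in `h1` and `h2` are `ψ''(y, w)`
    -- and `ψ''(w, y)`; they cancel by symmetry.
    have h3 : fderiv ℝ (fderiv ℝ ψ) p.1 (sprayOf E p).1 w =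
        fderiv ℝ (fderiv ℝ ψ) p.1 w p.2 :=
      (hψ.isSymmSndFDerivAt (by simp)).eq _ _
    rw [hess_sprayOf hE hpos, h2, h3] at h1
    exact (add_right_cancel h1).symm

end Local

/-! ### Smoothness, conservation of energy, homogeneity and divergence of the spray. -/

section Local

variable {n : ℕ} {E : Coord n × Coord n → ℝ} {p : Coord n × Coord n}
  {O : Set (Coord n × Coord n)}

lemma contDiffOn_det {ι G : Type*} [Fintype ι] [DecidableEq ι] [NormedAddCommGroup G]
    [NormedSpace ℝ G] {A : G → Matrix ι ι ℝ} {s : Set G} {m : WithTop ℕ∞}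
    (h : ∀ i j, ContDiffOn ℝ m (fun x => A x i j) s) : ContDiffOn ℝ m (fun x => (A x).det) s := by
  simp only [Matrix.det_apply']
  exact ContDiffOn.sum fun σ _ => contDiffOn_const.mul (contDiffOn_prod fun i _ => h _ _)

lemma contDiffOn_partial (hO : IsOpen O) (hE : ContDiffOn ℝ ∞ E O) (W : Coord n × Coord n) :
    ContDiffOn ℝ ∞ (fun p => fderiv ℝ E p W) O :=
  (hE.fderiv_of_isOpen hO (m := ∞) (by simp)).clm_apply contDiffOn_const

lemma contDiffOn_tensorOf (hO : IsOpen O) (hE : ContDiffOn ℝ ∞ E O) (i j : Fin n) :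
    ContDiffOn ℝ ∞ (fun p => tensorOf E p i j) O :=
  contDiffOn_const.mul (contDiffOn_partial hO (contDiffOn_partial hO hE _) _)

lemma contDiffAt_two (hO : IsOpen O) (hE : ContDiffOn ℝ ∞ E O) (hp : p ∈ O) :
    ContDiffAt ℝ 2 E p :=
  (hE.contDiffAt (hO.mem_nhds hp)).of_le (WithTop.coe_le_coe.2 le_top)

lemma contDiffOn_sprayOf (hO : IsOpen O) (hE : ContDiffOn ℝ ∞ E O)
    (hpos : ∀ p ∈ O, ∀ w : Coord n, w ≠ 0 → 0 < hess E p (0, w) (0, w)) :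
    ContDiffOn ℝ ∞ (sprayOf E) O := by
  have hdet : ContDiffOn ℝ ∞ (fun p => (tensorOf E p).det) O :=
    contDiffOn_det (contDiffOn_tensorOf hO hE)
  have hadj : ∀ i l, ContDiffOn ℝ ∞ (fun p => (tensorOf E p).adjugate i l) O := fun i l => by
    simp only [Matrix.adjugate_apply]
    refine contDiffOn_det fun a b => ?_
    by_cases ha : a = l
    · subst ha
      simp only [Matrix.updateRow_self]
      exact contDiffOn_const
    · simp only [Matrix.updateRow_ne ha]
      exact contDiffOn_tensorOf hO hE _ _
  have hinv : ∀ i l, ContDiffOn ℝ ∞ (fun p => (tensorOf E p)⁻¹ i l) O := fun i l => by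
    simp only [Matrix.inv_def, Ring.inverse_eq_inv', Matrix.smul_apply, smul_eq_mul]
    exact (hdet.inv fun p hp =>
      (tensorOf_posDef (contDiffAt_two hO hE hp) (hpos p hp)).det_pos.ne').mul (hadj i l)
  suffices h : ContDiffOn ℝ ∞ (sprayCoeffOf E) O from
    contDiff_snd.contDiffOn.prodMk (h.const_smul (-2 : ℝ))
  refine (contDiffOn_euclidean).2 fun i => ?_
  refine contDiffOn_const.mul (ContDiffOn.sum fun l _ => (hinv i l).mul (ContDiffOn.sub ?_ ?_))
  · refine ContDiffOn.sum fun k _ => ContDiffOn.mul ?_ ?_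
    · exact contDiffOn_partial hO (contDiffOn_partial hO hE _) _
    · exact ((contDiff_piLp_apply (p := 2) (i := k)).comp contDiff_snd).contDiffOn
  · exact contDiffOn_partial hO hE _

/-- A squared metric is constant along its spray. -/
lemma fderiv_apply_sprayOf (hE : ContDiffAt ℝ 2 E p)
    (hpos : ∀ w : Coord n, w ≠ 0 → 0 < hess E p (0, w) (0, w))
    (heuler : ∀ᶠ q : Coord n × Coord n in 𝓝 p, fderiv ℝ E q (0, q.2) = 2 * E q) :
    fderiv ℝ E p (sprayOf E p) = 0 := by
  have h1 : HasFDerivAt (fun q : Coord n × Coord n => fderiv ℝ E q (0, q.2))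
      ((fderiv ℝ E p).comp ((0 : Coord n × Coord n →L[ℝ] Coord n).prod
        (ContinuousLinearMap.snd ℝ (Coord n) (Coord n))) + (hess E p).flip (0, p.2)) p :=
    (differentiableAt_fderiv hE).hasFDerivAt.clm_apply
      ((hasFDerivAt_const (0 : Coord n) p).prodMk hasFDerivAt_snd)
  have h2 : HasFDerivAt (fun q => 2 * E q) ((2 : ℝ) • fderiv ℝ E p) p :=
    (hE.differentiableAt two_ne_zero).hasFDerivAt.const_mul 2
  have h3 := (h1.congr_of_eventuallyEq (heuler.mono fun q h => h.symm)).unique h2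
  have h4 := DFunLike.congr_fun h3 (sprayOf E p)
  have h5 := hess_sprayOf hE hpos p.2
  have h6 : fderiv ℝ E p (sprayOf E p) =
      fderiv ℝ E p (p.2, 0) + fderiv ℝ E p (0, (sprayOf E p).2) := by
    rw [← map_add]; simp [sprayOf]
  -- Euler's relation `E'(0, y) = 2 E`, differentiated along the spray. By Euler–Lagrange the
  -- Hessian term is `E'(y, 0)`, so the left side is the derivative of `E` along the spray and the
  -- right side is twice the same number.
  have h7 : fderiv ℝ E p (0, (sprayOf E p).2) + hess E p (sprayOf E p) (0, p.2) =
      2 * fderiv ℝ E p (sprayOf E p) := h4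
  linarith

/-- The spray is a geodesic spray: its vertical part is quadratic on rays. -/
lemma sprayOf_smul {c : ℝ} (hc : c ≠ 0) (hE : ContDiffAt ℝ 2 E p)
    (hpos : ∀ w : Coord n, w ≠ 0 → 0 < hess E p (0, w) (0, w))
    (hE' : ContDiffAt ℝ 2 E (p.1, c • p.2))
    (hpos' : ∀ w : Coord n, w ≠ 0 → 0 < hess E (p.1, c • p.2) (0, w) (0, w))
    (hhom : ∀ᶠ q : Coord n × Coord n in 𝓝 p, E (q.1, c • q.2) = c ^ 2 * E q) :
    sprayOf E (p.1, c • p.2) = (c • p.2, c ^ 2 • (sprayOf E p).2) := by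
  set σ : Coord n × Coord n →L[ℝ] Coord n × Coord n :=
    (ContinuousLinearMap.fst ℝ (Coord n) (Coord n)).prod
      (c • ContinuousLinearMap.snd ℝ (Coord n) (Coord n)) with hσ
  have hσa : ∀ q, σ q = (q.1, c • q.2) := fun q => rfl
  have hfd : ∀ᶠ q in 𝓝 p, ∀ W, fderiv ℝ E (σ q) (σ W) = c ^ 2 * fderiv ℝ E q W := by
    have hev : ∀ᶠ q in 𝓝 p, ContDiffAt ℝ 2 E (σ q) :=
      σ.continuous.continuousAt.eventually (hE'.eventually (by simp))
    filter_upwards [hhom.eventually_nhds, hE.eventually (by simp), hev] with q h1 h2 h3 W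
    have h4 : HasFDerivAt (fun q => E (σ q)) ((fderiv ℝ E (σ q)).comp σ) q :=
      (h3.differentiableAt two_ne_zero).hasFDerivAt.comp q σ.hasFDerivAt
    have h5 : HasFDerivAt (fun q => c ^ 2 * E q) (c ^ 2 • fderiv ℝ E q) q :=
      (h2.differentiableAt two_ne_zero).hasFDerivAt.const_mul _
    exact DFunLike.congr_fun ((h4.congr_of_eventuallyEq (h1.mono fun q h => h.symm)).unique h5) W
  have hhess : ∀ V W, hess E (σ p) (σ V) (σ W) = c ^ 2 * hess E p V W := fun V W => by
    have h1 : HasFDerivAt (fun q => fderiv ℝ E (σ q) (σ W))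
        (((hess E (σ p)).flip (σ W)).comp σ) p :=
      HasFDerivAt.comp (g := fun q => fderiv ℝ E q (σ W)) p
        (hasFDerivAt_fderiv_apply (p := σ p) hE' (σ W)) σ.hasFDerivAt
    have h2 := (hasFDerivAt_fderiv_apply hE W).const_mul (c ^ 2)
    exact DFunLike.congr_fun
      ((h1.congr_of_eventuallyEq (hfd.mono fun q h => (h W).symm)).unique h2) V
  -- The candidate is `c • σ (sprayOf E p)`; the Euler–Lagrange identity carries over since `E ∘ σ =
  -- c² E`.
  refine (eq_sprayOf hE' hpos' rfl fun w => ?_).symm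
  have h1 : ((c • p.2, c ^ 2 • (sprayOf E p).2) : Coord n × Coord n) = c • σ (sprayOf E p) := by
    rw [hσa]; ext1
    · simp [sprayOf]
    · simp [smul_smul, pow_two]
  have h2 : ((0 : Coord n), w) = σ (0, c⁻¹ • w) := by
    rw [hσa]; simp [smul_smul, hc]
  have h3 : ((w, 0) : Coord n × Coord n) = σ (w, 0) := by
    rw [hσa]; simp
  have h4 : hess E p (sprayOf E p) (0, c⁻¹ • w) = c⁻¹ * fderiv ℝ E p (w, 0) := by
    rw [hess_sprayOf hE hpos, ← smul_eq_mul, ← map_smul]; simp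
  have h5 : hess E (σ p) (c • σ (sprayOf E p)) (σ (0, c⁻¹ • w)) = fderiv ℝ E (σ p) (σ (w, 0)) := by
    rw [map_smul, smul_apply, hhess, h4, hfd.self_of_nhds, smul_eq_mul]
    field_simp
  rw [h1, h2]
  exact h5.trans (by rw [← h3, hσa])

lemma trace_prod_endomorphism (D : Coord n × Coord n →L[ℝ] Coord n × Coord n) :
    LinearMap.trace ℝ (Coord n × Coord n) D =
      ∑ i, (D (EuclideanSpace.single i 1, 0)).1 i + ∑ i, (D (0, EuclideanSpace.single i 1)).2 i := by
  set b := (EuclideanSpace.basisFun (Fin n) ℝ).toBasis with hb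
  rw [LinearMap.trace_eq_matrix_trace ℝ (b.prod b), Matrix.trace, Fintype.sum_sum_type]
  congr 1 <;> refine Finset.sum_congr rfl fun i _ => ?_ <;>
    simp [LinearMap.toMatrix_apply, hb]

lemma hasFDerivAt_hess_apply (hDE : ContDiffAt ℝ 2 (fderiv ℝ E) p)
    {f : Coord n × Coord n → Coord n × Coord n} {D : Coord n × Coord n →L[ℝ] Coord n × Coord n}
    (hf : HasFDerivAt f D p) (W : Coord n × Coord n) :
    HasFDerivAt (fun q => hess E q (f q) W)
      ((((hess E p).comp D + (fderiv ℝ (hess E) p).flip (f p)).flip) W) p := by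
  have h := ((differentiableAt_fderiv' hDE).hasFDerivAt.clm_apply hf).clm_apply
    (hasFDerivAt_const W p)
  simpa using h

set_option synthInstance.maxHeartbeats 200000 in
lemma fderiv_tensorOf_apply (hO : IsOpen O) (hE : ContDiffOn ℝ ∞ E O) (hp : p ∈ O)
    (hDE : ContDiffAt ℝ 2 (fderiv ℝ E) p) (i j : Fin n) (V : Coord n × Coord n) :
    fderiv ℝ (fun q => tensorOf E q i j) p V = 1 / 2 * fderiv ℝ (hess E) p V
      (0, EuclideanSpace.single i 1) (0, EuclideanSpace.single j 1) := by
  have h1 : (fun q => tensorOf E q i j) =ᶠ[𝓝 p] fun q => 1 / 2 * hess E q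
      (0, EuclideanSpace.single i 1) (0, EuclideanSpace.single j 1) := by
    filter_upwards [hO.mem_nhds hp] with q hq
    exact tensorOf_apply (contDiffAt_two hO hE hq) i j
  have h2 := hasFDerivAt_hess_apply hDE (hasFDerivAt_const ((0 : Coord n),
    (EuclideanSpace.single i 1 : Coord n)) p) (0, EuclideanSpace.single j 1)
  rw [h1.fderiv_eq, (h2.const_mul _).fderiv]
  simp

/-- The Euler–Lagrange identity holds on an open set and may be differentiated; this is how the
derivative of the spray is reached without differentiating `g⁻¹`. -/
lemma fderiv_hess_sprayOf (hO : IsOpen O) (hE : ContDiffOn ℝ ∞ E O)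
    (hpos : ∀ p ∈ O, ∀ w : Coord n, w ≠ 0 → 0 < hess E p (0, w) (0, w)) (hp : p ∈ O)
    (hDE : ContDiffAt ℝ 2 (fderiv ℝ E) p) {D : Coord n × Coord n →L[ℝ] Coord n × Coord n}
    (hD : HasFDerivAt (sprayOf E) D p) (V : Coord n × Coord n) (w : Coord n) :
    hess E p (D V) (0, w) + fderiv ℝ (hess E) p V (sprayOf E p) (0, w) = hess E p V (w, 0) := by
  have h1 := hasFDerivAt_hess_apply hDE hD (0, w)
  have h2 := hasFDerivAt_fderiv_apply (contDiffAt_two hO hE hp) (w, 0)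
  have h3 : (fun q => hess E q (sprayOf E q) (0, w)) =ᶠ[𝓝 p]
      fun q => fderiv ℝ E q (w, 0) := by
    filter_upwards [hO.mem_nhds hp] with q hq
    exact hess_sprayOf (contDiffAt_two hO hE hq) (hpos q hq) _
  have h4 := DFunLike.congr_fun (h1.unique (h2.congr_of_eventuallyEq h3)) V
  simpa using h4

lemma fderiv_det_apply (hO : IsOpen O) (hE : ContDiffOn ℝ ∞ E O) (hp : p ∈ O)
    (S : Coord n × Coord n) :
    fderiv ℝ (fun q => (tensorOf E q).det) p S = ((tensorOf E p).adjugate *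
      Matrix.of fun i j => fderiv ℝ (fun q => tensorOf E q i j) p S).trace := by
  have hline : HasDerivWithinAt (fun t : ℝ => p + t • S) S univ 0 := by
    exact (((hasDerivAt_id (0 : ℝ)).smul_const S).const_add p).hasDerivWithinAt.congr_deriv
      (one_smul ℝ S)
  have hcomp : ∀ φ : Coord n × Coord n → ℝ, DifferentiableAt ℝ φ p →
      HasDerivWithinAt (fun t : ℝ => φ (p + t • S)) (fderiv ℝ φ p S) univ 0 := fun φ hφ => by
    have h0 : p = p + (0 : ℝ) • S := by simp
    have h1 : HasFDerivAt φ (fderiv ℝ φ p) (p + (0 : ℝ) • S) := by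
      rw [← h0]; exact hφ.hasFDerivAt
    exact h1.comp_hasDerivWithinAt (0 : ℝ) hline
  have h1 := hasDerivWithinAt_det (A := fun t : ℝ => tensorOf E (p + t • S))
    (A' := Matrix.of fun i j => fderiv ℝ (fun q => tensorOf E q i j) p S)
    (s := univ) (t := 0) fun i j => hcomp _ (((contDiffOn_tensorOf hO hE i j).contDiffAt
      (hO.mem_nhds hp)).differentiableAt (by simp))
  have h2 := hcomp (fun q => (tensorOf E q).det)
    (((contDiffOn_det (contDiffOn_tensorOf hO hE)).contDiffAt
      (hO.mem_nhds hp)).differentiableAt (by simp))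
  rw [hasDerivWithinAt_univ] at h1 h2
  rw [h2.unique h1]
  simp

/-- The spray of `E` preserves the volume form `det g dx dy`. -/
lemma divergence_sprayOf (hO : IsOpen O) (hE : ContDiffOn ℝ ∞ E O)
    (hpos : ∀ p ∈ O, ∀ w : Coord n, w ≠ 0 → 0 < hess E p (0, w) (0, w)) (hp : p ∈ O) :
    fderiv ℝ (fun q => (tensorOf E q).det) p (sprayOf E p) +
      (tensorOf E p).det * LinearMap.trace ℝ (Coord n × Coord n) (fderiv ℝ (sprayOf E) p) = 0 := by
  have hE2 := contDiffAt_two hO hE hp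
  have hEp : ContDiffAt ℝ ∞ E p := hE.contDiffAt (hO.mem_nhds hp)
  have hDE : ContDiffAt ℝ 2 (fderiv ℝ E) p :=
    hEp.fderiv_right (m := 2) (WithTop.coe_le_coe.2 le_top)
  have hSd : DifferentiableAt ℝ (sprayOf E) p :=
    ((contDiffOn_sprayOf hO hE hpos).contDiffAt (hO.mem_nhds hp)).differentiableAt (by simp)
  obtain ⟨D, hD⟩ : ∃ D, D = fderiv ℝ (sprayOf E) p := ⟨_, rfl⟩
  have hSD : HasFDerivAt (sprayOf E) D p := hD ▸ hSd.hasFDerivAt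
  rw [← hD]
  have hD1 : ∀ V, (D V).1 = V.2 := fun V =>
    (DFunLike.congr_fun (hasFDerivAt_snd.unique hSD.fst) V).symm
  obtain ⟨B, hB⟩ : ∃ B : Matrix (Fin n) (Fin n) ℝ,
    ∀ i j, B i j = (D (0, EuclideanSpace.single j 1)).2 i := ⟨Matrix.of fun i j => _, fun _ _ => rfl⟩
  have htr : LinearMap.trace ℝ (Coord n × Coord n) D = B.trace := by
    rw [trace_prod_endomorphism]
    simp [hD1, Matrix.trace, hB]
  obtain ⟨M, hM⟩ : ∃ M : Matrix (Fin n) (Fin n) ℝ,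
    M = Matrix.of fun i j => fderiv ℝ (fun q => tensorOf E q i j) p (sprayOf E p) := ⟨_, rfl⟩
  -- Symmetry of `g` and of third derivatives moves the spray to the second slot, where it stands in
  -- `fderiv_hess_sprayOf`.
  have hMij : ∀ i j, M i j = 1 / 2 * fderiv ℝ (hess E) p (0, EuclideanSpace.single j 1)
      (sprayOf E p) (0, EuclideanSpace.single i 1) := fun i j => by
    have hsymm : (fun q => tensorOf E q i j) =ᶠ[𝓝 p] fun q => tensorOf E q j i := by
      filter_upwards [hO.mem_nhds hp] with q hq
      exact tensorOf_symm (contDiffAt_two hO hE hq) i j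
    rw [hM, Matrix.of_apply, hsymm.fderiv_eq, fderiv_tensorOf_apply hO hE hp hDE]
    congr 1
    exact DFunLike.congr_fun ((hDE.isSymmSndFDerivAt (by simp)).eq _ _) _
  obtain ⟨Z, hZ⟩ : ∃ Z : Matrix (Fin n) (Fin n) ℝ, ∀ i j, Z i j = 1 / 2 *
    (hess E p (EuclideanSpace.single j 1, 0) (0, EuclideanSpace.single i 1) -
      hess E p (EuclideanSpace.single i 1, 0) (0, EuclideanSpace.single j 1)) :=
    ⟨Matrix.of fun i j => _, fun _ _ => rfl⟩
  -- The differentiated Euler–Lagrange identity in vertical directions. Multiplying by `adj g` and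
  -- taking the trace turns `M` into the derivative of `det g`, turns `g B` into `det g · tr B`, and
  -- kills the antisymmetric `Z`.
  have hsum : M + tensorOf E p * B + Z = 0 := by
    ext i j
    have h5 := fderiv_hess_sprayOf hO hE hpos hp hDE hSD (0, EuclideanSpace.single j 1)
      (EuclideanSpace.single i 1)
    have h6 : D (0, EuclideanSpace.single j 1) =
        (EuclideanSpace.single j 1, 0) + (0, (D (0, EuclideanSpace.single j 1)).2) := by
      ext1 <;> simp [hD1]
    have h7 : hess E p (0, (D (0, EuclideanSpace.single j 1)).2) (0, EuclideanSpace.single i 1) =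
        2 * (tensorOf E p * B) i j := by
      rw [prod_sum_right, Matrix.mul_apply, Finset.mul_sum, map_sum, sum_apply]
      refine Finset.sum_congr rfl fun k _ => ?_
      rw [map_smul, smul_apply, smul_eq_mul, tensorOf_symm hE2, tensorOf_apply hE2, hB]
      ring
    rw [h6, map_add, add_apply, h7, hess_symm hE2 (0, EuclideanSpace.single j 1)] at h5
    rw [Matrix.add_apply, Matrix.add_apply, Matrix.zero_apply, hMij, hZ]
    linarith
  have hadjZ : ((tensorOf E p).adjugate * Z).trace = 0 := by
    have h1 : Z.transpose = -Z := by
      ext i j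
      rw [Matrix.transpose_apply, Matrix.neg_apply, hZ, hZ]
      ring
    have h2 : (tensorOf E p).transpose = tensorOf E p := by
      ext i j
      exact tensorOf_symm hE2 j i
    have h3 : ((tensorOf E p).adjugate * Z).trace = -((tensorOf E p).adjugate * Z).trace := by
      conv_lhs => rw [← Matrix.trace_transpose, Matrix.transpose_mul, h1,
        Matrix.adjugate_transpose, h2, Matrix.neg_mul, Matrix.trace_neg, Matrix.trace_mul_comm]
    linarith
  have h1 := congrArg (fun X => ((tensorOf E p).adjugate * X).trace) hsum
  simp only [Matrix.mul_add, Matrix.trace_add, hadjZ, Matrix.mul_zero, Matrix.trace_zero,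
    ← Matrix.mul_assoc, Matrix.adjugate_mul, Matrix.smul_mul, Matrix.one_mul, Matrix.trace_smul,
    smul_eq_mul] at h1
  rw [fderiv_det_apply hO hE hp, ← hM, htr]
  linarith

/-- The fundamental tensor under a change of coordinates. -/
lemma det_tensorOf_comp_tangentLift {E' : Coord n × Coord n → ℝ} {ψ : Coord n → Coord n}
    (hψ : ContDiffAt ℝ 2 ψ p.1) (hE : ContDiffAt ℝ 2 E p)
    (hE' : ContDiffAt ℝ 2 E' (tangentLift ψ p)) (heq : E =ᶠ[𝓝 p] fun q => E' (tangentLift ψ q)) :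
    (tensorOf E p).det = (fderiv ℝ ψ p.1).det ^ 2 * (tensorOf E' (tangentLift ψ p)).det := by
  set b := (EuclideanSpace.basisFun (Fin n) ℝ).toBasis with hb
  set J := LinearMap.toMatrix b b (fderiv ℝ ψ p.1) with hJ
  have hJa : ∀ i j, J i j = fderiv ℝ ψ p.1 (EuclideanSpace.single j 1) i := fun i j => by
    simp [hJ, LinearMap.toMatrix_apply, hb]
  -- For vertical arguments the second-order term in `hess_comp_tangentLift` vanishes, so `g`
  -- transforms as a tensor.
  have h1 : tensorOf E p = J.transpose * tensorOf E' (tangentLift ψ p) * J := by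
    ext i j
    have h2 := hess_comp_tangentLift hψ hE hE' heq (0, EuclideanSpace.single i 1)
      (EuclideanSpace.single j 1)
    rw [tensorOf_apply hE, h2, fderiv_tangentLift_apply hψ]
    simp only [map_zero, zero_apply, add_zero]
    have h0 : fderiv ℝ E' (tangentLift ψ p) ((0 : Coord n), (0 : Coord n)) = 0 :=
      map_zero (fderiv ℝ E' (tangentLift ψ p))
    rw [h0, hess_right_apply hE', Matrix.mul_apply]
    simp only [Matrix.mul_apply, Matrix.transpose_apply, hJa, Finset.sum_mul, add_zero]
    rw [Finset.sum_comm, Finset.mul_sum, Finset.mul_sum]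
    refine Finset.sum_congr rfl fun k _ => ?_
    rw [Finset.mul_sum, Finset.mul_sum]
    refine Finset.sum_congr rfl fun l _ => ?_
    ring
  have h3 : J.det = (fderiv ℝ ψ p.1).det := by
    rw [hJ, LinearMap.det_toMatrix]
  rw [h1, Matrix.det_mul, Matrix.det_mul, Matrix.det_transpose, h3]
  ring

/-- The derivative of the lift is block triangular with `ψ'` twice on the diagonal. The factor is
the one by which `det g` changes, so `det g dx dy` is invariant. -/
lemma det_fderiv_tangentLift {ψ : Coord n → Coord n} (hψ : ContDiffAt ℝ 2 ψ p.1) :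
    (fderiv ℝ (tangentLift ψ) p).det = (fderiv ℝ ψ p.1).det ^ 2 := by
  set b := (EuclideanSpace.basisFun (Fin n) ℝ).toBasis with hb
  set J := LinearMap.toMatrix b b (fderiv ℝ ψ p.1) with hJ
  have h3 : J.det = (fderiv ℝ ψ p.1).det := by
    rw [hJ, LinearMap.det_toMatrix]
  have h1 : LinearMap.toMatrix (b.prod b) (b.prod b) (fderiv ℝ (tangentLift ψ) p) =
      Matrix.fromBlocks J 0 (Matrix.of fun i j =>
        fderiv ℝ (fderiv ℝ ψ) p.1 (EuclideanSpace.single j 1) p.2 i) J := by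
    ext i j
    rcases i with i | i <;> rcases j with j | j <;>
      simp [LinearMap.toMatrix_apply, hb, fderiv_tangentLift_apply hψ, hJ]
  have h2 : (fderiv ℝ (tangentLift ψ) p).det =
      (LinearMap.toMatrix (b.prod b) (b.prod b) (fderiv ℝ (tangentLift ψ) p)).det := by
    rw [LinearMap.det_toMatrix]
  rw [h2, h1, Matrix.det_fromBlocks_zero₁₂, h3, pow_two]

end Local

/-! ### Induced charts of the tangent bundle and the metric in them. -/

section Charts

variable {n : ℕ} {M : Type*} [TopologicalSpace M] [ChartedSpace (Coord n) M]
  [IsManifold (𝓡 n) ∞ M]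

/-- The chart of the tangent bundle which is induced by the chart of `M` at `x₀`. -/
def tangentChart (x₀ : M) : PartialEquiv (TangentBundle (𝓡 n) M) (Coord n × Coord n) :=
  extChartAt (𝓡 n).tangent (⟨x₀, 0⟩ : TangentBundle (𝓡 n) M)

lemma mem_tangentChart_source {x₀ : M} {u : TangentBundle (𝓡 n) M} :
    u ∈ (tangentChart x₀).source ↔ u.1 ∈ (extChartAt (𝓡 n) x₀).source := by
  rw [tangentChart, extChartAt_source, extChartAt_source, TangentBundle.mem_chart_source_iff]

lemma mem_tangentChart_target {x₀ : M} {p : Coord n × Coord n} :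
    p ∈ (tangentChart x₀).target ↔ p.1 ∈ (extChartAt (𝓡 n) x₀).target := by
  rw [tangentChart, extChartAt_target, extChartAt_target]
  simp only [mem_inter_iff, mem_preimage, ModelWithCorners.range_eq_univ, mem_univ, and_true]
  exact TangentBundle.mem_chart_target_iff _ _

lemma tangentChart_apply (x₀ : M) (u : TangentBundle (𝓡 n) M) :
    tangentChart x₀ u = (extChartAt (𝓡 n) x₀ u.1, tangentCoordChange (𝓡 n) u.1 x₀ u.1 u.2) := rfl

lemma tangentChart_symm_fst (x₀ : M) (p : Coord n × Coord n) :
    ((tangentChart x₀).symm p).1 = (extChartAt (𝓡 n) x₀).symm p.1 := rfl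

lemma tangentChart_symm_apply (x₀ : M) (p : Coord n × Coord n) :
    (tangentChart x₀).symm p = ⟨(extChartAt (𝓡 n) x₀).symm p.1,
      tangentCoordChange (𝓡 n) x₀ ((extChartAt (𝓡 n) x₀).symm p.1)
        ((extChartAt (𝓡 n) x₀).symm p.1) p.2⟩ := rfl

lemma isOpen_tangentChart_source (x₀ : M) :
    IsOpen (tangentChart x₀ : PartialEquiv (TangentBundle (𝓡 n) M) _).source :=
  isOpen_extChartAt_source _

lemma isOpen_tangentChart_target (x₀ : M) : IsOpen (tangentChart (n := n) x₀).target :=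
  isOpen_extChartAt_target _

lemma continuousOn_tangentChart (x₀ : M) :
    ContinuousOn (tangentChart x₀) (tangentChart (n := n) x₀).source :=
  continuousOn_extChartAt _

lemma continuousOn_tangentChart_symm (x₀ : M) :
    ContinuousOn (tangentChart x₀).symm (tangentChart (n := n) x₀).target :=
  continuousOn_extChartAt_symm _

lemma tangentChart_snd_ne_zero {x₀ : M} {u : TangentBundle (𝓡 n) M}
    (hu : u.1 ∈ (extChartAt (𝓡 n) x₀).source) : (tangentChart x₀ u).2 ≠ 0 ↔ u.2 ≠ 0 := by
  rw [tangentChart_apply, not_iff_not]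
  constructor
  · intro h
    have h1 := tangentCoordChange_comp (I := 𝓡 n) (w := u.1) (x := x₀) (y := u.1) (z := u.1)
      (v := u.2) ⟨⟨mem_extChartAt_source _, hu⟩, mem_extChartAt_source _⟩
    have h2 : tangentCoordChange (𝓡 n) u.1 x₀ u.1 u.2 = 0 := h
    have h3 : tangentCoordChange (𝓡 n) u.1 u.1 u.1 u.2 = u.2 :=
      tangentCoordChange_self (mem_extChartAt_source _)
    exact (h3.symm.trans h1.symm).trans (by rw [h2]; exact map_zero _)
  · intro h
    simp only [h]
    exact map_zero _

/-- The change of coordinates between the charts of `M` at `x₀` and `x₁`. -/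
def transition (x₀ x₁ : M) : Coord n → Coord n :=
  extChartAt (𝓡 n) x₁ ∘ (extChartAt (𝓡 n) x₀).symm

lemma contDiffAt_transition {x₀ x₁ : M} {x : Coord n} (hx : x ∈ (extChartAt (𝓡 n) x₀).target)
    (hx₁ : (extChartAt (𝓡 n) x₀).symm x ∈ (extChartAt (𝓡 n) x₁).source) :
    ContDiffAt ℝ ∞ (transition x₀ x₁) x := by
  have h := contDiffWithinAt_ext_coord_change (I := 𝓡 n) (n := ∞) x₁ x₀ (y := x) (by
    rw [PartialEquiv.trans_source, PartialEquiv.symm_source]; exact ⟨hx, hx₁⟩)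
  rw [ModelWithCorners.range_eq_univ, contDiffWithinAt_univ] at h
  exact h

lemma fderiv_transition {x₀ x₁ : M} {x : Coord n} (hx : x ∈ (extChartAt (𝓡 n) x₀).target) :
    fderiv ℝ (transition x₀ x₁) x =
      tangentCoordChange (𝓡 n) x₀ x₁ ((extChartAt (𝓡 n) x₀).symm x) := by
  rw [tangentCoordChange_def, ModelWithCorners.range_eq_univ, fderivWithin_univ,
    (extChartAt (𝓡 n) x₀).right_inv hx, transition]

lemma fderiv_transition_surjective {x₀ x₁ : M} {x : Coord n}
    (hx : x ∈ (extChartAt (𝓡 n) x₀).target)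
    (hx₁ : (extChartAt (𝓡 n) x₀).symm x ∈ (extChartAt (𝓡 n) x₁).source) :
    Function.Surjective (fderiv ℝ (transition x₀ x₁) x) := fun v => by
  have h0 := (extChartAt (𝓡 n) x₀).map_target hx
  refine ⟨tangentCoordChange (𝓡 n) x₁ x₀ ((extChartAt (𝓡 n) x₀).symm x) v, ?_⟩
  rw [fderiv_transition hx, tangentCoordChange_comp ⟨⟨hx₁, h0⟩, hx₁⟩, tangentCoordChange_self hx₁]

/-- The change of coordinates between the induced charts of the tangent bundle. -/
lemma tangentChart_tangentChart_symm {x₀ x₁ : M} {p : Coord n × Coord n}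
    (hx : p.1 ∈ (extChartAt (𝓡 n) x₀).target)
    (hx₁ : (extChartAt (𝓡 n) x₀).symm p.1 ∈ (extChartAt (𝓡 n) x₁).source) :
    tangentChart x₁ ((tangentChart x₀).symm p) = tangentLift (transition x₀ x₁) p := by
  have h0 := (extChartAt (𝓡 n) x₀).map_target hx
  rw [tangentChart_apply, tangentChart_symm_apply, tangentLift, fderiv_transition hx]
  simp only
  rw [tangentCoordChange_comp ⟨⟨h0, mem_extChartAt_source _⟩, hx₁⟩]
  rfl

/-- The nonzero vectors over the chart at `x₀`, in coordinates. -/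
def regularSet (x₀ : M) : Set (Coord n × Coord n) :=
  {p | p.1 ∈ (extChartAt (𝓡 n) x₀).target ∧ p.2 ≠ 0}

lemma isOpen_regularSet (x₀ : M) : IsOpen (regularSet (n := n) x₀) :=
  ((isOpen_extChartAt_target x₀).preimage continuous_fst).inter
    (isOpen_ne.preimage continuous_snd)

namespace FinslerMetric

variable (F : FinslerMetric n M)

/-- The function `F²` in the chart at `x₀`. -/
def energy (x₀ : M) (p : Coord n × Coord n) : ℝ := F.coord x₀ p ^ 2

lemma coord_eq (x₀ : M) (p : Coord n × Coord n) :
    F.coord x₀ p = F.toFun ((tangentChart x₀).symm p) := rfl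

lemma fundamentalTensor_eq (x₀ : M) (p : Coord n × Coord n) :
    F.fundamentalTensor x₀ p = tensorOf (F.energy x₀) p := rfl

lemma coord_tangentChart {x₀ : M} {u : TangentBundle (𝓡 n) M}
    (hu : u.1 ∈ (extChartAt (𝓡 n) x₀).source) : F.coord x₀ (tangentChart x₀ u) = F.toFun u := by
  rw [coord_eq, (tangentChart x₀).left_inv (mem_tangentChart_source.2 hu)]

lemma tangentChart_symm_snd_ne_zero {x₀ : M} {p : Coord n × Coord n}
    (hx : p.1 ∈ (extChartAt (𝓡 n) x₀).target) :
    ((tangentChart x₀).symm p).2 ≠ 0 ↔ p.2 ≠ 0 := by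
  rw [← tangentChart_snd_ne_zero (x₀ := x₀) ((extChartAt (𝓡 n) x₀).map_target hx),
    (tangentChart x₀).right_inv (mem_tangentChart_target.2 hx)]

lemma contDiffOn_coord (x₀ : M) : ContDiffOn ℝ ∞ (F.coord x₀) (regularSet x₀) := by
  have h1 : ContMDiffOn 𝓘(ℝ, Coord n × Coord n) (𝓡 n).tangent ∞
      (tangentChart (n := n) x₀).symm (tangentChart (n := n) x₀).target :=
    contMDiffOn_extChartAt_symm _
  rw [← contMDiffOn_iff_contDiffOn]
  exact F.smooth.comp (h1.mono fun p hp => mem_tangentChart_target.2 hp.1)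
    fun p hp => (tangentChart_symm_snd_ne_zero hp.1).2 hp.2

lemma contDiffOn_energy (x₀ : M) : ContDiffOn ℝ ∞ (F.energy x₀) (regularSet x₀) :=
  (F.contDiffOn_coord x₀).pow 2

lemma coord_smul (x₀ : M) (x y : Coord n) {c : ℝ} (hc : 0 ≤ c) :
    F.coord x₀ (x, c • y) = c * F.coord x₀ (x, y) := by
  rw [coord_eq, coord_eq, tangentChart_symm_apply, tangentChart_symm_apply]
  have h := F.homogeneous ((extChartAt (𝓡 n) x₀).symm x) (tangentCoordChange (𝓡 n) x₀
    ((extChartAt (𝓡 n) x₀).symm x) ((extChartAt (𝓡 n) x₀).symm x) y) c hc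
  rw [← h]
  congr 2
  exact map_smul _ _ _

/-- A chart is linear on fibres, so the lines `v + s w` of `strongly_convex` become the lines `p + s
(0, w)`, along which the second derivative of `E / 2` is half the Hessian. -/
lemma hess_energy_pos {x₀ : M} {p : Coord n × Coord n} (hp : p ∈ regularSet x₀) (w : Coord n)
    (hw : w ≠ 0) : 0 < hess (F.energy x₀) p (0, w) (0, w) := by
  set m := (extChartAt (𝓡 n) x₀).symm p.1 with hm
  set A : Coord n →L[ℝ] Coord n := tangentCoordChange (𝓡 n) x₀ m m with hA
  have hw' : A w ≠ 0 := (tangentChart_symm_snd_ne_zero (p := (p.1, w)) hp.1).2 hw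
  have h2 : (fun s : ℝ => F.toFun ⟨m, A p.2 + s • A w⟩ ^ 2 / 2) =
      fun s : ℝ => F.energy x₀ (p + s • ((0 : Coord n), w)) / 2 := by
    ext s
    rw [energy, coord_eq, tangentChart_symm_apply]
    have h3 : p + s • ((0 : Coord n), w) = (p.1, p.2 + s • w) := by
      ext1 <;> simp
    rw [h3]
    simp only [← hm]
    rw [← hA, map_add, map_smul]
  have h1 : 0 < iteratedDeriv 2
      (fun s : ℝ => F.energy x₀ (p + s • ((0 : Coord n), w)) / 2) 0 := by
    rw [← h2]
    exact F.strongly_convex m (A p.2) (A w)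
      ((tangentChart_symm_snd_ne_zero hp.1).2 hp.2) hw'
  have hline : ∀ s : ℝ, HasDerivAt (fun s : ℝ => p + s • ((0 : Coord n), w)) ((0 : Coord n), w) s :=
    fun s => (((hasDerivAt_id s).smul_const ((0 : Coord n), w)).const_add p).congr_deriv
      (one_smul ℝ _)
  have hcont : ContinuousAt (fun s : ℝ => p + s • ((0 : Coord n), w)) 0 :=
    (hline 0).continuousAt
  have h0 : p + (0 : ℝ) • ((0 : Coord n), w) = p := by simp
  have hev : ∀ᶠ s : ℝ in 𝓝 0, p + s • ((0 : Coord n), w) ∈ regularSet x₀ :=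
    hcont.eventually (by
      change ∀ᶠ q in 𝓝 (p + (0 : ℝ) • ((0 : Coord n), w)), _
      rw [h0]; exact (isOpen_regularSet x₀).mem_nhds hp)
  have hd1 : deriv (fun s : ℝ => F.energy x₀ (p + s • ((0 : Coord n), w)) / 2) =ᶠ[𝓝 0]
      fun s => fderiv ℝ (F.energy x₀) (p + s • ((0 : Coord n), w)) (0, w) / 2 := by
    filter_upwards [hev] with s hs
    have h4 := contDiffAt_two (isOpen_regularSet x₀) (F.contDiffOn_energy x₀) hs
    exact (((h4.differentiableAt two_ne_zero).hasFDerivAt.comp_hasDerivAt s (hline s)).div_const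
      2).deriv
  have hE2 := contDiffAt_two (isOpen_regularSet x₀) (F.contDiffOn_energy x₀) hp
  have h5 : HasFDerivAt (fun q => fderiv ℝ (F.energy x₀) q (0, w))
      ((hess (F.energy x₀) p).flip (0, w)) (p + (0 : ℝ) • ((0 : Coord n), w)) := by
    rw [h0]; exact hasFDerivAt_fderiv_apply hE2 (0, w)
  have h6 := (h5.comp_hasDerivAt (0 : ℝ) (hline 0)).div_const 2
  rw [iteratedDeriv_succ, iteratedDeriv_one, hd1.deriv_eq] at h1
  have h7 : deriv (fun s : ℝ => fderiv ℝ (F.energy x₀) (p + s • ((0 : Coord n), w)) (0, w) / 2) 0 =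
      (hess (F.energy x₀) p).flip (0, w) (0, w) / 2 := h6.deriv
  rw [h7] at h1
  have h8 : (hess (F.energy x₀) p).flip (0, w) (0, w) = hess (F.energy x₀) p (0, w) (0, w) := rfl
  linarith

lemma energy_tangentLift {x₀ x₁ : M} {p : Coord n × Coord n}
    (hx : p.1 ∈ (extChartAt (𝓡 n) x₀).target)
    (hx₁ : (extChartAt (𝓡 n) x₀).symm p.1 ∈ (extChartAt (𝓡 n) x₁).source) :
    F.energy x₀ p = F.energy x₁ (tangentLift (transition x₀ x₁) p) := by
  rw [energy, energy, ← tangentChart_tangentChart_symm hx hx₁, coord_tangentChart, coord_eq]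
  exact hx₁

lemma eventually_mem_overlap {x₀ x₁ : M} {p : Coord n × Coord n}
    (hx : p.1 ∈ (extChartAt (𝓡 n) x₀).target)
    (hx₁ : (extChartAt (𝓡 n) x₀).symm p.1 ∈ (extChartAt (𝓡 n) x₁).source) :
    ∀ᶠ q : Coord n × Coord n in 𝓝 p, q.1 ∈ (extChartAt (𝓡 n) x₀).target ∧
      (extChartAt (𝓡 n) x₀).symm q.1 ∈ (extChartAt (𝓡 n) x₁).source := by
  have h1 : ContinuousAt (fun q : Coord n × Coord n => (extChartAt (𝓡 n) x₀).symm q.1) p :=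
    ((continuousOn_extChartAt_symm x₀).continuousAt
      ((isOpen_extChartAt_target x₀).mem_nhds hx)).comp continuous_fst.continuousAt
  exact (continuous_fst.continuousAt.eventually ((isOpen_extChartAt_target x₀).mem_nhds hx)).and
    (h1.eventually ((isOpen_extChartAt_source x₁).mem_nhds hx₁))

lemma tangentLift_transition_mem {x₀ x₁ : M} {p : Coord n × Coord n} (hp : p ∈ regularSet x₀)
    (hx₁ : (extChartAt (𝓡 n) x₀).symm p.1 ∈ (extChartAt (𝓡 n) x₁).source) :
    tangentLift (transition x₀ x₁) p ∈ regularSet x₁ := by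
  rw [← tangentChart_tangentChart_symm hp.1 hx₁]
  exact ⟨(extChartAt (𝓡 n) x₁).map_source hx₁,
    (tangentChart_snd_ne_zero hx₁).2 ((tangentChart_symm_snd_ne_zero hp.1).2 hp.2)⟩

lemma energy_eventuallyEq {x₀ x₁ : M} {p : Coord n × Coord n}
    (hx : p.1 ∈ (extChartAt (𝓡 n) x₀).target)
    (hx₁ : (extChartAt (𝓡 n) x₀).symm p.1 ∈ (extChartAt (𝓡 n) x₁).source) :
    F.energy x₀ =ᶠ[𝓝 p] fun q => F.energy x₁ (tangentLift (transition x₀ x₁) q) :=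
  (eventually_mem_overlap hx hx₁).mono fun _ hq => F.energy_tangentLift hq.1 hq.2

/-- The geodesic spray in the chart at `x₀`. -/
def chartSpray (x₀ : M) (p : Coord n × Coord n) : Coord n × Coord n := sprayOf (F.energy x₀) p

/-- `F²` need not be twice differentiable at zero vectors, so the formula may involve the default
derivative. The mixed terms carry the factor `y = 0`. The derivative `∂E/∂xˡ` is zero because `E`
vanishes on the zero section, or by default if `E` is not differentiable. -/
lemma chartSpray_zero (x₀ : M) (x : Coord n) : F.chartSpray x₀ (x, 0) = 0 := by
  have h0 : ∀ z : Coord n, F.energy x₀ (z, 0) = 0 := fun z => by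
    have := F.coord_smul x₀ z 0 (c := 0) le_rfl
    rw [energy]; simp at this; simp [this]
  have h1 : ∀ l, partialX l (F.energy x₀) (x, 0) = 0 := fun l => by
    rw [partialX]
    by_cases hd : DifferentiableAt ℝ (F.energy x₀) (x, 0)
    · have h2 : HasFDerivAt (fun z : Coord n => (z, (0 : Coord n)))
          (ContinuousLinearMap.inl ℝ (Coord n) (Coord n)) x :=
        (ContinuousLinearMap.inl ℝ (Coord n) (Coord n)).hasFDerivAt
      have h3 := hd.hasFDerivAt.comp x h2
      have h4 : F.energy x₀ ∘ (fun z : Coord n => (z, (0 : Coord n))) = fun _ => 0 :=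
        funext h0
      rw [h4] at h3
      exact (DFunLike.congr_fun (h3.unique (hasFDerivAt_const 0 x)) (EuclideanSpace.single l 1))
    · rw [fderiv_zero_of_not_differentiableAt hd]; rfl
  rw [chartSpray, sprayOf]
  ext1
  · rfl
  · ext i
    simp [sprayCoeffOf, h1]

lemma contDiffOn_chartSpray (x₀ : M) : ContDiffOn ℝ ∞ (F.chartSpray x₀) (regularSet x₀) :=
  contDiffOn_sprayOf (isOpen_regularSet x₀) (F.contDiffOn_energy x₀) fun _ hp =>
    F.hess_energy_pos hp

lemma contDiffAt_two_transition {x₀ x₁ : M} {x : Coord n}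
    (hx : x ∈ (extChartAt (𝓡 n) x₀).target)
    (hx₁ : (extChartAt (𝓡 n) x₀).symm x ∈ (extChartAt (𝓡 n) x₁).source) :
    ContDiffAt ℝ 2 (transition x₀ x₁) x :=
  (contDiffAt_transition hx hx₁).of_le (WithTop.coe_le_coe.2 le_top)

/-- The local representations of the geodesic spray agree on overlaps. -/
lemma fderiv_tangentLift_chartSpray {x₀ x₁ : M} {p : Coord n × Coord n}
    (hx : p.1 ∈ (extChartAt (𝓡 n) x₀).target)
    (hx₁ : (extChartAt (𝓡 n) x₀).symm p.1 ∈ (extChartAt (𝓡 n) x₁).source) :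
    fderiv ℝ (tangentLift (transition x₀ x₁)) p (F.chartSpray x₀ p) =
      F.chartSpray x₁ (tangentLift (transition x₀ x₁) p) := by
  rcases eq_or_ne p.2 0 with h0 | h0
  · have hp : p = (p.1, 0) := by rw [← h0]
    have h1 : tangentLift (transition x₀ x₁) p = (transition x₀ x₁ p.1, 0) := by
      rw [tangentLift, h0, map_zero]
    rw [h1, chartSpray_zero]
    rw [hp, chartSpray_zero, map_zero]
  · have hp : p ∈ regularSet x₀ := ⟨hx, h0⟩
    have hp₁ := tangentLift_transition_mem hp hx₁
    exact fderiv_tangentLift_sprayOf (contDiffAt_two_transition hx hx₁)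
      (fderiv_transition_surjective hx hx₁)
      (contDiffAt_two (isOpen_regularSet x₀) (F.contDiffOn_energy x₀) hp)
      (F.hess_energy_pos hp)
      (contDiffAt_two (isOpen_regularSet x₁) (F.contDiffOn_energy x₁) hp₁)
      (F.hess_energy_pos hp₁) (F.energy_eventuallyEq hx hx₁)

lemma spray_eq (u : TangentBundle (𝓡 n) M) :
    F.spray u = F.chartSpray u.1 (tangentChart u.1 u) := by
  have h : tangentCoordChange (𝓡 n) u.1 u.1 u.1 u.2 = u.2 :=
    tangentCoordChange_self (mem_extChartAt_source _)
  have h2 : tangentChart u.1 u = (extChartAt (𝓡 n) u.1 u.1, u.2) := by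
    rw [tangentChart_apply]; exact Prod.ext rfl h
  rw [h2]
  rfl

end FinslerMetric

end Charts

/-! ### Topology of the tangent bundle; integral curves of the spray in charts. -/

section Curves

variable {n : ℕ} {M : Type*} [TopologicalSpace M] [ChartedSpace (Coord n) M]
  [IsManifold (𝓡 n) ∞ M]

lemma exists_countable_chart_cover [SecondCountableTopology M] :
    ∃ s : Set M, s.Countable ∧ ⋃ x ∈ s, (extChartAt (𝓡 n) x).source = univ := by
  obtain ⟨s, hs, h⟩ := TopologicalSpace.countable_cover_nhds (α := M)
    (f := fun x => (extChartAt (𝓡 n) x).source) fun x => extChartAt_source_mem_nhds x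
  exact ⟨s, hs, h⟩

instance tangentBundle_secondCountable [SecondCountableTopology M] :
    SecondCountableTopology (TangentBundle (𝓡 n) M) := by
  obtain ⟨s, hs, h⟩ := exists_countable_chart_cover (n := n) (M := M)
  have : SecondCountableTopology (ModelProd (Coord n) (Coord n)) :=
    inferInstanceAs (SecondCountableTopology (Coord n × Coord n))
  refine ChartedSpace.secondCountable_of_countable_cover (H := ModelProd (Coord n) (Coord n))
    (s := (fun x => (⟨x, 0⟩ : TangentBundle (𝓡 n) M)) '' s) ?_ (hs.image _)
  refine eq_univ_of_forall fun u => ?_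
  have hu : u.1 ∈ ⋃ x ∈ s, (extChartAt (𝓡 n) x).source := by rw [h]; trivial
  simp only [mem_iUnion] at hu
  obtain ⟨x, hx, hux⟩ := hu
  refine mem_biUnion (mem_image_of_mem _ hx) ?_
  have := mem_tangentChart_source.2 hux
  rwa [tangentChart, extChartAt_source] at this

lemma continuous_tangentBundle_proj :
    Continuous (fun u : TangentBundle (𝓡 n) M => u.1) :=
  FiberBundle.continuous_proj (Coord n) (TangentSpace (𝓡 n) : M → Type _)

instance tangentBundle_t2 [T2Space M] : T2Space (TangentBundle (𝓡 n) M) := by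
  refine ⟨fun u v huv => ?_⟩
  by_cases h : u.1 = v.1
  · have hu : u ∈ (tangentChart u.1).source := mem_tangentChart_source.2 (mem_extChartAt_source _)
    have hv : v ∈ (tangentChart u.1).source := mem_tangentChart_source.2 (by
      rw [← h]; exact mem_extChartAt_source _)
    have hne : tangentChart u.1 u ≠ tangentChart u.1 v := fun he =>
      huv ((tangentChart u.1).injOn hu hv he)
    obtain ⟨A, B, hA, hB, huA, hvB, hAB⟩ := t2_separation hne
    refine ⟨_, _, (continuousOn_tangentChart u.1).isOpen_inter_preimage
      (isOpen_tangentChart_source u.1) hA, (continuousOn_tangentChart u.1).isOpen_inter_preimage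
      (isOpen_tangentChart_source u.1) hB, ⟨hu, huA⟩, ⟨hv, hvB⟩, ?_⟩
    exact disjoint_left.2 fun z hz hz' => disjoint_left.1 hAB hz.2 hz'.2
  · obtain ⟨A, B, hA, hB, huA, hvB, hAB⟩ := t2_separation h
    exact ⟨_, _, hA.preimage continuous_tangentBundle_proj,
      hB.preimage continuous_tangentBundle_proj, huA, hvB, hAB.preimage _⟩

/-- The set of nonzero tangent vectors. -/
def slit (n : ℕ) (M : Type*) [TopologicalSpace M] [ChartedSpace (Coord n) M]
    [IsManifold (𝓡 n) ∞ M] : Set (TangentBundle (𝓡 n) M) := {u | u.2 ≠ 0}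

lemma tangentChart_mem_regularSet {x₀ : M} {u : TangentBundle (𝓡 n) M}
    (hu : u.1 ∈ (extChartAt (𝓡 n) x₀).source) :
    tangentChart x₀ u ∈ regularSet x₀ ↔ u ∈ slit n M :=
  ⟨fun h => (tangentChart_snd_ne_zero hu).1 h.2,
    fun h => ⟨(extChartAt (𝓡 n) x₀).map_source hu, (tangentChart_snd_ne_zero hu).2 h⟩⟩

lemma isOpen_slit : IsOpen (slit n M) := by
  refine isOpen_iff_mem_nhds.2 fun u hu => ?_
  have hs : u.1 ∈ (extChartAt (𝓡 n) u.1).source := mem_extChartAt_source _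
  have h := (continuousOn_tangentChart u.1).isOpen_inter_preimage
    (isOpen_tangentChart_source u.1) (isOpen_regularSet (n := n) u.1)
  refine Filter.mem_of_superset (h.mem_nhds ⟨mem_tangentChart_source.2 hs,
    (tangentChart_mem_regularSet hs).2 hu⟩) fun v hv => ?_
  exact (tangentChart_mem_regularSet (mem_tangentChart_source.1 hv.1)).1 hv.2

lemma hasDerivWithinAt_tangentLift_transition {x₀ x₁ : M} {c : ℝ → Coord n × Coord n}
    {V : Coord n × Coord n} {s : Set ℝ} {t : ℝ} (hc : HasDerivWithinAt c V s t)
    (hx : (c t).1 ∈ (extChartAt (𝓡 n) x₀).target)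
    (hx₁ : (extChartAt (𝓡 n) x₀).symm (c t).1 ∈ (extChartAt (𝓡 n) x₁).source) :
    HasDerivWithinAt (fun r => tangentLift (transition x₀ x₁) (c r))
      (fderiv ℝ (tangentLift (transition x₀ x₁)) (c t) V) s t :=
  (hasFDerivAt_tangentLift
    (FinslerMetric.contDiffAt_two_transition hx hx₁)).differentiableAt.hasFDerivAt
      |>.comp_hasDerivWithinAt t hc

namespace FinslerMetric

variable (F : FinslerMetric n M)

/-- The manifold derivative at time `t` is read in the preferred chart at the base point of `u t`,
where `spray_eq` gives the spray. -/
lemma hasMFDerivWithinAt_iff {u : ℝ → TangentBundle (𝓡 n) M} {s : Set ℝ} {t : ℝ} :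
    HasMFDerivWithinAt 𝓘(ℝ, ℝ) (𝓡 n).tangent u s t
      ((1 : ℝ →L[ℝ] ℝ).smulRight (F.spray (u t))) ↔
    ContinuousWithinAt u s t ∧ HasDerivWithinAt (fun r => tangentChart (u t).1 (u r))
      (F.chartSpray (u t).1 (tangentChart (u t).1 (u t))) s t := by
  have hs : (extChartAt 𝓘(ℝ, ℝ) t).symm ⁻¹' s ∩ range 𝓘(ℝ, ℝ) = s := by
    rw [ModelWithCorners.range_eq_univ, inter_univ, extChartAt_model_space_eq_id]
    rfl
  have hV : ∀ V : Coord n × Coord n, (1 : ℝ →L[ℝ] ℝ).smulRight V =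
      ContinuousLinearMap.toSpanSingleton ℝ V := fun V => by ext <;> simp
  unfold HasMFDerivWithinAt
  rw [hs, spray_eq]
  refine and_congr_right fun _ => ?_
  rw [hasDerivWithinAt_iff_hasFDerivWithinAt, ← hV]
  exact Iff.rfl

/-- Integral curves of the spray satisfy the geodesic equation in every chart. -/
lemma hasDerivWithinAt_tangentChart {u : ℝ → TangentBundle (𝓡 n) M} {s : Set ℝ} {t : ℝ}
    (h : IsMIntegralCurveOn u F.spray s) (ht : t ∈ s) {x₀ : M}
    (hx₀ : (u t).1 ∈ (extChartAt (𝓡 n) x₀).source) :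
    HasDerivWithinAt (fun r => tangentChart x₀ (u r))
      (F.chartSpray x₀ (tangentChart x₀ (u t))) s t := by
  obtain ⟨hc, hd⟩ := F.hasMFDerivWithinAt_iff.1 (h t ht)
  have hs : (u t).1 ∈ (extChartAt (𝓡 n) (u t).1).source := mem_extChartAt_source _
  have htar : (tangentChart (u t).1 (u t)).1 ∈ (extChartAt (𝓡 n) (u t).1).target :=
    (extChartAt (𝓡 n) (u t).1).map_source hs
  have hsym : (extChartAt (𝓡 n) (u t).1).symm (tangentChart (u t).1 (u t)).1 = (u t).1 :=
    (extChartAt (𝓡 n) (u t).1).left_inv hs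
  have hback : ∀ v : TangentBundle (𝓡 n) M, v.1 ∈ (extChartAt (𝓡 n) (u t).1).source →
      v.1 ∈ (extChartAt (𝓡 n) x₀).source →
      tangentLift (transition (u t).1 x₀) (tangentChart (u t).1 v) = tangentChart x₀ v :=
    fun v hv hv₀ => by
      rw [← tangentChart_tangentChart_symm ((extChartAt (𝓡 n) (u t).1).map_source hv),
        (tangentChart (u t).1).left_inv (mem_tangentChart_source.2 hv)]
      rw [tangentChart_apply]
      simp only
      rw [(extChartAt (𝓡 n) (u t).1).left_inv hv]
      exact hv₀
  have h1 := hasDerivWithinAt_tangentLift_transition hd htar (by rw [hsym]; exact hx₀)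
  rw [F.fderiv_tangentLift_chartSpray htar (by rw [hsym]; exact hx₀), hback _ hs hx₀] at h1
  have hev : ∀ᶠ r in 𝓝[s] t, (u r).1 ∈ (extChartAt (𝓡 n) (u t).1).source ∧
      (u r).1 ∈ (extChartAt (𝓡 n) x₀).source := by
    have hpc : ContinuousWithinAt (fun r => (u r).1) s t :=
      continuous_tangentBundle_proj.continuousAt.comp_continuousWithinAt hc
    exact (hpc.eventually ((isOpen_extChartAt_source _).mem_nhds hs)).and
      (hpc.eventually ((isOpen_extChartAt_source _).mem_nhds hx₀))
  exact h1.congr_of_eventuallyEq (hev.mono fun r hr => (hback _ hr.1 hr.2).symm)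
    (hback _ hs hx₀).symm

/-- Solutions of the geodesic equation in a chart are integral curves of the spray. -/
lemma isMIntegralCurveOn_of_chart {x₀ : M} {c : ℝ → Coord n × Coord n} {s : Set ℝ}
    (hc : ∀ t ∈ s, (c t).1 ∈ (extChartAt (𝓡 n) x₀).target)
    (hd : ∀ t ∈ s, HasDerivWithinAt c (F.chartSpray x₀ (c t)) s t) :
    IsMIntegralCurveOn (fun t => (tangentChart x₀).symm (c t)) F.spray s := by
  intro t ht
  have hs := mem_extChartAt_source (I := 𝓡 n) ((extChartAt (𝓡 n) x₀).symm (c t).1)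
  refine F.hasMFDerivWithinAt_iff.2 ⟨?_, ?_⟩
  · have h1 := (continuousOn_tangentChart_symm x₀).continuousAt
      ((isOpen_tangentChart_target x₀).mem_nhds (mem_tangentChart_target.2 (hc t ht)))
    exact ContinuousAt.comp_continuousWithinAt h1 (hd t ht).continuousWithinAt
  · have h1 := hasDerivWithinAt_tangentLift_transition
      (x₁ := (extChartAt (𝓡 n) x₀).symm (c t).1) (hd t ht) (hc t ht) hs
    rw [F.fderiv_tangentLift_chartSpray (hc t ht) hs] at h1
    have hev : ∀ᶠ r in 𝓝[s] t, (c r).1 ∈ (extChartAt (𝓡 n) x₀).target ∧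
        (extChartAt (𝓡 n) x₀).symm (c r).1 ∈
          (extChartAt (𝓡 n) ((extChartAt (𝓡 n) x₀).symm (c t).1)).source :=
      (hd t ht).continuousWithinAt.eventually (eventually_mem_overlap (hc t ht) hs)
    rw [← tangentChart_tangentChart_symm (hc t ht) hs] at h1
    exact h1.congr_of_eventuallyEq (hev.mono fun r hr =>
      tangentChart_tangentChart_symm hr.1 hr.2) (tangentChart_tangentChart_symm (hc t ht) hs)

/-- Euler's relation, from `E (x, (1 + s) y) = (1 + s)² E (x, y)`. Homogeneity is only positive, so
`s > -1` is needed, which holds near `s = 0`. -/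
lemma fderiv_energy_radial {x₀ : M} {p : Coord n × Coord n} (hp : p ∈ regularSet x₀) :
    fderiv ℝ (F.energy x₀) p (0, p.2) = 2 * F.energy x₀ p := by
  have h1 : HasFDerivAt (F.energy x₀) (fderiv ℝ (F.energy x₀) p) (p + (0 : ℝ) • (0, p.2)) := by
    rw [zero_smul, add_zero]
    exact ((contDiffAt_two (isOpen_regularSet x₀) (F.contDiffOn_energy x₀) hp).differentiableAt
      two_ne_zero).hasFDerivAt
  have h2 : HasDerivAt (fun s : ℝ => p + s • ((0 : Coord n), p.2)) (0, p.2) 0 :=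
    (((hasDerivAt_id (0 : ℝ)).smul_const ((0 : Coord n), p.2)).const_add p).congr_deriv
      (one_smul ℝ _)
  have h3 := h1.comp_hasDerivAt (0 : ℝ) h2
  have h4 : HasDerivAt (fun s : ℝ => (1 + s) ^ 2 * F.energy x₀ p) (2 * F.energy x₀ p) 0 := by
    have := ((((hasDerivAt_id (0 : ℝ)).const_add 1).fun_pow 2).mul_const (F.energy x₀ p))
    refine this.congr_deriv ?_
    simp
  have h5 : (F.energy x₀ ∘ fun s : ℝ => p + s • ((0 : Coord n), p.2)) =ᶠ[𝓝 0]
      fun s : ℝ => (1 + s) ^ 2 * F.energy x₀ p := by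
    filter_upwards [Ioi_mem_nhds (show (-1 : ℝ) < 0 by norm_num)] with s hs
    have h6 : p + s • ((0 : Coord n), p.2) = (p.1, (1 + s) • p.2) := by
      ext1 <;> simp [add_smul]
    have h7 : 0 ≤ 1 + s := by have := mem_Ioi.1 hs; linarith
    simp only [Function.comp_apply]
    rw [h6, energy, F.coord_smul x₀ _ _ h7, energy]
    ring
  exact h3.unique (h4.congr_of_eventuallyEq h5)

lemma fderiv_energy_chartSpray {x₀ : M} {p : Coord n × Coord n} (hp : p ∈ regularSet x₀) :
    fderiv ℝ (F.energy x₀) p (F.chartSpray x₀ p) = 0 :=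
  fderiv_apply_sprayOf (contDiffAt_two (isOpen_regularSet x₀) (F.contDiffOn_energy x₀) hp)
    (F.hess_energy_pos hp) (by
      filter_upwards [(isOpen_regularSet x₀).mem_nhds hp] with q hq
      exact F.fderiv_energy_radial hq)

lemma chartSpray_smul {x₀ : M} {x y : Coord n} (hp : (x, y) ∈ regularSet x₀) {c : ℝ}
    (hc : 0 < c) :
    F.chartSpray x₀ (x, c • y) = (c • y, c ^ 2 • (F.chartSpray x₀ (x, y)).2) := by
  have hp' : (x, c • y) ∈ regularSet x₀ := ⟨hp.1, smul_ne_zero hc.ne' hp.2⟩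
  exact sprayOf_smul (p := (x, y)) hc.ne'
    (contDiffAt_two (isOpen_regularSet x₀) (F.contDiffOn_energy x₀) hp)
    (F.hess_energy_pos hp) (contDiffAt_two (isOpen_regularSet x₀) (F.contDiffOn_energy x₀) hp')
    (F.hess_energy_pos hp') (Filter.Eventually.of_forall fun q => by
      rw [energy, energy, F.coord_smul x₀ _ _ hc.le]; ring)

end FinslerMetric

end Curves

/-! ### Short solutions of a second order equation with a quadratically homogeneous right side. -/

section Homogeneous

variable {V W : Type*} [NormedAddCommGroup V] [NormedSpace ℝ V] [FiniteDimensional ℝ V]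
  [NormedAddCommGroup W] [NormedSpace ℝ W]

/-- A map which is positively homogeneous of degree two in the second variable has a small
Lipschitz constant near the zero section. -/
lemma exists_lipschitzOnWith_of_homogeneous {Γ : V × V → W} {U : Set V} {p : V} (hU : IsOpen U)
    (hp : p ∈ U) (hΓ : ContDiffOn ℝ 1 Γ {q | q.1 ∈ U ∧ q.2 ≠ 0})
    (hhom : ∀ x ∈ U, ∀ y : V, y ≠ 0 → ∀ c : ℝ, 0 < c → Γ (x, c • y) = c ^ 2 • Γ (x, y))
    (h0 : ∀ x ∈ U, Γ (x, 0) = 0) {ε : ℝ≥0} (hε : 0 < ε) :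
    ∃ δ > 0, Metric.closedBall p δ ⊆ U ∧
      LipschitzOnWith ε Γ (Metric.closedBall (p, (0 : V)) δ) := by
  have hO : IsOpen {q : V × V | q.1 ∈ U ∧ q.2 ≠ 0} :=
    (hU.preimage continuous_fst).inter (isOpen_ne.preimage continuous_snd)
  obtain ⟨ρ, hρ, hρU⟩ := Metric.nhds_basis_closedBall.mem_iff.1 (hU.mem_nhds hp)
  have hK : IsCompact (Metric.closedBall p ρ ×ˢ Metric.sphere (0 : V) 1) :=
    (isCompact_closedBall p ρ).prod (isCompact_sphere 0 1)
  have hKO : Metric.closedBall p ρ ×ˢ Metric.sphere (0 : V) 1 ⊆ {q | q.1 ∈ U ∧ q.2 ≠ 0} :=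
    fun q hq => ⟨hρU hq.1, fun h => by
      have := hq.2; rw [h, mem_sphere_zero_iff_norm, norm_zero] at this; norm_num at this⟩
  obtain ⟨C₁, hC₁⟩ := hK.exists_bound_of_continuousOn (hΓ.continuousOn.mono hKO)
  obtain ⟨C₂, hC₂⟩ := hK.exists_bound_of_continuousOn
    ((hΓ.continuousOn_fderiv_of_isOpen hO le_rfl).mono hKO)
  have hsq : ∀ x ∈ Metric.closedBall p ρ, ∀ y : V, ‖Γ (x, y)‖ ≤ |C₁| * ‖y‖ ^ 2 := by
    intro x hx y
    rcases eq_or_ne y 0 with rfl | hy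
    · rw [h0 x (hρU hx)]; simp
    · have hy' : 0 < ‖y‖ := norm_pos_iff.2 hy
      have hθ : (x, ‖y‖⁻¹ • y) ∈ Metric.closedBall p ρ ×ˢ Metric.sphere (0 : V) 1 :=
        ⟨hx, by rw [mem_sphere_zero_iff_norm, norm_smul, norm_inv, norm_norm,
          inv_mul_cancel₀ hy'.ne']⟩
      have h1 := hhom x (hρU hx) _ (hKO hθ).2 ‖y‖ hy'
      rw [smul_smul, mul_inv_cancel₀ hy'.ne', one_smul] at h1
      rw [h1, norm_smul, norm_pow, norm_norm, mul_comm]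
      gcongr
      exact (hC₁ _ hθ).trans (le_abs_self _)
  -- Smoothness is assumed only off the zero section; on it the quadratic bound `hsq` gives
  -- derivative zero.
  have hd0 : ∀ x ∈ Metric.ball p ρ, HasFDerivAt Γ (0 : V × V →L[ℝ] W) (x, 0) := by
    intro x hx
    rw [hasFDerivAt_iff_isLittleO_nhds_zero]
    have h1 : (fun h : V × V => Γ ((x, 0) + h) - Γ (x, 0) - (0 : V × V →L[ℝ] W) h) =O[𝓝 0]
        fun h => ‖h‖ ^ 2 := by
      refine Asymptotics.IsBigO.of_bound |C₁| ?_
      have h2 : ∀ᶠ h : V × V in 𝓝 0, x + h.1 ∈ Metric.ball p ρ := by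
        have h3 : Continuous fun h : V × V => x + h.1 := by fun_prop
        exact h3.continuousAt.eventually (Metric.isOpen_ball.mem_nhds (by simpa using hx))
      filter_upwards [h2] with h hh
      have h4 : ((x, 0) : V × V) + h = (x + h.1, h.2) := by ext1 <;> simp
      rw [h4, h0 x (hρU (Metric.ball_subset_closedBall hx))]
      simp only [sub_zero, _root_.zero_apply, norm_pow, norm_norm]
      refine (hsq _ (Metric.ball_subset_closedBall hh) _).trans ?_
      gcongr
      exact norm_snd_le h
    refine h1.trans_isLittleO ?_
    have h3 := Asymptotics.isLittleO_norm_pow_id (E' := V × V) one_lt_two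
    exact h3
  -- With `l = ‖y‖`, near `(x, y)` the map is `l² Γ ∘ A`, where `A` rescales the fibre to the unit
  -- sphere and has norm at most `l⁻¹` because `l ≤ 1`. One factor `l` remains.
  have hder : ∀ x ∈ Metric.ball p ρ, ∀ y : V, y ≠ 0 → ‖y‖ ≤ 1 →
      ‖fderiv ℝ Γ (x, y)‖ ≤ |C₂| * ‖y‖ := by
    intro x hx y hy hy1
    have hxU := hρU (Metric.ball_subset_closedBall hx)
    set l := ‖y‖ with hl
    have hy' : 0 < l := norm_pos_iff.2 hy
    set θ := l⁻¹ • y with hθd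
    have hθ : (x, θ) ∈ Metric.closedBall p ρ ×ˢ Metric.sphere (0 : V) 1 :=
      ⟨Metric.ball_subset_closedBall hx, by
        rw [mem_sphere_zero_iff_norm, norm_smul, norm_inv, norm_norm, inv_mul_cancel₀ hy'.ne']⟩
    set A : V × V →L[ℝ] V × V :=
      (ContinuousLinearMap.fst ℝ V V).prod (l⁻¹ • ContinuousLinearMap.snd ℝ V V) with hA
    have hAxy : A (x, y) = (x, θ) := by simp [hA, hθd]
    have hdθ : HasFDerivAt Γ (fderiv ℝ Γ (x, θ)) (A (x, y)) := by
      rw [hAxy]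
      exact ((hΓ.contDiffAt (hO.mem_nhds (hKO hθ))).differentiableAt one_ne_zero).hasFDerivAt
    have h1 : HasFDerivAt (fun q => l ^ 2 • Γ (A q)) (l ^ 2 • (fderiv ℝ Γ (x, θ)).comp A) (x, y) :=
      (hdθ.comp (x, y) A.hasFDerivAt).const_smul (l ^ 2)
    have h2 : Γ =ᶠ[𝓝 (x, y)] fun q => l ^ 2 • Γ (A q) := by
      filter_upwards [hO.mem_nhds (show ((x, y) : V × V) ∈ {q : V × V | q.1 ∈ U ∧ q.2 ≠ 0} from
        ⟨hxU, hy⟩)] with q hq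
      have h3 := hhom q.1 hq.1 (l⁻¹ • q.2) (smul_ne_zero (inv_ne_zero hy'.ne') hq.2) l hy'
      rw [smul_smul, mul_inv_cancel₀ hy'.ne', one_smul] at h3
      exact h3
    rw [(h1.congr_of_eventuallyEq h2).fderiv]
    refine ContinuousLinearMap.opNorm_le_bound _ (by positivity) fun h => ?_
    simp only [_root_.smul_apply, ContinuousLinearMap.comp_apply]
    have hAh : ‖A h‖ ≤ l⁻¹ * ‖h‖ := by
      rw [Prod.norm_def]
      refine max_le ?_ ?_
      · refine (norm_fst_le h).trans ?_
        exact le_mul_of_one_le_left (norm_nonneg h) ((one_le_inv₀ hy').2 hy1)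
      · change ‖l⁻¹ • h.2‖ ≤ _
        rw [norm_smul, norm_inv, hl, norm_norm]
        gcongr
        exact norm_snd_le h
    rw [norm_smul, norm_pow, hl, norm_norm, ← hl]
    calc l ^ 2 * ‖fderiv ℝ Γ (x, θ) (A h)‖ ≤ l ^ 2 * (|C₂| * (l⁻¹ * ‖h‖)) := by
          gcongr
          exact (ContinuousLinearMap.le_opNorm _ _).trans (mul_le_mul
            ((hC₂ _ hθ).trans (le_abs_self _)) hAh (norm_nonneg _) (abs_nonneg _))
      _ = |C₂| * l * ‖h‖ := by field_simp
  obtain ⟨δ, hδ, hδ1, hδρ, hδε⟩ : ∃ δ > 0, δ ≤ 1 ∧ δ < ρ ∧ |C₂| * δ ≤ ε := by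
    refine ⟨min (min 1 (ρ / 2)) (ε / (|C₂| + 1)), by positivity,
      (min_le_left _ _).trans (min_le_left _ _),
      ((min_le_left _ _).trans (min_le_right _ _)).trans_lt (by linarith), ?_⟩
    have h1 : |C₂| * (ε / (|C₂| + 1)) ≤ ε := by
      rw [mul_div_assoc', div_le_iff₀ (by positivity)]
      have : (0 : ℝ) ≤ ε := ε.2
      nlinarith [abs_nonneg C₂]
    exact (mul_le_mul_of_nonneg_left (min_le_right _ _) (abs_nonneg _)).trans h1
  refine ⟨δ, hδ, (Metric.closedBall_subset_closedBall hδρ.le).trans hρU, ?_⟩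
  have hmem : ∀ q ∈ Metric.closedBall (p, (0 : V)) δ, q.1 ∈ Metric.ball p ρ ∧ ‖q.2‖ ≤ δ := by
    intro q hq
    rw [mem_closedBall_iff_norm, Prod.norm_def] at hq
    exact ⟨mem_ball_iff_norm.2 (((le_max_left _ _).trans hq).trans_lt hδρ), by
      simpa using (le_max_right _ _).trans hq⟩
  have hdiff : ∀ q ∈ Metric.closedBall (p, (0 : V)) δ, DifferentiableAt ℝ Γ q ∧
      ‖fderiv ℝ Γ q‖ ≤ ε := by
    intro q hq
    obtain ⟨h1, h2⟩ := hmem q hq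
    rcases eq_or_ne q.2 0 with h | h
    · have hq0 : q = (q.1, 0) := by rw [← h]
      have h3 := hd0 q.1 h1
      rw [← hq0] at h3
      exact ⟨h3.differentiableAt, by rw [h3.fderiv, norm_zero]; exact ε.2⟩
    · refine ⟨(hΓ.contDiffAt (hO.mem_nhds ⟨hρU (Metric.ball_subset_closedBall h1),
        h⟩)).differentiableAt one_ne_zero, (hder q.1 h1 q.2 h (h2.trans hδ1)).trans ?_⟩
      exact (mul_le_mul_of_nonneg_left h2 (abs_nonneg _)).trans hδε
  exact (convex_closedBall _ _).lipschitzOnWith_of_nnnorm_fderiv_le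
    (fun q hq => (hdiff q hq).1) fun q hq => (hdiff q hq).2

/-- A family of curves `t ↦ X q v t` which differs little from the family `q + t v` of straight
lines, for `q` close to `p` and small `v`. -/
structure IsAlmostLinear (ε a : ℝ) (p : V) (X : V → V → ℝ → V) : Prop where
  zero : ∀ q v, ‖q - p‖ ≤ a → ‖v‖ ≤ a → X q v 0 = q
  const : ∀ q, ‖q - p‖ ≤ a → ∀ t ∈ Icc (0 : ℝ) 1, X q 0 t = q
  lipschitz : ∀ q v q' v', ‖q - p‖ ≤ a → ‖v‖ ≤ a → ‖q' - p‖ ≤ a → ‖v'‖ ≤ a →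
    ∀ t ∈ Icc (0 : ℝ) 1, ‖(X q v t - q - t • v) - (X q' v' t - q' - t • v')‖ ≤
      ε * t * max ‖q - q'‖ ‖v - v'‖
  time : ∀ q v, ‖q - p‖ ≤ a → ‖v‖ ≤ a → ∀ t ∈ Icc (0 : ℝ) 1, ∀ t' ∈ Icc (0 : ℝ) 1,
    ‖(X q v t - q - t • v) - (X q v t' - q - t' • v)‖ ≤ ε * a * |t - t'|

section SecondOrder

variable {Γ : V × V → V} {p : V} {b : ℝ} {ε : ℝ≥0}

/-- The first order system `(y, Γ)` has Lipschitz constant one in the maximum norm, and Grönwall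
over unit time costs `exp 1 < 3`. -/
lemma norm_sub_le_of_secondOrder (hε : ε ≤ 1)
    (hΓ : LipschitzOnWith ε Γ (Metric.closedBall (p, (0 : V)) b)) {z z' : ℝ → V × V}
    (hz : ∀ t ∈ Icc (0 : ℝ) 1, HasDerivWithinAt z ((z t).2, Γ (z t)) (Icc 0 1) t ∧
      z t ∈ Metric.closedBall (p, (0 : V)) b)
    (hz' : ∀ t ∈ Icc (0 : ℝ) 1, HasDerivWithinAt z' ((z' t).2, Γ (z' t)) (Icc 0 1) t ∧
      z' t ∈ Metric.closedBall (p, (0 : V)) b) {t : ℝ} (ht : t ∈ Icc (0 : ℝ) 1) :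
    ‖z t - z' t‖ ≤ 3 * ‖z 0 - z' 0‖ := by
  have hS : LipschitzOnWith 1 (fun q : V × V => (q.2, Γ q)) (Metric.closedBall (p, (0 : V)) b) := by
    have h1 : LipschitzOnWith 1 (Prod.snd : V × V → V) (Metric.closedBall (p, (0 : V)) b) :=
      LipschitzWith.prod_snd.lipschitzOnWith
    have h2 := h1.prodMk (hΓ.weaken hε)
    rwa [max_self] at h2
  have h := dist_le_of_trajectories_ODE_of_mem (v := fun _ q => (q.2, Γ q))
    (s := fun _ => Metric.closedBall (p, (0 : V)) b) (K := 1) (a := 0) (b := 1)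
    (δ := dist (z 0) (z' 0)) (fun _ _ => hS)
    (fun t ht => (hz t ht).1.continuousWithinAt)
    (fun t ht => hasDerivWithinAt_Ici_of_Icc (hz t (Ico_subset_Icc_self ht)).1 ht)
    (fun t ht => (hz t (Ico_subset_Icc_self ht)).2)
    (fun t ht => (hz' t ht).1.continuousWithinAt)
    (fun t ht => hasDerivWithinAt_Ici_of_Icc (hz' t (Ico_subset_Icc_self ht)).1 ht)
    (fun t ht => (hz' t (Ico_subset_Icc_self ht)).2) le_rfl t ht
  rw [dist_eq_norm, dist_eq_norm] at h
  refine h.trans ?_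
  rw [mul_comm]
  gcongr
  have h1 : Real.exp (((1 : ℝ≥0) : ℝ) * (t - 0)) ≤ Real.exp 1 := by
    apply Real.exp_le_exp.2
    simpa using ht.2
  exact h1.trans (Real.exp_one_lt_d9.le.trans (by norm_num))

/-- Deviation from the straight line is a double time integral of `Γ`, so differences of deviations
gain the Lipschitz constant `ε` of `Γ`. -/
lemma norm_sub_sub_le_of_secondOrder (hε : ε ≤ 1)
    (hΓ : LipschitzOnWith ε Γ (Metric.closedBall (p, (0 : V)) b)) {z z' : ℝ → V × V}
    (hz : ∀ t ∈ Icc (0 : ℝ) 1, HasDerivWithinAt z ((z t).2, Γ (z t)) (Icc 0 1) t ∧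
      z t ∈ Metric.closedBall (p, (0 : V)) b)
    (hz' : ∀ t ∈ Icc (0 : ℝ) 1, HasDerivWithinAt z' ((z' t).2, Γ (z' t)) (Icc 0 1) t ∧
      z' t ∈ Metric.closedBall (p, (0 : V)) b) {t : ℝ} (ht : t ∈ Icc (0 : ℝ) 1) :
    ‖((z t).1 - (z 0).1 - t • (z 0).2) - ((z' t).1 - (z' 0).1 - t • (z' 0).2)‖ ≤
      3 * ε * t * ‖z 0 - z' 0‖ := by
  have h0 : (0 : ℝ) ∈ Icc (0 : ℝ) 1 := ⟨le_rfl, zero_le_one⟩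
  have hv : ∀ s ∈ Icc (0 : ℝ) 1, ‖((z s).2 - (z' s).2) - ((z 0).2 - (z' 0).2)‖ ≤
      3 * ε * ‖z 0 - z' 0‖ := by
    intro s hs
    have h1 := (convex_Icc (0 : ℝ) 1).norm_image_sub_le_of_norm_hasDerivWithin_le
      (f := fun r => (z r).2 - (z' r).2) (f' := fun r => Γ (z r) - Γ (z' r))
      (C := 3 * ε * ‖z 0 - z' 0‖)
      (fun r hr => (hasFDerivAt_snd.comp_hasDerivWithinAt r (hz r hr).1).sub
        (hasFDerivAt_snd.comp_hasDerivWithinAt r (hz' r hr).1))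
      (fun r hr => (hΓ.norm_sub_le (hz r hr).2 (hz' r hr).2).trans (by
        have := norm_sub_le_of_secondOrder hε hΓ hz hz' hr
        calc (ε : ℝ) * ‖z r - z' r‖ ≤ ε * (3 * ‖z 0 - z' 0‖) := by gcongr
          _ = _ := by ring)) h0 hs
    refine h1.trans ?_
    have h2 : ‖s - 0‖ ≤ 1 := by
      rw [sub_zero, Real.norm_eq_abs, abs_of_nonneg hs.1]; exact hs.2
    exact mul_le_of_le_one_right (by positivity) h2
  have h1 := (convex_Icc (0 : ℝ) 1).norm_image_sub_le_of_norm_hasDerivWithin_le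
    (f := fun r => ((z r).1 - (z' r).1) - r • ((z 0).2 - (z' 0).2))
    (f' := fun r => ((z r).2 - (z' r).2) - ((z 0).2 - (z' 0).2))
    (C := 3 * ε * ‖z 0 - z' 0‖)
    (fun r hr => (((hasFDerivAt_fst.comp_hasDerivWithinAt r (hz r hr).1).sub
        (hasFDerivAt_fst.comp_hasDerivWithinAt r (hz' r hr).1)).sub
        ((hasDerivWithinAt_id r _).smul_const ((z 0).2 - (z' 0).2))).congr_deriv (by simp))
    hv h0 ht
  rw [sub_zero, Real.norm_eq_abs, abs_of_nonneg ht.1] at h1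
  calc _ = ‖(fun r => ((z r).1 - (z' r).1) - r • ((z 0).2 - (z' 0).2)) t -
        (fun r => ((z r).1 - (z' r).1) - r • ((z 0).2 - (z' 0).2)) 0‖ := by
        congr 1; simp only [zero_smul, smul_sub]; abel
    _ ≤ _ := h1
    _ = _ := by ring

lemma norm_sub_le_time_of_secondOrder (h0 : Γ (p, 0) = 0) (hb : 0 ≤ b)
    (hΓ : LipschitzOnWith ε Γ (Metric.closedBall (p, (0 : V)) b)) {z : ℝ → V × V}
    (hz : ∀ t ∈ Icc (0 : ℝ) 1, HasDerivWithinAt z ((z t).2, Γ (z t)) (Icc 0 1) t ∧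
      z t ∈ Metric.closedBall (p, (0 : V)) b) {t t' : ℝ} (ht : t ∈ Icc (0 : ℝ) 1)
    (ht' : t' ∈ Icc (0 : ℝ) 1) :
    ‖((z t).1 - (z 0).1 - t • (z 0).2) - ((z t').1 - (z 0).1 - t' • (z 0).2)‖ ≤
      ε * b * |t - t'| := by
  have h00 : (0 : ℝ) ∈ Icc (0 : ℝ) 1 := ⟨le_rfl, zero_le_one⟩
  have hv : ∀ s ∈ Icc (0 : ℝ) 1, ‖(z s).2 - (z 0).2‖ ≤ ε * b := by
    intro s hs
    have h1 := (convex_Icc (0 : ℝ) 1).norm_image_sub_le_of_norm_hasDerivWithin_le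
      (f := fun r => (z r).2) (f' := fun r => Γ (z r)) (C := ε * b)
      (fun r hr => (hasFDerivAt_snd (𝕜 := ℝ) (E := V) (F := V) (p := z r)).comp_hasDerivWithinAt r
        (hz r hr).1)
      (fun r hr => by
        have h2 := hΓ.norm_sub_le (hz r hr).2 (Metric.mem_closedBall_self hb)
        rw [h0, sub_zero] at h2
        exact h2.trans (mul_le_mul_of_nonneg_left (mem_closedBall_iff_norm.1 (hz r hr).2) ε.2))
      h00 hs
    refine h1.trans ?_
    have h2 : ‖s - 0‖ ≤ 1 := by
      rw [sub_zero, Real.norm_eq_abs, abs_of_nonneg hs.1]; exact hs.2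
    exact mul_le_of_le_one_right (by positivity) h2
  exact (convex_Icc (0 : ℝ) 1).norm_image_sub_le_of_norm_hasDerivWithin_le
    (f := fun r => (z r).1 - (z 0).1 - r • (z 0).2)
    (f' := fun r => (z r).2 - (z 0).2)
    (C := ε * b)
    (fun r hr => (((hasFDerivAt_fst.comp_hasDerivWithinAt r (hz r hr).1).sub_const _).sub
        ((hasDerivWithinAt_id r _).smul_const (z 0).2)).congr_deriv (by simp))
    hv ht' ht

end SecondOrder

/-- Short geodesics of a quadratic second order equation form an almost linear family. -/
theorem exists_isAlmostLinear_of_homogeneous {Γ : V × V → V} {U : Set V} {p : V} (hU : IsOpen U)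
    (hp : p ∈ U) (hΓ : ContDiffOn ℝ 1 Γ {q | q.1 ∈ U ∧ q.2 ≠ 0})
    (hhom : ∀ x ∈ U, ∀ y : V, y ≠ 0 → ∀ c : ℝ, 0 < c → Γ (x, c • y) = c ^ 2 • Γ (x, y))
    (h0 : ∀ x ∈ U, Γ (x, 0) = 0) {ε : ℝ≥0} (hε : 0 < ε) :
    ∃ a > 0, ∃ c : V → V → ℝ → V × V,
      (∀ q v, ‖q - p‖ ≤ a → ‖v‖ ≤ a → c q v 0 = (q, v) ∧ ∀ t ∈ Icc (0 : ℝ) 1,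
        HasDerivWithinAt (c q v) ((c q v t).2, Γ (c q v t)) (Icc 0 1) t ∧ (c q v t).1 ∈ U) ∧
      IsAlmostLinear ε a p fun q v t => (c q v t).1 := by
  -- The estimate in the initial data loses a factor 3, and the one in time is in terms of `b = 4
  -- a`; a quarter of `ε` serves both.
  set η : ℝ≥0 := min 1 (ε / 4) with hη
  have hη0 : 0 < η := by positivity
  have hη1 : η ≤ 1 := min_le_left _ _
  have hηε : 4 * (η : ℝ) ≤ ε := by
    have : (η : ℝ) ≤ ε / 4 := by exact_mod_cast min_le_right 1 (ε / 4)
    linarith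
  obtain ⟨b, hb, hbU, hL⟩ := exists_lipschitzOnWith_of_homogeneous hU hp hΓ hhom h0 hη0
  have hS : LipschitzOnWith 1 (fun q : V × V => (q.2, Γ q)) (Metric.closedBall (p, (0 : V)) b) := by
    have h1 : LipschitzOnWith 1 (Prod.snd : V × V → V) (Metric.closedBall (p, (0 : V)) b) :=
      LipschitzWith.prod_snd.lipschitzOnWith
    have h2 := h1.prodMk (hL.weaken hη1)
    rwa [max_self] at h2
  have hmem : ∀ q : V × V, q ∈ Metric.closedBall (p, (0 : V)) b ↔ ‖q.1 - p‖ ≤ b ∧ ‖q.2‖ ≤ b := by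
    intro q
    rw [mem_closedBall_iff_norm, Prod.norm_def, max_le_iff]
    simp
  have hbd : ∀ q ∈ Metric.closedBall (p, (0 : V)) b, ‖(q.2, Γ q)‖ ≤ b := by
    intro q hq
    have h1 := hS.norm_sub_le hq (Metric.mem_closedBall_self hb.le)
    simp only [h0 p hp] at h1
    rw [NNReal.coe_one, one_mul] at h1
    have h2 : ((q.2, Γ q) : V × V) - (0, 0) = (q.2, Γ q) := by ext1 <;> simp
    rw [h2] at h1
    exact h1.trans (mem_closedBall_iff_norm.1 hq)
  -- The speed bound on the ball of radius `b` is `b` itself, so solutions from the half ball are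
  -- obtained only up to time `1 / 2`. Homogeneity then helps: starting with velocity `2 v` and
  -- slowing time down by two gives a solution with velocity `v` on `[0, 1]`.
  obtain ⟨α, hα⟩ := exists_solutions_mem_closedBall (S := fun _ (q : V × V) => (q.2, Γ q))
    (p := (p, (0 : V))) (a := b) (r := b / 2) (L := b) (T := 1 / 2) (K := 1) (by positivity) hb.le
    (by norm_num) (fun _ _ => hS) (fun _ _ => continuousOn_const) (fun _ _ => hbd)
    (by linarith)
  set A : V × V →L[ℝ] V × V :=
    (ContinuousLinearMap.fst ℝ V V).prod ((1 / 2 : ℝ) • ContinuousLinearMap.snd ℝ V V) with hA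
  have hAa : ∀ q : V × V, A q = (q.1, (1 / 2 : ℝ) • q.2) := fun q => rfl
  have hin : ∀ q v : V, ‖q - p‖ ≤ b / 4 → ‖v‖ ≤ b / 4 →
      ((q, (2 : ℝ) • v) : V × V) ∈ Metric.closedBall (p, (0 : V)) (b / 2) := by
    intro q v hq hv
    rw [mem_closedBall_iff_norm, Prod.norm_def]
    refine max_le (by simpa using hq.trans (by linarith)) ?_
    simp only [Prod.snd_sub, sub_zero, norm_smul, Real.norm_ofNat]
    linarith
  set c : V → V → ℝ → V × V := fun q v t => A (α (q, (2 : ℝ) • v) (1 / 2 * t)) with hc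
  have hc0 : ∀ q v : V, ‖q - p‖ ≤ b / 4 → ‖v‖ ≤ b / 4 → c q v 0 = (q, v) := by
    intro q v hq hv
    simp only [hc]
    rw [mul_zero, (hα _ (hin q v hq hv)).1, hAa]
    ext1
    · rfl
    · simp [smul_smul]
  have hsol : ∀ q v : V, ‖q - p‖ ≤ b / 4 → ‖v‖ ≤ b / 4 → ∀ t ∈ Icc (0 : ℝ) 1,
      HasDerivWithinAt (c q v) ((c q v t).2, Γ (c q v t)) (Icc 0 1) t ∧
        c q v t ∈ Metric.closedBall (p, (0 : V)) b := by
    intro q v hq hv t ht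
    have hmaps : MapsTo (fun t : ℝ => 1 / 2 * t) (Icc 0 1) (Icc 0 (1 / 2)) := fun s hs =>
      ⟨by have := hs.1; positivity, by have := hs.2; linarith⟩
    obtain ⟨h1, h2⟩ := (hα _ (hin q v hq hv)).2 _ (hmaps ht)
    set w := α (q, (2 : ℝ) • v) (1 / 2 * t) with hw
    have h3 : HasDerivWithinAt (fun t : ℝ => 1 / 2 * t) (1 / 2) (Icc 0 1) t :=
      ((hasDerivWithinAt_id t _).const_mul (1 / 2 : ℝ)).congr_deriv (by simp)
    have h4 := A.hasFDerivAt.comp_hasDerivWithinAt t (h1.scomp t h3 hmaps)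
    obtain ⟨h5, h6⟩ := (hmem w).1 h2
    refine ⟨h4.congr_deriv ?_, (hmem _).2 ⟨h5, ?_⟩⟩
    · have h7 : Γ (w.1, (1 / 2 : ℝ) • w.2) = (1 / 2 : ℝ) ^ 2 • Γ w := by
        have hwU : w.1 ∈ U := hbU (mem_closedBall_iff_norm.2 h5)
        rcases eq_or_ne w.2 0 with h | h
        · have : w = (w.1, 0) := by rw [← h]
          rw [h, smul_zero, this, h0 _ hwU, smul_zero]
        · exact hhom w.1 hwU w.2 h (1 / 2) (by norm_num)
      change A ((1 / 2 : ℝ) • (w.2, Γ w)) = ((A w).2, Γ (A w))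
      rw [hAa, hAa, h7]
      ext1
      · rfl
      · simp [smul_smul]; norm_num
    · change ‖(1 / 2 : ℝ) • w.2‖ ≤ b
      rw [norm_smul, Real.norm_of_nonneg (by norm_num)]
      have := norm_nonneg w.2
      linarith
  refine ⟨b / 4, by positivity, c, fun q v hq hv => ⟨hc0 q v hq hv, fun t ht => ?_⟩, ?_, ?_, ?_, ?_⟩
  · obtain ⟨h1, h2⟩ := hsol q v hq hv t ht
    exact ⟨h1, hbU (mem_closedBall_iff_norm.2 ((hmem _).1 h2).1)⟩
  · intro q v hq hv
    simp only [hc0 q v hq hv]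
  · intro q hq t ht
    have hz : ‖(0 : V)‖ ≤ b / 4 := by rw [norm_zero]; positivity
    have hqU : q ∈ U := hbU (mem_closedBall_iff_norm.2 (hq.trans (by linarith)))
    have h1 := norm_sub_le_of_secondOrder (z := c q 0) (z' := fun _ => (q, 0)) hη1 hL
      (hsol q 0 hq hz) (fun s _ => ⟨by
        simp only [h0 q hqU]; exact hasDerivWithinAt_const _ _ _,
        (hmem _).2 ⟨hq.trans (by linarith), by simpa using hb.le⟩⟩) ht
    rw [hc0 q 0 hq hz, sub_self, norm_zero, mul_zero, norm_le_zero_iff, sub_eq_zero] at h1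
    simp only [h1]
  · intro q v q' v' hq hv hq' hv' t ht
    have h1 := norm_sub_sub_le_of_secondOrder hη1 hL (hsol q v hq hv) (hsol q' v' hq' hv') ht
    rw [hc0 q v hq hv, hc0 q' v' hq' hv'] at h1
    refine h1.trans ?_
    rw [Prod.norm_def]
    simp only [Prod.fst_sub, Prod.snd_sub]
    have ht0 := ht.1
    have hη' : 3 * (η : ℝ) ≤ ε := by linarith [η.2]
    gcongr
  · intro q v hq hv t ht t' ht'
    have h1 := norm_sub_le_time_of_secondOrder (h0 p hp) hb.le hL (hsol q v hq hv) ht ht'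
    rw [hc0 q v hq hv] at h1
    refine h1.trans ?_
    have : (η : ℝ) * b ≤ ε * (b / 4) := by nlinarith
    gcongr

end Homogeneous

/-! ### Joining points by curves of an almost linear family. -/

section Joins

variable {V : Type*} [NormedAddCommGroup V] [NormedSpace ℝ V] [FiniteDimensional ℝ V]
  {ε a : ℝ} {p : V} {X : V → V → ℝ → V} {f : V → ℝ}

/-- Comparison with velocity zero, whose curve is constant. -/
lemma IsAlmostLinear.norm_error_le (hX : IsAlmostLinear ε a p X) {q v : V} (hq : ‖q - p‖ ≤ a)
    (hv : ‖v‖ ≤ a) {t : ℝ} (ht : t ∈ Icc (0 : ℝ) 1) : ‖X q v t - q - t • v‖ ≤ ε * t * ‖v‖ := by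
  have ha : 0 ≤ a := (norm_nonneg _).trans hq
  have h := hX.lipschitz q v q 0 hq hv hq (by simpa using ha) t ht
  rw [hX.const q hq t ht] at h
  simpa using h

/-- Two points are joined by a curve of an almost linear family. -/
lemma IsAlmostLinear.exists_eq (hX : IsAlmostLinear ε a p X) (hε : ε ≤ 1 / 2)
    {q q₂ : V} (hq : ‖q - p‖ ≤ a) {b t : ℝ} (hb : 2 * b ≤ a) (ht0 : 0 < t) (ht1 : t ≤ 1)
    (hq₂ : ‖q₂ - q‖ ≤ t * b) : ∃ v, ‖v‖ ≤ 2 * b ∧ X q v t = q₂ := by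
  have ht : t ∈ Icc (0 : ℝ) 1 := ⟨ht0.le, ht1⟩
  have hb0 : 0 ≤ b := by
    have := (norm_nonneg _).trans hq₂
    exact nonneg_of_mul_nonneg_right this ht0
  -- A fixed point of `φ` is a velocity that reaches `q₂` at time `t`; the error term makes `φ` a
  -- contraction with factor `1 / 2` of the ball of radius `2 b`.
  set φ : V → V := fun v => t⁻¹ • (q₂ - q - (X q v t - q - t • v)) with hφ
  have hmaps : MapsTo φ (Metric.closedBall 0 (2 * b)) (Metric.closedBall 0 (2 * b)) := by
    intro v hv
    rw [mem_closedBall_zero_iff] at hv ⊢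
    have h1 := hX.norm_error_le hq (hv.trans hb) ht
    simp only [hφ]
    rw [norm_smul, norm_inv, Real.norm_of_nonneg ht0.le, inv_mul_le_iff₀ ht0]
    have h2 : ε * t * ‖v‖ ≤ 1 / 2 * t * (2 * b) := by gcongr
    calc _ ≤ ‖q₂ - q‖ + ‖X q v t - q - t • v‖ := norm_sub_le _ _
      _ ≤ t * b + 1 / 2 * t * (2 * b) := by linarith
      _ = _ := by ring
  have hlip : LipschitzOnWith (1 / 2) φ (Metric.closedBall 0 (2 * b)) := by
    refine LipschitzOnWith.of_dist_le_mul fun v hv v' hv' => ?_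
    rw [mem_closedBall_zero_iff] at hv hv'
    have h1 := hX.lipschitz q v' q v hq (hv'.trans hb) hq (hv.trans hb) t ht
    rw [sub_self, norm_zero, max_eq_right (norm_nonneg _)] at h1
    rw [dist_eq_norm, dist_eq_norm]
    simp only [hφ]
    rw [← smul_sub, sub_sub_sub_cancel_left, norm_smul, norm_inv, Real.norm_of_nonneg ht0.le,
      inv_mul_le_iff₀ ht0]
    refine h1.trans ?_
    rw [norm_sub_rev v' v]
    push_cast
    have : ε * t * ‖v - v'‖ ≤ 1 / 2 * t * ‖v - v'‖ := by gcongr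
    linarith
  have hcontr : ContractingWith (1 / 2) (hmaps.restrict φ _ _) :=
    ⟨by rw [← NNReal.coe_lt_coe]; norm_num, hlip.mapsToRestrict hmaps⟩
  obtain ⟨v, hv, hfix, -⟩ := hcontr.exists_fixedPoint' Metric.isClosed_closedBall.isComplete hmaps
    (x := 0) (Metric.mem_closedBall_self (by positivity)) (edist_ne_top _ _)
  refine ⟨v, mem_closedBall_zero_iff.1 hv, ?_⟩
  have h1 : t • φ v = t • v := by rw [hfix]
  simp only [hφ] at h1
  rw [smul_smul, mul_inv_cancel₀ ht0.ne', one_smul] at h1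
  have h2 : q₂ - q - (X q v t - q - t • v) - t • v = q₂ - X q v t := by abel
  rw [h1, sub_self] at h2
  exact (sub_eq_zero.1 h2.symm).symm

/-- Joins of pairs of points along an almost linear family. -/
lemma IsAlmostLinear.exists_join (hX : IsAlmostLinear ε a p X) (hε0 : 0 ≤ ε) (hε : ε ≤ 1 / 2)
    (hconv : ∀ q v, ‖q - p‖ ≤ a → ‖v‖ ≤ a → ConvexOn ℝ (Icc 0 1) fun t => f (X q v t)) :
    ∃ J : V → V → ℝ → V, ∀ q₁ q₂, ‖q₁ - p‖ ≤ a / 4 → ‖q₂ - p‖ ≤ a / 4 →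
      ∀ t ∈ Icc (0 : ℝ) 1, f (J q₁ q₂ t) ≤ max (f q₁) (f q₂) ∧
      ‖J q₁ q₂ t - ((1 - t) • q₁ + t • q₂)‖ ≤ 2 * ε * a ∧
      ∀ q₁' q₂', ‖q₁' - p‖ ≤ a / 4 → ‖q₂' - p‖ ≤ a / 4 → ∀ t' ∈ Icc (0 : ℝ) 1,
        ‖(J q₁ q₂ t - ((1 - t) • q₁ + t • q₂)) -
          (J q₁' q₂' t' - ((1 - t') • q₁' + t' • q₂'))‖ ≤
        12 * ε * max ‖q₁ - q₁'‖ ‖q₂ - q₂'‖ + 2 * ε * a * |t - t'| := by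
  have h01 : (1 : ℝ) ∈ Icc (0 : ℝ) 1 := ⟨zero_le_one, le_rfl⟩
  have hex : ∀ q₁ q₂, ∃ v, ‖q₁ - p‖ ≤ a / 4 → ‖q₂ - p‖ ≤ a / 4 → ‖v‖ ≤ a ∧ X q₁ v 1 = q₂ := by
    intro q₁ q₂
    by_cases h : ‖q₁ - p‖ ≤ a / 4 ∧ ‖q₂ - p‖ ≤ a / 4
    · have hd : ‖q₂ - q₁‖ ≤ 1 * (a / 2) := by
        calc ‖q₂ - q₁‖ = ‖(q₂ - p) - (q₁ - p)‖ := by congr 1; abel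
          _ ≤ ‖q₂ - p‖ + ‖q₁ - p‖ := norm_sub_le _ _
          _ ≤ _ := by linarith
      have ha : 0 ≤ a := by linarith [(norm_nonneg _).trans h.1]
      obtain ⟨v, hv, hv1⟩ := hX.exists_eq hε (q := q₁) (q₂ := q₂) (b := a / 2)
        (h.1.trans (by linarith)) (by linarith) one_pos le_rfl hd
      exact ⟨v, fun _ _ => ⟨by linarith, hv1⟩⟩
    · exact ⟨0, fun h1 h2 => (h ⟨h1, h2⟩).elim⟩
  choose v hv using hex
  -- With `e t` the deviation of the curve from its tangent line, the deviation from the chord is `e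
  -- t - t e 1`, because the curve ends at `q₂`.
  have herr : ∀ q₁ q₂, ‖q₁ - p‖ ≤ a / 4 → ‖q₂ - p‖ ≤ a / 4 → ∀ t : ℝ,
      X q₁ (v q₁ q₂) t - ((1 - t) • q₁ + t • q₂) = (X q₁ (v q₁ q₂) t - q₁ - t • v q₁ q₂) -
        t • (X q₁ (v q₁ q₂) 1 - q₁ - (1 : ℝ) • v q₁ q₂) := by
    intro q₁ q₂ h1 h2 t
    rw [(hv q₁ q₂ h1 h2).2, one_smul, sub_smul, one_smul, smul_sub, smul_sub]
    abel
  refine ⟨fun q₁ q₂ t => X q₁ (v q₁ q₂) t, fun q₁ q₂ h1 h2 t ht => ?_⟩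
  have ha : 0 ≤ a := by linarith [(norm_nonneg _).trans h1]
  have h1a : ‖q₁ - p‖ ≤ a := h1.trans (by linarith)
  obtain ⟨hva, hv1⟩ := hv q₁ q₂ h1 h2
  refine ⟨?_, ?_, ?_⟩
  · have h := hconv q₁ _ h1a hva
    have h3 := h.2 (show (0 : ℝ) ∈ Icc 0 1 from ⟨le_rfl, zero_le_one⟩) h01
      (sub_nonneg.2 ht.2) ht.1 (by ring)
    simp only [smul_eq_mul, mul_zero, mul_one, zero_add] at h3
    rw [hX.zero _ _ h1a hva, hv1] at h3
    refine h3.trans ?_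
    have h4 := le_max_left (f q₁) (f q₂)
    have h5 := le_max_right (f q₁) (f q₂)
    nlinarith [ht.1, ht.2, mul_le_mul_of_nonneg_left h4 (sub_nonneg.2 ht.2),
      mul_le_mul_of_nonneg_left h5 ht.1]
  · simp only [herr q₁ q₂ h1 h2]
    have h3 := hX.norm_error_le h1a hva ht
    have h4 := hX.norm_error_le h1a hva h01
    have h5 : ε * t * ‖v q₁ q₂‖ ≤ ε * 1 * a := by
      have := ht.2; gcongr
    have h6 : t * ‖X q₁ (v q₁ q₂) 1 - q₁ - (1 : ℝ) • v q₁ q₂‖ ≤ 1 * (ε * 1 * a) := by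
      have := ht.2
      have := ht.1
      gcongr
      exact h4.trans (by gcongr)
    refine (norm_sub_le _ _).trans ?_
    rw [norm_smul, Real.norm_of_nonneg ht.1]
    linarith
  · intro q₁' q₂' h1' h2' t' ht'
    have h1a' : ‖q₁' - p‖ ≤ a := h1'.trans (by linarith)
    obtain ⟨hva', hv1'⟩ := hv q₁' q₂' h1' h2'
    simp only [herr q₁ q₂ h1 h2, herr q₁' q₂' h1' h2']
    set w := v q₁ q₂ with hw
    set w' := v q₁' q₂' with hw'
    set D := max ‖q₁ - q₁'‖ ‖q₂ - q₂'‖ with hD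
    have hD0 : 0 ≤ D := (norm_nonneg _).trans (le_max_left _ _)
    have hD1 : ‖q₁ - q₁'‖ ≤ D := le_max_left _ _
    have hD2 : ‖q₂ - q₂'‖ ≤ D := le_max_right _ _
    -- The velocity is determined by the end points up to the error at time one; that error contains
    -- `‖w - w'‖` with coefficient at most `1 / 2` and is absorbed.
    have hww : ‖w - w'‖ ≤ 5 * D := by
      have h3 := hX.lipschitz q₁ w q₁' w' h1a hva h1a' hva' 1 h01
      rw [hv1, hv1', one_smul, one_smul] at h3
      have h4 : w - w' = (q₂ - q₂') - (q₁ - q₁') - ((q₂ - q₁ - w) - (q₂' - q₁' - w')) := by abel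
      have h5 : ‖w - w'‖ ≤ ‖q₂ - q₂'‖ + ‖q₁ - q₁'‖ + ‖(q₂ - q₁ - w) - (q₂' - q₁' - w')‖ := by
        rw [h4]
        exact (norm_sub_le _ _).trans (by gcongr; exact norm_sub_le _ _)
      have h6 : ε * 1 * max ‖q₁ - q₁'‖ ‖w - w'‖ ≤ 1 / 2 * (D + ‖w - w'‖) := by
        rw [mul_one]
        refine mul_le_mul hε (max_le ?_ ?_) (le_max_of_le_left (norm_nonneg _)) (by norm_num)
        · linarith [norm_nonneg (w - w')]
        · linarith
      linarith
    have hmax : max ‖q₁ - q₁'‖ ‖w - w'‖ ≤ 5 * D := max_le (by linarith) hww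
    have hA : ‖(X q₁ w t - q₁ - t • w) - (X q₁' w' t - q₁' - t • w')‖ ≤ 5 * ε * D := by
      refine (hX.lipschitz q₁ w q₁' w' h1a hva h1a' hva' t ht).trans ?_
      calc ε * t * max ‖q₁ - q₁'‖ ‖w - w'‖ ≤ ε * 1 * (5 * D) := by
            have := ht.2; gcongr
        _ = _ := by ring
    have hB : ‖(X q₁' w' t - q₁' - t • w') - (X q₁' w' t' - q₁' - t' • w')‖ ≤
        ε * a * |t - t'| := hX.time q₁' w' h1a' hva' t ht t' ht'
    have hC : ‖(X q₁ w 1 - q₁ - (1 : ℝ) • w) - (X q₁' w' 1 - q₁' - (1 : ℝ) • w')‖ ≤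
        5 * ε * D := by
      refine (hX.lipschitz q₁ w q₁' w' h1a hva h1a' hva' 1 h01).trans ?_
      calc ε * 1 * max ‖q₁ - q₁'‖ ‖w - w'‖ ≤ ε * 1 * (5 * D) := by gcongr
        _ = _ := by ring
    have hE : ‖X q₁' w' 1 - q₁' - (1 : ℝ) • w'‖ ≤ ε * a := by
      refine (hX.norm_error_le h1a' hva' h01).trans ?_
      rw [mul_one]; gcongr
    generalize X q₁ w t - q₁ - t • w = A at *
    generalize X q₁' w' t - q₁' - t • w' = A' at *
    generalize X q₁' w' t' - q₁' - t' • w' = A'' at *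
    generalize X q₁ w 1 - q₁ - (1 : ℝ) • w = B at *
    generalize X q₁' w' 1 - q₁' - (1 : ℝ) • w' = B' at *
    have hsplit : A - t • B - (A'' - t' • B') = (A - A') + (A' - A'') - t • (B - B') -
        (t - t') • B' := by
      rw [smul_sub, sub_smul]; abel
    rw [hsplit]
    have h7 : ‖t • (B - B')‖ ≤ 1 * (5 * ε * D) := by
      rw [norm_smul, Real.norm_of_nonneg ht.1]
      have := ht.2
      gcongr
    have h8 : ‖(t - t') • B'‖ ≤ |t - t'| * (ε * a) := by
      rw [norm_smul, Real.norm_eq_abs]; gcongr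
    have h9 := norm_sub_le ((A - A') + (A' - A'') - t • (B - B')) ((t - t') • B')
    have h10 := norm_sub_le ((A - A') + (A' - A'')) (t • (B - B'))
    have h11 := norm_add_le (A - A') (A' - A'')
    nlinarith [mul_nonneg hε0 hD0]

end Joins

/-! ### Perturbed cubes; continuity of functions convex along an almost linear family. -/

section Cubes

variable {V : Type*} [NormedAddCommGroup V] [NormedSpace ℝ V] [FiniteDimensional ℝ V]
  {ε a : ℝ} {p : V} {X : V → V → ℝ → V} {f : V → ℝ}

lemma update_mem_cube {n : ℕ} {s : Fin n → ℝ} (hs : ‖s‖ ≤ 1) (i : Fin n) {c : ℝ} (hc : |c| ≤ 1) :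
    ‖Function.update s i c‖ ≤ 1 := by
  refine (pi_norm_le_iff_of_nonneg zero_le_one).2 fun j => ?_
  rcases eq_or_ne j i with rfl | h
  · simpa using hc
  · rw [Function.update_of_ne h]; exact (norm_le_pi_norm s j).trans hs

lemma norm_update_sub_update_le {n : ℕ} (s s' : Fin n → ℝ) (i : Fin n) (c : ℝ) :
    ‖Function.update s i c - Function.update s' i c‖ ≤ ‖s - s'‖ := by
  refine (pi_norm_le_iff_of_nonneg (norm_nonneg _)).2 fun j => ?_
  rcases eq_or_ne j i with rfl | h
  · simp
  · rw [Pi.sub_apply, Function.update_of_ne h, Function.update_of_ne h]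
    exact norm_le_pi_norm (s - s') j

lemma norm_update_sub_update_le_abs {n : ℕ} (s : Fin n → ℝ) (i : Fin n) (c c' : ℝ) :
    ‖Function.update s i c - Function.update s i c'‖ ≤ |c - c'| := by
  refine (pi_norm_le_iff_of_nonneg (abs_nonneg _)).2 fun j => ?_
  rcases eq_or_ne j i with rfl | h
  · simp
  · rw [Pi.sub_apply, Function.update_of_ne h, Function.update_of_ne h]
    simp

/-- A perturbation of an affine cube, obtained from the vertices by successive joins. -/
lemma IsAlmostLinear.exists_cube (hX : IsAlmostLinear ε a p X) (hε0 : 0 ≤ ε) (hε : ε ≤ 1 / 2)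
    (hconv : ∀ q v, ‖q - p‖ ≤ a → ‖v‖ ≤ a → ConvexOn ℝ (Icc 0 1) fun t => f (X q v t))
    (ha : 0 ≤ a) {n : ℕ} (L : (Fin n → ℝ) →L[ℝ] V) (hL : ∀ s, ‖L s‖ ≤ a / 8 * ‖s‖)
    (hμ : 4 * ε * 3 ^ n ≤ 1 / 8) {B : ℝ}
    (hB : ∀ s : Fin n → ℝ, (∀ j, s j = 1 ∨ s j = -1) → f (p + L s) ≤ B) {k : ℕ} (hk : k ≤ n) :
    ∃ P : (Fin n → ℝ) → V,
      (∀ s, ‖s‖ ≤ 1 → ‖P s - (p + L s)‖ ≤ 4 * ε * a * (3 ^ k - 1)) ∧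
      (∀ s s', ‖s‖ ≤ 1 → ‖s'‖ ≤ 1 → ‖(P s - (p + L s)) - (P s' - (p + L s'))‖ ≤
        4 * ε * a * (3 ^ k - 1) * ‖s - s'‖) ∧
      ∀ s, ‖s‖ ≤ 1 → (∀ j : Fin n, k ≤ j.val → s j = 1 ∨ s j = -1) → f (P s) ≤ B := by
  induction k with
  | zero =>
    exact ⟨fun s => p + L s, fun s _ => by simp, fun s s' _ _ => by simp,
      fun s _ h => hB s fun j => h j (Nat.zero_le _)⟩
  | succ k ih =>
    obtain ⟨P, hP1, hP2, hP3⟩ := ih (Nat.le_of_succ_le hk)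
    obtain ⟨J, hJ⟩ := hX.exists_join hε0 hε hconv
    set i : Fin n := ⟨k, hk⟩ with hi
    set m : ℝ := 4 * ε * a * (3 ^ k - 1) with hm
    have hpow : (1 : ℝ) ≤ 3 ^ k := one_le_pow₀ (by norm_num)
    have hm0 : 0 ≤ m := by
      have : (0 : ℝ) ≤ 3 ^ k - 1 := by linarith
      positivity
    have hm8 : m ≤ a / 8 := by
      have h1 : (3 : ℝ) ^ k ≤ 3 ^ n := pow_le_pow_right₀ (by norm_num) (Nat.le_of_succ_le hk)
      have h2 : 4 * ε * (3 ^ k - 1) ≤ 1 / 8 := by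
        refine le_trans ?_ hμ
        exact mul_le_mul_of_nonneg_left (by linarith) (by positivity)
      calc m = a * (4 * ε * (3 ^ k - 1)) := by rw [hm]; ring
        _ ≤ a * (1 / 8) := mul_le_mul_of_nonneg_left h2 ha
        _ = _ := by ring
    -- Each join at most doubles the error `m` and adds `4 ε a`, so this recursion leaves room in
    -- both estimates below.
    have hm' : 4 * ε * a * (3 ^ (k + 1) - 1) = 3 * m + 8 * ε * a := by rw [hm]; ring
    have hea : 0 ≤ ε * a := by positivity
    have hPa : ∀ s, ‖s‖ ≤ 1 → ‖P s - p‖ ≤ a / 4 := by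
      intro s hs
      have h1 : P s - p = (P s - (p + L s)) + L s := by abel
      rw [h1]
      refine (norm_add_le _ _).trans ?_
      have h2 : a / 8 * ‖s‖ ≤ a / 8 * 1 := by gcongr
      linarith [hP1 s hs, hL s]
    -- The new map joins the points over the two faces `s i = -1` and `s i = 1`, with parameter `τ
    -- s`. On these faces one more coordinate is a sign, so the induction hypothesis bounds `f` at
    -- both ends of the join.
    set lo : (Fin n → ℝ) → Fin n → ℝ := fun s => Function.update s i (-1) with hlo
    set hi' : (Fin n → ℝ) → Fin n → ℝ := fun s => Function.update s i 1 with hhi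
    set τ : (Fin n → ℝ) → ℝ := fun s => (1 + s i) / 2 with hτ
    have hlo1 : ∀ s, ‖s‖ ≤ 1 → ‖lo s‖ ≤ 1 := fun s hs => update_mem_cube hs i (by norm_num)
    have hhi1 : ∀ s, ‖s‖ ≤ 1 → ‖hi' s‖ ≤ 1 := fun s hs => update_mem_cube hs i (by norm_num)
    have hτ1 : ∀ s, ‖s‖ ≤ 1 → τ s ∈ Icc (0 : ℝ) 1 := by
      intro s hs
      have h1 := abs_le.1 ((norm_le_pi_norm s i).trans hs)
      exact ⟨by simp only [hτ]; linarith [h1.1], by simp only [hτ]; linarith [h1.2]⟩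
    have hcomb : ∀ s, (1 - τ s) • lo s + τ s • hi' s = s := by
      intro s
      ext j
      simp only [Pi.add_apply, Pi.smul_apply, smul_eq_mul, hlo, hhi, hτ]
      rcases eq_or_ne j i with rfl | h
      · simp only [Function.update_self]; ring
      · simp only [Function.update_of_ne h]; ring
    have hLcomb : ∀ s, p + L s = (1 - τ s) • (p + L (lo s)) + τ s • (p + L (hi' s)) := by
      intro s
      conv_lhs => rw [← hcomb s]
      simp only [map_add, map_smul, smul_add]
      simp only [sub_smul, one_smul]
      abel
    set R : (Fin n → ℝ) → V := fun s => P s - (p + L s) with hR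
    set K : (Fin n → ℝ) → V := fun s => J (P (lo s)) (P (hi' s)) (τ s) -
      ((1 - τ s) • P (lo s) + τ s • P (hi' s)) with hK
    have hsplit : ∀ s, J (P (lo s)) (P (hi' s)) (τ s) - (p + L s) =
        K s + ((1 - τ s) • R (lo s) + τ s • R (hi' s)) := by
      intro s
      simp only [hK, hR]
      rw [hLcomb s, smul_sub (1 - τ s), smul_sub (τ s)]
      abel
    refine ⟨fun s => J (P (lo s)) (P (hi' s)) (τ s), fun s hs => ?_, fun s s' hs hs' => ?_,
      fun s hs hv => ?_⟩
    · have h1 := (hJ _ _ (hPa _ (hlo1 s hs)) (hPa _ (hhi1 s hs)) _ (hτ1 s hs)).2.1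
      obtain ⟨ht0, ht1⟩ := hτ1 s hs
      simp only
      rw [hsplit, hm']
      have h2 : ‖(1 - τ s) • R (lo s) + τ s • R (hi' s)‖ ≤ m := by
        refine (norm_add_le _ _).trans ?_
        rw [norm_smul, norm_smul, Real.norm_of_nonneg ht0, Real.norm_of_nonneg (sub_nonneg.2 ht1)]
        have h3 := mul_le_mul_of_nonneg_left (hP1 _ (hlo1 s hs)) (sub_nonneg.2 ht1)
        have h4 := mul_le_mul_of_nonneg_left (hP1 _ (hhi1 s hs)) ht0
        simp only [hR]
        linarith
      refine (norm_add_le _ _).trans ?_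
      simp only [hK]
      linarith
    · obtain ⟨ht0, ht1⟩ := hτ1 s hs
      set d := ‖s - s'‖ with hd
      have hd0 : 0 ≤ d := norm_nonneg _
      have hdlo : ‖lo s - lo s'‖ ≤ d := norm_update_sub_update_le s s' i (-1)
      have hdhi : ‖hi' s - hi' s'‖ ≤ d := norm_update_sub_update_le s s' i 1
      have hdt : |τ s - τ s'| ≤ d / 2 := by
        have h1 : τ s - τ s' = (s - s') i / 2 := by simp only [hτ, Pi.sub_apply]; ring
        rw [h1, abs_div, abs_two]
        have := norm_le_pi_norm (s - s') i
        rw [Real.norm_eq_abs] at this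
        linarith
      have hPd : ∀ x y, ‖x‖ ≤ 1 → ‖y‖ ≤ 1 → ‖x - y‖ ≤ d → ‖P x - P y‖ ≤ a / 4 * d := by
        intro x y hx hy hxy
        have h1 : P x - P y = (R x - R y) + L (x - y) := by
          simp only [hR]; rw [map_sub]; abel
        rw [h1]
        refine (norm_add_le _ _).trans ?_
        have h2 : ‖R x - R y‖ ≤ a / 8 * d := (hP2 x y hx hy).trans (by gcongr)
        have h3 : ‖L (x - y)‖ ≤ a / 8 * d := (hL _).trans (by gcongr)
        linarith
      have hRR : ∀ x y, ‖x‖ ≤ 1 → ‖y‖ ≤ 1 → ‖x - y‖ ≤ d → ‖R x - R y‖ ≤ m * d :=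
        fun x y hx hy hxy => (hP2 x y hx hy).trans (by gcongr)
      have h1 := (hJ _ _ (hPa _ (hlo1 s hs)) (hPa _ (hhi1 s hs)) _ (hτ1 s hs)).2.2 _ _
        (hPa _ (hlo1 s' hs')) (hPa _ (hhi1 s' hs')) _ (hτ1 s' hs')
      have h2 : ‖K s - K s'‖ ≤ 4 * ε * a * d := by
        simp only [hK]
        refine h1.trans ?_
        have h3 : max ‖P (lo s) - P (lo s')‖ ‖P (hi' s) - P (hi' s')‖ ≤ a / 4 * d :=
          max_le (hPd _ _ (hlo1 s hs) (hlo1 s' hs') hdlo) (hPd _ _ (hhi1 s hs) (hhi1 s' hs') hdhi)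
        calc _ ≤ 12 * ε * (a / 4 * d) + 2 * ε * a * (d / 2) := by gcongr
          _ = _ := by ring
      have h4 : ‖R (hi' s') - R (lo s')‖ ≤ m * 2 := by
        refine (hP2 _ _ (hhi1 s' hs') (hlo1 s' hs')).trans ?_
        gcongr
        refine (norm_update_sub_update_le_abs s' i 1 (-1)).trans ?_
        norm_num
      -- The last summand comes from the changing weights; the faces are at distance 2, so it costs
      -- `|τ s - τ s'| · 2 m`.
      have hsp : (K s + ((1 - τ s) • R (lo s) + τ s • R (hi' s))) -
          (K s' + ((1 - τ s') • R (lo s') + τ s' • R (hi' s'))) =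
          (K s - K s') + ((1 - τ s) • (R (lo s) - R (lo s')) + τ s • (R (hi' s) - R (hi' s'))) +
            (τ s - τ s') • (R (hi' s') - R (lo s')) := by
        simp only [smul_sub, sub_smul, one_smul]; abel
      simp only
      rw [hsplit, hsplit, hm', hsp]
      refine (norm_add_le _ _).trans ((add_le_add_left (norm_add_le _ _) _).trans ?_)
      have h5 : ‖(1 - τ s) • (R (lo s) - R (lo s')) + τ s • (R (hi' s) - R (hi' s'))‖ ≤ m * d := by
        refine (norm_add_le _ _).trans ?_
        rw [norm_smul, norm_smul, Real.norm_of_nonneg ht0, Real.norm_of_nonneg (sub_nonneg.2 ht1)]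
        have h6 := mul_le_mul_of_nonneg_left
          (hRR _ _ (hlo1 s hs) (hlo1 s' hs') hdlo) (sub_nonneg.2 ht1)
        have h7 := mul_le_mul_of_nonneg_left (hRR _ _ (hhi1 s hs) (hhi1 s' hs') hdhi) ht0
        linarith
      have h8 : ‖(τ s - τ s') • (R (hi' s') - R (lo s'))‖ ≤ d / 2 * (m * 2) := by
        rw [norm_smul, Real.norm_eq_abs]; gcongr
      have h9 : 0 ≤ ε * a * d := by positivity
      nlinarith [mul_nonneg hm0 hd0]
    · have h1 := (hJ _ _ (hPa _ (hlo1 s hs)) (hPa _ (hhi1 s hs)) _ (hτ1 s hs)).1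
      have h2 : ∀ c : ℝ, c = 1 ∨ c = -1 → ∀ j : Fin n, k ≤ j.val →
          Function.update s i c j = 1 ∨ Function.update s i c j = -1 := by
        intro c hc j hj
        rcases eq_or_ne j i with rfl | h
        · rwa [Function.update_self]
        · rw [Function.update_of_ne h]
          refine hv j (Nat.lt_of_le_of_ne hj fun h' => h (Fin.ext h'.symm))
      exact h1.trans (max_le (hP3 _ (hlo1 s hs) (h2 _ (Or.inr rfl)))
        (hP3 _ (hhi1 s hs) (h2 _ (Or.inl rfl))))

variable (V) in
/-- Functions which are convex along an almost linear family are locally bounded above. -/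
theorem exists_isAlmostLinear_bound :
    ∃ ε : ℝ≥0, 0 < ε ∧ (ε : ℝ) ≤ 1 / 2 ∧ ∀ (a : ℝ) (p : V) (X : V → V → ℝ → V) (f : V → ℝ),
      0 < a → IsAlmostLinear ε a p X →
      (∀ q v, ‖q - p‖ ≤ a → ‖v‖ ≤ a → ConvexOn ℝ (Icc 0 1) fun t => f (X q v t)) →
      ∃ r > 0, ∃ B, ∀ q, ‖q - p‖ ≤ r → f q ≤ B := by
  set n := Module.finrank ℝ V with hn
  have L₀ : (Fin n → ℝ) ≃L[ℝ] V := ContinuousLinearEquiv.ofFinrankEq (by simp [hn])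
  set N := ‖(L₀ : (Fin n → ℝ) →L[ℝ] V)‖ + 1 with hN
  set N' := ‖(L₀.symm : V →L[ℝ] (Fin n → ℝ))‖ + 1 with hN'
  have hN1 : 1 ≤ N := by rw [hN]; linarith [norm_nonneg (L₀ : (Fin n → ℝ) →L[ℝ] V)]
  have hN1' : 1 ≤ N' := by rw [hN']; linarith [norm_nonneg (L₀.symm : V →L[ℝ] (Fin n → ℝ))]
  have hNN : 1 ≤ N * N' := one_le_mul_of_one_le_of_one_le hN1 hN1'
  have h3 : (1 : ℝ) ≤ 3 ^ n := one_le_pow₀ (by norm_num)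
  -- Chosen so that the Lipschitz error `m` of the perturbed cube is at most a third of `Q⁻¹`, where
  -- `Q` bounds the right inverse of `L`; the perturbation of `L` then still covers a ball.
  set e : ℝ := (96 * 3 ^ n * (N * N'))⁻¹ with he
  have he0 : 0 < e := by positivity
  have he' : 4 * e * 3 ^ n * (24 * (N * N')) = 1 := by rw [he]; field_simp; norm_num
  have hμe : 4 * e * 3 ^ n ≤ 1 / 24 := by
    have : 0 < 4 * e * 3 ^ n := by positivity
    nlinarith
  refine ⟨⟨e, he0.le⟩, he0, ?_, fun a p X f ha hX hconv => ?_⟩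
  · change e ≤ 1 / 2
    nlinarith
  change IsAlmostLinear e a p X at hX
  set c := a / (8 * N) with hc
  have hc0 : 0 < c := by positivity
  set L : (Fin n → ℝ) →L[ℝ] V := c • (L₀ : (Fin n → ℝ) →L[ℝ] V) with hL
  have hLb : ∀ s, ‖L s‖ ≤ a / 8 * ‖s‖ := by
    intro s
    have h1 : L s = c • (L₀ : (Fin n → ℝ) →L[ℝ] V) s := rfl
    rw [h1, norm_smul, Real.norm_of_nonneg hc0.le]
    calc c * ‖(L₀ : (Fin n → ℝ) →L[ℝ] V) s‖ ≤ c * (N * ‖s‖) := by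
          gcongr
          refine (ContinuousLinearMap.le_opNorm _ _).trans ?_
          gcongr
          rw [hN]; linarith
      _ = a / 8 * ‖s‖ := by rw [hc]; field_simp
  have hfin : {s : Fin n → ℝ | ∀ j, s j = 1 ∨ s j = -1}.Finite := by
    have := Set.Finite.pi (t := fun _ : Fin n => ({1, -1} : Set ℝ)) fun _ => by simp
    exact this.subset fun s hs j _ => hs j
  obtain ⟨B, hB⟩ := (hfin.image fun s => f (p + L s)).bddAbove
  obtain ⟨P, hP1, hP2, hP3⟩ := hX.exists_cube he0.le (by nlinarith) hconv ha.le L hLb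
    (by linarith) (B := B) (fun s hs => hB ⟨s, hs, rfl⟩) le_rfl
  set m := 4 * e * a * (3 ^ n - 1) with hm
  have hm0 : 0 ≤ m := by
    have : (0 : ℝ) ≤ 3 ^ n - 1 := by linarith
    positivity
  set Q : ℝ := N' * c⁻¹ with hQ
  have hQ0 : 0 < Q := by positivity
  have hmQ : 3 * m ≤ Q⁻¹ := by
    have h1 : Q⁻¹ = 3 * (a * (4 * e * 3 ^ n)) := by
      have h2 : a * (4 * e * 3 ^ n) = a * (1 / (24 * (N * N'))) := by
        rw [← he']; field_simp
      rw [h2, hQ, hc]; field_simp; norm_num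
    rw [h1, hm]
    have : 0 ≤ a * (4 * e) := by positivity
    nlinarith
  let Linv : L.NonlinearRightInverse :=
    { toFun := fun y => c⁻¹ • L₀.symm y
      nnnorm := ⟨Q, hQ0.le⟩
      bound' := fun y => by
        rw [norm_smul, norm_inv, Real.norm_of_nonneg hc0.le]
        change _ ≤ Q * ‖y‖
        have h1 : ‖L₀.symm y‖ ≤ N' * ‖y‖ := by
          refine (ContinuousLinearMap.le_opNorm (L₀.symm : V →L[ℝ] (Fin n → ℝ)) y).trans ?_
          gcongr
          rw [hN']; linarith
        calc c⁻¹ * ‖L₀.symm y‖ ≤ c⁻¹ * (N' * ‖y‖) := by gcongr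
          _ = _ := by rw [hQ]; ring
      right_inv' := fun y => by
        change c • L₀ (c⁻¹ • L₀.symm y) = y
        rw [map_smul, L₀.apply_symm_apply, smul_smul, mul_inv_cancel₀ hc0.ne', one_smul] }
  have happrox : ApproximatesLinearOn P L (Metric.closedBall 0 1) ⟨m, hm0⟩ := by
    intro s hs s' hs'
    rw [mem_closedBall_zero_iff] at hs hs'
    have h1 := hP2 s s' hs hs'
    have h2 : (P s - (p + L s)) - (P s' - (p + L s')) = P s - P s' - L (s - s') := by
      rw [map_sub]; abel
    rw [h2] at h1
    exact h1
  have hsurj := happrox.surjOn_closedBall_of_nonlinearRightInverse Linv zero_le_one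
    (Subset.refl _)
  -- The image covers the ball of radius `Q⁻¹ - m` about `P 0`, which is within `m` of `p`; as `3 m
  -- ≤ Q⁻¹`, a third of `Q⁻¹` is left around `p`.
  refine ⟨Q⁻¹ / 3, by positivity, B, fun q hq => ?_⟩
  have hP0 : ‖P 0 - p‖ ≤ m := by simpa using hP1 0 (by simp)
  have hq' : q ∈ Metric.closedBall (P 0) (((Linv.nnnorm : ℝ)⁻¹ - (⟨m, hm0⟩ : ℝ≥0)) * 1) := by
    rw [mem_closedBall_iff_norm, mul_one]
    change _ ≤ Q⁻¹ - m
    calc ‖q - P 0‖ = ‖(q - p) - (P 0 - p)‖ := by congr 1; abel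
      _ ≤ ‖q - p‖ + ‖P 0 - p‖ := norm_sub_le _ _
      _ ≤ _ := by linarith
  obtain ⟨s, hs, rfl⟩ := hsurj hq'
  exact hP3 s (mem_closedBall_zero_iff.1 hs) fun j hj => absurd j.2 (not_lt.2 hj)

variable (V) in
/-- Functions which are convex along a sufficiently linear family are continuous. -/
theorem exists_isAlmostLinear_continuousAt :
    ∃ ε : ℝ≥0, 0 < ε ∧ (ε : ℝ) ≤ 1 / 2 ∧ ∀ (a : ℝ) (p : V) (X : V → V → ℝ → V) (f : V → ℝ),
      0 < a → IsAlmostLinear ε a p X →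
      (∀ q v, ‖q - p‖ ≤ a → ‖v‖ ≤ a → ConvexOn ℝ (Icc 0 1) fun t => f (X q v t)) →
      ContinuousAt f p := by
  obtain ⟨ε, hε0, hε, H⟩ := exists_isAlmostLinear_bound V
  refine ⟨ε, hε0, hε, fun a p X f ha hX hconv => ?_⟩
  obtain ⟨r, hr, B, hB⟩ := H a p X f ha hX hconv
  have h00 : (0 : ℝ) ∈ Icc (0 : ℝ) 1 := ⟨le_rfl, zero_le_one⟩
  have h01 : (1 : ℝ) ∈ Icc (0 : ℝ) 1 := ⟨zero_le_one, le_rfl⟩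
  set b := min a r / 8 with hb
  have hb0 : 0 < b := by positivity
  have hba : 8 * b ≤ a := by rw [hb]; linarith [min_le_left a r]
  have hbr : 8 * b ≤ r := by rw [hb]; linarith [min_le_right a r]
  -- The curve from `q` through `q₂` at time `t` is followed to time one, where it is still in the
  -- region with `f ≤ B`.
  have hkey : ∀ q q₂, ‖q - p‖ ≤ b → ∀ t, 0 < t → t ≤ 1 → ‖q₂ - q‖ ≤ t * b →
      f q₂ ≤ (1 - t) * f q + t * B := by
    intro q q₂ hq t ht0 ht1 hd
    obtain ⟨v, hv, hXv⟩ := hX.exists_eq hε (hq.trans (by linarith)) (b := b) (by linarith)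
      ht0 ht1 hd
    have hqa : ‖q - p‖ ≤ a := hq.trans (by linarith)
    have hva : ‖v‖ ≤ a := hv.trans (by linarith)
    have h1 := (hconv q v hqa hva).2 h00 h01 (sub_nonneg.2 ht1) ht0.le (by ring)
    simp only [smul_eq_mul, mul_zero, mul_one, zero_add] at h1
    rw [hXv, hX.zero q v hqa hva] at h1
    refine h1.trans (by
      gcongr
      refine hB _ ?_
      have h2 := hX.norm_error_le hqa hva h01
      have h3 : X q v 1 - p = (X q v 1 - q - (1 : ℝ) • v) + v + (q - p) := by
        rw [one_smul]; abel
      rw [h3]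
      refine (norm_add_le _ _).trans ((add_le_add_left (norm_add_le _ _) _).trans ?_)
      have h4 : (ε : ℝ) * 1 * ‖v‖ ≤ 1 / 2 * 1 * (2 * b) := by gcongr
      linarith)
  have hfp : f p ≤ B := hB p (by simpa using hr.le)
  have hbound : ∀ q, ‖q - p‖ ≤ b / 2 → ‖f q - f p‖ ≤ 2 * (B - f p) / b * ‖q - p‖ := by
    intro q hq
    rcases eq_or_ne q p with rfl | hne
    · simp
    set t := ‖q - p‖ / b with ht
    have ht0 : 0 < t := div_pos (norm_pos_iff.2 (sub_ne_zero.2 hne)) hb0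
    have ht1 : t ≤ 1 / 2 := by rw [ht, div_le_iff₀ hb0]; linarith
    have htb : t * b = ‖q - p‖ := by rw [ht]; field_simp
    -- The curve from `p` through `q` bounds `f q` from above, the curve from `q` through `p` bounds
    -- it from below. Both run forwards, so reversibility is not needed.
    have h1 := hkey p q (by simpa using hb0.le) t ht0 (by linarith) htb.ge
    have h2 := hkey q p (by linarith) t ht0 (by linarith) (by rw [htb, norm_sub_rev])
    have h3 : 2 * (B - f p) / b * ‖q - p‖ = 2 * (B - f p) * t := by rw [ht]; field_simp
    rw [h3, Real.norm_eq_abs, abs_le]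
    have h4 : 0 ≤ t * (B - f p) := mul_nonneg ht0.le (sub_nonneg.2 hfp)
    constructor
    · nlinarith
    · nlinarith
  rw [ContinuousAt, tendsto_iff_norm_sub_tendsto_zero]
  have hlim : Filter.Tendsto (fun q => 2 * (B - f p) / b * ‖q - p‖) (𝓝 p) (𝓝 0) := by
    have : Continuous fun q => 2 * (B - f p) / b * ‖q - p‖ := by fun_prop
    simpa using this.tendsto p
  refine squeeze_zero' (Filter.Eventually.of_forall fun _ => norm_nonneg _) ?_ hlim
  filter_upwards [Metric.closedBall_mem_nhds p (half_pos hb0)] with q hq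
  exact hbound q (mem_closedBall_iff_norm.1 hq)

end Cubes

/-! ### Continuity of the metric and of convex functions; reduction to short geodesics. -/

namespace FinslerMetric

variable {n : ℕ} {M : Type*} [TopologicalSpace M] [ChartedSpace (Coord n) M]
  [IsManifold (𝓡 n) ∞ M] (F : FinslerMetric n M)

/-- A bound over the unit sphere extends to the fibre by homogeneity. It gives continuity of `F` at
zero vectors and makes short coordinate vectors short for `F`. -/
lemma exists_coord_le (x₀ : M) {K : Set (Coord n)} (hK : IsCompact K)
    (hKt : K ⊆ (extChartAt (𝓡 n) x₀).target) :
    ∃ C > 0, ∀ x ∈ K, ∀ y : Coord n, |F.coord x₀ (x, y)| ≤ C * ‖y‖ := by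
  have hK' : IsCompact (K ×ˢ Metric.sphere (0 : Coord n) 1) := hK.prod (isCompact_sphere 0 1)
  have hsub : K ×ˢ Metric.sphere (0 : Coord n) 1 ⊆ regularSet x₀ := fun q hq =>
    ⟨hKt hq.1, fun h => by
      have := hq.2; rw [h, mem_sphere_zero_iff_norm, norm_zero] at this; norm_num at this⟩
  obtain ⟨C, hC⟩ := hK'.exists_bound_of_continuousOn ((F.contDiffOn_coord x₀).continuousOn.mono hsub)
  refine ⟨|C| + 1, by positivity, fun x hx y => ?_⟩
  rcases eq_or_ne y 0 with rfl | hy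
  · have := F.coord_smul x₀ x 0 (c := 0) le_rfl
    rw [smul_zero, zero_mul] at this
    rw [this]; simp
  · have hy' : 0 < ‖y‖ := norm_pos_iff.2 hy
    have h1 := F.coord_smul x₀ x (‖y‖⁻¹ • y) hy'.le
    rw [smul_smul, mul_inv_cancel₀ hy'.ne', one_smul] at h1
    have h2 := hC (x, ‖y‖⁻¹ • y) ⟨hx, by
      rw [mem_sphere_zero_iff_norm, norm_smul, norm_inv, norm_norm, inv_mul_cancel₀ hy'.ne']⟩
    rw [h1, abs_mul, abs_of_pos hy', mul_comm]
    gcongr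
    rw [Real.norm_eq_abs] at h2
    linarith [le_abs_self C]

lemma toFun_eq_zero {u : TangentBundle (𝓡 n) M} (hu : u.2 = 0) : F.toFun u = 0 := by
  have h := F.homogeneous u.1 u.2 0 le_rfl
  rw [zero_smul, zero_mul, ← hu] at h
  exact h

lemma continuous_toFun : Continuous F.toFun := by
  refine continuous_iff_continuousAt.2 fun u => ?_
  by_cases hu : u.2 = 0
  · have hs : u.1 ∈ (extChartAt (𝓡 n) u.1).source := mem_extChartAt_source _
    have htar := (extChartAt (𝓡 n) u.1).map_source hs
    obtain ⟨r, hr, hrt⟩ := Metric.nhds_basis_closedBall.mem_iff.1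
      ((isOpen_extChartAt_target (I := 𝓡 n) u.1).mem_nhds htar)
    obtain ⟨C, hC0, hC⟩ := F.exists_coord_le u.1 (isCompact_closedBall _ r) hrt
    have hct : ContinuousAt (tangentChart u.1) u := (continuousOn_tangentChart u.1).continuousAt
      ((isOpen_tangentChart_source u.1).mem_nhds (mem_tangentChart_source.2 hs))
    have h0 : (tangentChart u.1 u).2 = 0 := by
      by_contra h
      exact (tangentChart_snd_ne_zero hs).1 h hu
    rw [ContinuousAt, F.toFun_eq_zero hu]
    have hlim : Filter.Tendsto (fun w => C * ‖(tangentChart u.1 w).2‖) (𝓝 u) (𝓝 0) := by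
      have h1 : ContinuousAt (fun w => C * ‖(tangentChart u.1 w).2‖) u :=
        (continuousAt_snd.comp' hct).norm.const_mul C
      have h2 := h1.tendsto
      rwa [h0, norm_zero, mul_zero] at h2
    refine squeeze_zero_norm' ?_ hlim
    have h3 : ∀ᶠ w : TangentBundle (𝓡 n) M in 𝓝 u, (tangentChart u.1 w).1 ∈
        Metric.closedBall (extChartAt (𝓡 n) u.1 u.1) r :=
      (continuousAt_fst.comp' hct).eventually (Metric.closedBall_mem_nhds _ hr)
    filter_upwards [h3, (isOpen_tangentChart_source u.1).mem_nhds (mem_tangentChart_source.2 hs)]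
      with w hw hws
    have h4 := hC _ hw (tangentChart u.1 w).2
    rwa [Prod.mk.eta, F.coord_tangentChart (mem_tangentChart_source.1 hws)] at h4
  · exact (F.smooth.continuousOn).continuousAt (isOpen_slit.mem_nhds hu)

/-- Short geodesics near a point form an almost linear family in the chart at this point. -/
lemma exists_isAlmostLinear (x₀ : M) {ε : ℝ≥0} (hε : 0 < ε) :
    ∃ a > 0, ∃ c : Coord n → Coord n → ℝ → Coord n × Coord n,
      (∀ q v, ‖q - extChartAt (𝓡 n) x₀ x₀‖ ≤ a → ‖v‖ ≤ a → c q v 0 = (q, v) ∧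
        IsMIntegralCurveOn (fun t => (tangentChart x₀).symm (c q v t)) F.spray (Icc 0 1)) ∧
      IsAlmostLinear ε a (extChartAt (𝓡 n) x₀ x₀) fun q v t => (c q v t).1 := by
  obtain ⟨a, ha, c, h1, h2⟩ := exists_isAlmostLinear_of_homogeneous
    (Γ := fun q => (F.chartSpray x₀ q).2) (isOpen_extChartAt_target x₀)
    ((extChartAt (𝓡 n) x₀).map_source (mem_extChartAt_source x₀))
    ((F.contDiffOn_chartSpray x₀).snd.of_le (by exact_mod_cast le_top))
    (fun x hx y hy c hc => by
      rw [F.chartSpray_smul (x := x) (y := y) ⟨hx, hy⟩ hc])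
    (fun x _ => by rw [chartSpray_zero]; rfl) hε
  exact ⟨a, ha, c, fun q v hq hv => ⟨(h1 q v hq hv).1,
    F.isMIntegralCurveOn_of_chart (fun t ht => ((h1 q v hq hv).2 t ht).2)
      fun t ht => ((h1 q v hq hv).2 t ht).1⟩, h2⟩

variable {F} in
-- In the chart at a point, `f` is convex along the almost linear family of short geodesics.
theorem IsConvex.continuous {f : M → ℝ} (hf : F.IsConvex f) : Continuous f := by
  refine continuous_iff_continuousAt.2 fun x₀ => ?_
  obtain ⟨ε, hε, -, H⟩ := exists_isAlmostLinear_continuousAt (Coord n)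
  obtain ⟨a, ha, c, h1, h2⟩ := F.exists_isAlmostLinear x₀ hε
  have h3 := H a _ _ (f ∘ (extChartAt (𝓡 n) x₀).symm) ha h2 fun q v hq hv =>
    hf (fun t => (extChartAt (𝓡 n) x₀).symm (c q v t).1) 0 1 zero_le_one
      ⟨_, (h1 q v hq hv).2, fun t _ => rfl⟩
  have h4 : ContinuousAt ((f ∘ (extChartAt (𝓡 n) x₀).symm) ∘ extChartAt (𝓡 n) x₀) x₀ :=
    ContinuousAt.comp h3 (continuousAt_extChartAt x₀)
  refine h4.congr ?_
  filter_upwards [extChartAt_source_mem_nhds (I := 𝓡 n) x₀] with x hx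
  simp only [Function.comp_apply]
  rw [(extChartAt (𝓡 n) x₀).left_inv hx]

/-- All points near `x₀` are reached from it at time one by geodesics of speed less than one. This
is how invariance under the time-one map becomes a statement about `M`. -/
lemma isLocallyConstant_of_forall_isMIntegralCurveOn {f : M → ℝ}
    (hf : ∀ u : ℝ → TangentBundle (𝓡 n) M, IsMIntegralCurveOn u F.spray (Icc 0 1) →
      u 0 ∈ slit n M → F.toFun (u 0) < 1 → f (u 1).1 = f (u 0).1) : IsLocallyConstant f := by
  refine (IsLocallyConstant.iff_eventually_eq f).2 fun x₀ => ?_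
  set p := extChartAt (𝓡 n) x₀ x₀ with hp
  have hpt : p ∈ (extChartAt (𝓡 n) x₀).target :=
    (extChartAt (𝓡 n) x₀).map_source (mem_extChartAt_source x₀)
  obtain ⟨a, ha, c, h1, h2⟩ := F.exists_isAlmostLinear x₀ (ε := 1 / 2) (by norm_num)
  obtain ⟨C, hC0, hC⟩ := F.exists_coord_le x₀ (isCompact_singleton (x := p))
    (singleton_subset_iff.2 hpt)
  -- The velocity found below has norm at most `2 b`: the first bound keeps it in the almost linear
  -- family, the second makes its `F`-length at most `1 / 2`.
  set b := min (a / 2) (1 / (4 * C)) with hb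
  have hb0 : 0 < b := by positivity
  have hba : 2 * b ≤ a := by linarith [min_le_left (a / 2) (1 / (4 * C))]
  have hbC : C * (2 * b) < 1 := by
    have h3 : C * (2 * (1 / (4 * C))) = 1 / 2 := by field_simp; norm_num
    have h4 : C * (2 * b) ≤ C * (2 * (1 / (4 * C))) := by
      gcongr; exact min_le_right _ _
    linarith
  filter_upwards [extChartAt_source_mem_nhds (I := 𝓡 n) x₀,
    (continuousAt_extChartAt (I := 𝓡 n) x₀).eventually (Metric.closedBall_mem_nhds _ hb0)]
    with x hx hxb
  have hpp : ‖p - p‖ ≤ a := by simpa using ha.le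
  obtain ⟨v, hv, hXv⟩ := h2.exists_eq (by norm_num) hpp (b := b) hba one_pos le_rfl
    (q₂ := extChartAt (𝓡 n) x₀ x) (by
      rw [one_mul]; exact mem_closedBall_iff_norm.1 hxb)
  have hx₀s : (extChartAt (𝓡 n) x₀).symm p = x₀ :=
    (extChartAt (𝓡 n) x₀).left_inv (mem_extChartAt_source x₀)
  obtain ⟨hc0, hint⟩ := h1 p v hpp (hv.trans hba)
  have hend : ((tangentChart x₀).symm (c p v 1)).1 = x := by
    rw [tangentChart_symm_fst, hXv, (extChartAt (𝓡 n) x₀).left_inv hx]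
  have hstart : ((tangentChart x₀).symm (c p v 0)).1 = x₀ := by
    rw [tangentChart_symm_fst, hc0, hx₀s]
  rcases eq_or_ne v 0 with rfl | hv0
  · have h3 := h2.const p hpp 1 ⟨zero_le_one, le_rfl⟩
    rw [hXv] at h3
    rw [← (extChartAt (𝓡 n) x₀).left_inv hx, h3, hx₀s]
  · have h3 := hf _ hint (by
      rw [hc0]
      exact (tangentChart_symm_snd_ne_zero (p := (p, v)) hpt).2 hv0) (by
      rw [hc0, ← F.coord_eq]
      refine (le_abs_self _).trans_lt ((hC p rfl v).trans_lt (lt_of_le_of_lt ?_ hbC))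
      gcongr)
    rwa [hend, hstart] at h3

end FinslerMetric

/-- A measurable set is pulled back to a measurable subset of an open set of continuity. -/
lemma measurableSet_inter_preimage_of_continuousOn {α β : Type*} [TopologicalSpace α]
    [MeasurableSpace α] [OpensMeasurableSpace α] [TopologicalSpace β] [MeasurableSpace β]
    [BorelSpace β] {g : α → β} {O : Set α} (hO : IsOpen O) (hg : ContinuousOn g O) {A : Set β}
    (hA : MeasurableSet A) : MeasurableSet (O ∩ g ⁻¹' A) := by
  have h1 : Measurable (O.domRestrict g) :=
    (continuousOn_iff_continuous_domRestrict.1 hg).measurable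
  have h2 := hO.measurableSet.subtype_image (h1 hA)
  convert h2 using 1
  ext x
  exact ⟨fun hx => ⟨⟨x, hx.1⟩, hx.2, rfl⟩, by rintro ⟨y, hy, rfl⟩; exact ⟨y.2, hy⟩⟩

/-! ### The Liouville measure and its finiteness on the unit ball bundle. -/

section Liouville

instance volume_coord_prod_isAddHaarMeasure (n : ℕ) :
    (volume : Measure (Coord n × Coord n)).IsAddHaarMeasure :=
  inferInstanceAs (((volume : Measure (Coord n)).prod volume).IsAddHaarMeasure)

variable {n : ℕ} {M : Type*} [TopologicalSpace M] [ChartedSpace (Coord n) M]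
  [IsManifold (𝓡 n) ∞ M]

instance tangentBundle_measurableSpace : MeasurableSpace (TangentBundle (𝓡 n) M) := borel _

instance tangentBundle_borelSpace : BorelSpace (TangentBundle (𝓡 n) M) := ⟨rfl⟩

namespace FinslerMetric

variable (F : FinslerMetric n M)

/-- The density of the Liouville measure in the chart at `x₀`. -/
def liouvilleDensity (x₀ : M) (p : Coord n × Coord n) : ENNReal :=
  ENNReal.ofReal (F.fundamentalTensor x₀ p).det

/-- The Liouville measure on the nonzero vectors over the chart at `x₀`. -/
def chartLiouville (x₀ : M) : Measure (TangentBundle (𝓡 n) M) :=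
  Measure.map (tangentChart x₀).symm
    ((volume.restrict (regularSet x₀)).withDensity (F.liouvilleDensity x₀))

lemma regularSet_subset_target (x₀ : M) : regularSet (n := n) x₀ ⊆ (tangentChart x₀).target :=
  fun _ hp => mem_tangentChart_target.2 hp.1

lemma measurableSet_regularSet_inter (x₀ : M) {A : Set (TangentBundle (𝓡 n) M)}
    (hA : MeasurableSet A) : MeasurableSet (regularSet x₀ ∩ (tangentChart x₀).symm ⁻¹' A) :=
  measurableSet_inter_preimage_of_continuousOn (isOpen_regularSet x₀)
    ((continuousOn_tangentChart_symm x₀).mono (regularSet_subset_target x₀)) hA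

lemma chartLiouville_apply (x₀ : M) {A : Set (TangentBundle (𝓡 n) M)} (hA : MeasurableSet A) :
    F.chartLiouville x₀ A =
      ∫⁻ p in regularSet x₀ ∩ (tangentChart x₀).symm ⁻¹' A, F.liouvilleDensity x₀ p := by
  have h1 : AEMeasurable (tangentChart x₀).symm (volume.restrict (regularSet (n := n) x₀)) :=
    ((continuousOn_tangentChart_symm x₀).mono
      (regularSet_subset_target x₀)).aemeasurable (isOpen_regularSet x₀).measurableSet
  have h2 : AEMeasurable (tangentChart x₀).symm
      ((volume.restrict (regularSet x₀)).withDensity (F.liouvilleDensity x₀)) :=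
    h1.mono_ac (withDensity_absolutelyContinuous _ _)
  rw [chartLiouville, Measure.map_apply_of_aemeasurable h2 hA]
  have h3 : NullMeasurableSet ((tangentChart x₀).symm ⁻¹' A)
      (volume.restrict (regularSet (n := n) x₀)) := h1.nullMeasurableSet_preimage hA
  have h4 : ((tangentChart x₀).symm ⁻¹' A : Set (Coord n × Coord n)) =ᵐ[
      volume.restrict (regularSet (n := n) x₀)]
      (regularSet x₀ ∩ (tangentChart x₀).symm ⁻¹' A : Set _) := by
    filter_upwards [ae_restrict_mem (isOpen_regularSet x₀).measurableSet] with p hp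
    exact propext ⟨fun h => ⟨hp, h⟩, fun h => h.2⟩
  rw [measure_congr ((withDensity_absolutelyContinuous _ _).ae_eq h4),
    withDensity_apply _ (measurableSet_regularSet_inter x₀ hA),
    Measure.restrict_restrict (measurableSet_regularSet_inter x₀ hA),
    inter_eq_left.2 inter_subset_left]

/-- The local expressions of the Liouville measure agree on overlaps. -/
lemma chartLiouville_eq {x₀ x₁ : M} {A : Set (TangentBundle (𝓡 n) M)} (hA : MeasurableSet A)
    (h0 : A ⊆ (tangentChart x₀).source) (h1 : A ⊆ (tangentChart x₁).source) :
    F.chartLiouville x₀ A = F.chartLiouville x₁ A := by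
  rw [chartLiouville_apply _ _ hA, chartLiouville_apply _ _ hA]
  set A₀ := regularSet x₀ ∩ (tangentChart x₀).symm ⁻¹' A with hA₀
  have hsrc : ∀ p ∈ A₀, (extChartAt (𝓡 n) x₀).symm p.1 ∈ (extChartAt (𝓡 n) x₁).source :=
    fun p hp => mem_tangentChart_source.1 (h1 hp.2)
  have hτ : ∀ p ∈ A₀, tangentLift (transition x₀ x₁) p =
      tangentChart x₁ ((tangentChart x₀).symm p) := fun p hp =>
    (tangentChart_tangentChart_symm hp.1.1 (hsrc p hp)).symm
  have himage : regularSet x₁ ∩ (tangentChart x₁).symm ⁻¹' A =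
      tangentLift (transition x₀ x₁) '' A₀ := by
    ext q
    constructor
    · rintro ⟨hq, hqA⟩
      have hs0 := mem_tangentChart_source.1 (h0 hqA)
      have hslit : (tangentChart x₁).symm q ∈ slit n M :=
        (tangentChart_symm_snd_ne_zero hq.1).2 hq.2
      have hmem : tangentChart x₀ ((tangentChart x₁).symm q) ∈ A₀ :=
        ⟨(tangentChart_mem_regularSet hs0).2 hslit, by
          rw [mem_preimage, (tangentChart x₀).left_inv (h0 hqA)]; exact hqA⟩
      refine ⟨_, hmem, ?_⟩
      rw [hτ _ hmem, (tangentChart x₀).left_inv (h0 hqA),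
        (tangentChart x₁).right_inv (mem_tangentChart_target.2 hq.1)]
    · rintro ⟨p, hp, rfl⟩
      refine ⟨tangentLift_transition_mem hp.1 (hsrc p hp), ?_⟩
      rw [mem_preimage, hτ p hp, (tangentChart x₁).left_inv (h1 hp.2)]
      exact hp.2
  have hinj : InjOn (tangentLift (transition x₀ x₁)) A₀ := by
    intro p hp q hq hpq
    rw [hτ p hp, hτ q hq] at hpq
    exact (tangentChart x₀).symm.injOn (mem_tangentChart_target.2 hp.1.1)
      (mem_tangentChart_target.2 hq.1.1) ((tangentChart x₁).injOn (h1 hp.2) (h1 hq.2) hpq)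
  have hder : ∀ p ∈ A₀, HasFDerivWithinAt (tangentLift (transition x₀ x₁))
      (fderiv ℝ (tangentLift (transition x₀ x₁)) p) A₀ p := fun p hp =>
    (hasFDerivAt_tangentLift (contDiffAt_two_transition hp.1.1
      (hsrc p hp))).differentiableAt.hasFDerivAt.hasFDerivWithinAt
  rw [himage, lintegral_image_eq_lintegral_abs_det_fderiv_mul volume
    (measurableSet_regularSet_inter x₀ hA) hder hinj]
  refine setLIntegral_congr_fun (measurableSet_regularSet_inter x₀ hA) fun p hp => ?_
  have hψ := contDiffAt_two_transition hp.1.1 (hsrc p hp)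
  have hp₁ := tangentLift_transition_mem hp.1 (hsrc p hp)
  simp only [liouvilleDensity]
  -- The Jacobian of the lift and the change of `det g` are both the square of `det ψ'`.
  rw [fundamentalTensor_eq, fundamentalTensor_eq, det_fderiv_tangentLift hψ,
    abs_of_nonneg (sq_nonneg _), ← ENNReal.ofReal_mul (sq_nonneg _),
    ← det_tensorOf_comp_tangentLift hψ
      (contDiffAt_two (isOpen_regularSet x₀) (F.contDiffOn_energy x₀) hp.1)
      (contDiffAt_two (isOpen_regularSet x₁) (F.contDiffOn_energy x₁) hp₁)
      (F.energy_eventuallyEq hp.1.1 (hsrc p hp))]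

variable (n M) in
lemma exists_chartSeq [SecondCountableTopology M] [Nonempty M] :
    ∃ e : ℕ → M, ⋃ i, (extChartAt (𝓡 n) (e i)).source = univ := by
  obtain ⟨s, hs, h⟩ := exists_countable_chart_cover (n := n) (M := M)
  have hne : s.Nonempty := by
    obtain ⟨x⟩ := ‹Nonempty M›
    have hx : x ∈ ⋃ x ∈ s, (extChartAt (𝓡 n) x).source := by rw [h]; trivial
    simp only [mem_iUnion] at hx
    exact ⟨_, hx.choose_spec.choose⟩
  obtain ⟨e, rfl⟩ := hs.exists_eq_range hne
  exact ⟨e, by simpa using h⟩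

variable [SecondCountableTopology M] [Nonempty M]

variable (n M) in
/-- A sequence of points whose charts cover `M`. -/
def chartSeq : ℕ → M := (exists_chartSeq n M).choose

variable (n M) in
/-- A partition of `M` which is subordinate to the charts at the points of `chartSeq`. -/
def cell (i : ℕ) : Set M := disjointed (fun i => (extChartAt (𝓡 n) (chartSeq n M i)).source) i

variable (n M) in
/-- The Liouville measure of a Finsler metric on the nonzero tangent vectors. -/
def liouville : Measure (TangentBundle (𝓡 n) M) :=
  Measure.sum fun i => (F.chartLiouville (chartSeq n M i)).restrict
    ((fun u : TangentBundle (𝓡 n) M => u.1) ⁻¹' cell n M i)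

lemma iUnion_cell : ⋃ i, cell n M i = univ := by
  have h := (exists_chartSeq n M).choose_spec
  rw [← h]
  exact iUnion_disjointed

lemma pairwise_disjoint_cell : Pairwise (Function.onFun Disjoint (cell n M)) :=
  disjoint_disjointed _

lemma cell_subset (i : ℕ) : cell n M i ⊆ (extChartAt (𝓡 n) (chartSeq n M i)).source :=
  disjointed_subset _ _

lemma measurableSet_cell [MeasurableSpace M] [BorelSpace M] (i : ℕ) :
    MeasurableSet (cell n M i) :=
  MeasurableSet.disjointed (fun _ => (isOpen_extChartAt_source _).measurableSet) i

lemma measurableSet_proj_cell (i : ℕ) :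
    MeasurableSet ((fun u : TangentBundle (𝓡 n) M => u.1) ⁻¹' cell n M i) := by
  borelize M
  exact continuous_tangentBundle_proj.measurable (measurableSet_cell i)

/-- Independence of the chosen cover: each piece of `A` over a cell lies in two charts, so its
measure may be computed in the chart at `x₀`. -/
lemma liouville_apply {x₀ : M} {A : Set (TangentBundle (𝓡 n) M)} (hA : MeasurableSet A)
    (h0 : A ⊆ (tangentChart x₀).source) :
    F.liouville n M A =
      ∫⁻ p in regularSet x₀ ∩ (tangentChart x₀).symm ⁻¹' A, F.liouvilleDensity x₀ p := by
  rw [← chartLiouville_apply _ _ hA, liouville, Measure.sum_apply _ hA]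
  have h1 : ∀ i, ((F.chartLiouville (chartSeq n M i)).restrict
      ((fun u : TangentBundle (𝓡 n) M => u.1) ⁻¹' cell n M i)) A =
      F.chartLiouville x₀ (A ∩ (fun u : TangentBundle (𝓡 n) M => u.1) ⁻¹' cell n M i) := by
    intro i
    rw [Measure.restrict_apply hA]
    exact F.chartLiouville_eq (hA.inter (measurableSet_proj_cell i))
      (fun u hu => mem_tangentChart_source.2 (cell_subset i hu.2)) fun u hu => h0 hu.1
  simp only [h1]
  rw [← measure_iUnion (fun i j hij => ((pairwise_disjoint_cell hij).preimage _).mono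
    inter_subset_right inter_subset_right) fun i => hA.inter (measurableSet_proj_cell i),
    ← inter_iUnion, ← preimage_iUnion, iUnion_cell, preimage_univ, inter_univ]

lemma liouvilleDensity_pos {x₀ : M} {p : Coord n × Coord n} (hp : p ∈ regularSet x₀) :
    0 < (F.fundamentalTensor x₀ p).det := by
  rw [fundamentalTensor_eq]
  exact (tensorOf_posDef (contDiffAt_two (isOpen_regularSet x₀) (F.contDiffOn_energy x₀) hp)
    (F.hess_energy_pos hp)).det_pos

lemma aemeasurable_liouvilleDensity (x₀ : M) :
    AEMeasurable (F.liouvilleDensity x₀) (volume.restrict (regularSet (n := n) x₀)) := by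
  have h1 : ContinuousOn (fun p => (tensorOf (F.energy x₀) p).det) (regularSet x₀) :=
    (contDiffOn_det (contDiffOn_tensorOf (isOpen_regularSet x₀)
      (F.contDiffOn_energy x₀))).continuousOn
  exact (h1.aemeasurable (isOpen_regularSet x₀).measurableSet).ennreal_ofReal

lemma measurableSet_image_symm {x₀ : M} {A : Set (Coord n × Coord n)} (hA : MeasurableSet A)
    (hAr : A ⊆ regularSet x₀) : MeasurableSet ((tangentChart x₀).symm '' A) := by
  have h : (tangentChart x₀).symm '' A = (tangentChart x₀).source ∩ tangentChart x₀ ⁻¹' A :=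
    (tangentChart x₀).symm_image_eq_source_inter_preimage
      fun p hp => mem_tangentChart_target.2 (hAr hp).1
  rw [h]
  exact measurableSet_inter_preimage_of_continuousOn (isOpen_tangentChart_source x₀)
    (continuousOn_tangentChart x₀) hA

lemma liouville_image_symm {x₀ : M} {A : Set (Coord n × Coord n)} (hA : MeasurableSet A)
    (hAr : A ⊆ regularSet x₀) :
    F.liouville n M ((tangentChart x₀).symm '' A) = ∫⁻ p in A, F.liouvilleDensity x₀ p := by
  have hAt : A ⊆ (tangentChart x₀).symm.source := fun p hp =>
    mem_tangentChart_target.2 (hAr hp).1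
  rw [F.liouville_apply (x₀ := x₀) (measurableSet_image_symm hA hAr)]
  · congr 2
    ext p
    constructor
    · rintro ⟨hp, q, hq, hqp⟩
      rwa [← (tangentChart x₀).symm.injOn (hAt hq) (mem_tangentChart_target.2 hp.1) hqp]
    · exact fun hp => ⟨hAr hp, p, hp, rfl⟩
  · rintro _ ⟨p, hp, rfl⟩
    exact (tangentChart x₀).map_target (hAt hp)

/-- The density is positive on nonzero vectors. This lets an almost everywhere identity of
continuous functions hold everywhere. -/
lemma liouville_pos {O : Set (TangentBundle (𝓡 n) M)} (hO : IsOpen O) (hOs : O ⊆ slit n M)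
    (hne : O.Nonempty) : 0 < F.liouville n M O := by
  obtain ⟨u, hu⟩ := hne
  have hus : u.1 ∈ (extChartAt (𝓡 n) u.1).source := mem_extChartAt_source _
  have hO' : IsOpen (O ∩ (tangentChart u.1).source) := hO.inter (isOpen_tangentChart_source _)
  refine lt_of_lt_of_le ?_ (measure_mono (inter_subset_left : O ∩ (tangentChart u.1).source ⊆ O))
  rw [F.liouville_apply hO'.measurableSet inter_subset_right]
  have hop : IsOpen (regularSet u.1 ∩
      (tangentChart u.1).symm ⁻¹' (O ∩ (tangentChart u.1).source)) :=
    ((continuousOn_tangentChart_symm u.1).mono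
      (regularSet_subset_target u.1)).isOpen_inter_preimage (isOpen_regularSet u.1) hO'
  have hopen : (regularSet u.1 ∩
      (tangentChart u.1).symm ⁻¹' (O ∩ (tangentChart u.1).source)).Nonempty :=
    ⟨tangentChart u.1 u, (tangentChart_mem_regularSet hus).2 (hOs hu), by
      rw [mem_preimage, (tangentChart u.1).left_inv (mem_tangentChart_source.2 hus)]
      exact ⟨hu, mem_tangentChart_source.2 hus⟩⟩
  rw [pos_iff_ne_zero]
  intro h0
  rw [lintegral_eq_zero_iff' ((F.aemeasurable_liouvilleDensity u.1).mono_set inter_subset_left)]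
    at h0
  refine (hop.measure_pos volume hopen).ne' ?_
  rw [Filter.EventuallyEq, ae_restrict_iff' hop.measurableSet] at h0
  refine measure_mono_null (fun p hp => ?_) (ae_iff.1 h0)
  simp only [mem_ofPred_eq, Pi.zero_apply, Classical.not_imp]
  refine ⟨hp, ?_⟩
  rw [liouvilleDensity, ENNReal.ofReal_eq_zero, not_le]
  exact F.liouvilleDensity_pos hp.1

/-- Integration over the fibre `{F < 1}` gives the Holmes–Thompson density times the volume of the
Euclidean ball. Only an upper bound is needed, and the inequality versions of Tonelli and of
`withDensity` avoid measurability of that density. -/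
lemma chartLiouville_cell_le [MeasurableSpace M] [BorelSpace M] (x₀ : M) {D : Set M}
    (hD : MeasurableSet D) :
    ∫⁻ p in regularSet x₀ ∩ (tangentChart x₀).symm ⁻¹'
      ({u | u ∈ slit n M ∧ F.toFun u < 1} ∩ (fun u : TangentBundle (𝓡 n) M => u.1) ⁻¹' D),
      F.liouvilleDensity x₀ p ≤
    volume (Metric.ball (0 : Coord n) 1) * F.htChartMeasure x₀ D := by
  set S : Set (Coord n) := (extChartAt (𝓡 n) x₀).symm ⁻¹' D with hS
  have hball0 : volume (Metric.ball (0 : Coord n) 1) ≠ 0 :=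
    (Metric.measure_ball_pos volume _ one_pos).ne'
  have hball1 : volume (Metric.ball (0 : Coord n) 1) ≠ ⊤ := measure_ball_lt_top.ne
  set A := regularSet x₀ ∩ (tangentChart x₀).symm ⁻¹'
    ({u | u ∈ slit n M ∧ F.toFun u < 1} ∩ (fun u : TangentBundle (𝓡 n) M => u.1) ⁻¹' D) with hA
  have hAm : MeasurableSet A := measurableSet_regularSet_inter x₀
    ((isOpen_slit.inter (isOpen_Iio.preimage F.continuous_toFun)).measurableSet.inter
      (continuous_tangentBundle_proj.measurable hD))
  have hfiber : ∀ x, ∫⁻ y, A.indicator (F.liouvilleDensity x₀) (x, y) ≤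
      (S ∩ (extChartAt (𝓡 n) x₀).target).indicator
        (fun x => volume (Metric.ball (0 : Coord n) 1) * F.htDensity x₀ x) x := by
    intro x
    by_cases hx : x ∈ S ∩ (extChartAt (𝓡 n) x₀).target
    · rw [indicator_of_mem hx, htDensity, ENNReal.mul_div_cancel hball0 hball1]
      refine le_trans (lintegral_mono fun y => ?_) (lintegral_indicator_le
        (fun y => F.liouvilleDensity x₀ (x, y)) {y | F.coord x₀ (x, y) < 1})
      by_cases hy : (x, y) ∈ A
      · rw [indicator_of_mem hy, indicator_of_mem]
        exact hy.2.1.2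
      · rw [indicator_of_notMem hy]; exact zero_le
    · rw [indicator_of_notMem hx, nonpos_iff_eq_zero, lintegral_eq_zero_of_ae_eq_zero]
      refine Filter.Eventually.of_forall fun y => indicator_of_notMem (fun hy => hx ?_) _
      exact ⟨hy.2.2, hy.1.1⟩
  have hmap : AEMeasurable (extChartAt (𝓡 n) x₀).symm
      ((volume.restrict (extChartAt (𝓡 n) x₀).target).withDensity (F.htDensity x₀)) :=
    ((continuousOn_extChartAt_symm x₀).aemeasurable
      (isOpen_extChartAt_target x₀).measurableSet).mono_ac (withDensity_absolutelyContinuous _ _)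
  calc ∫⁻ p in A, F.liouvilleDensity x₀ p
      = ∫⁻ p, A.indicator (F.liouvilleDensity x₀) p := (lintegral_indicator hAm _).symm
    _ ≤ ∫⁻ x, ∫⁻ y, A.indicator (F.liouvilleDensity x₀) (x, y) := lintegral_prod_le _
    _ ≤ ∫⁻ x, (S ∩ (extChartAt (𝓡 n) x₀).target).indicator
        (fun x => volume (Metric.ball (0 : Coord n) 1) * F.htDensity x₀ x) x :=
      lintegral_mono hfiber
    _ ≤ ∫⁻ x in S ∩ (extChartAt (𝓡 n) x₀).target,
        volume (Metric.ball (0 : Coord n) 1) * F.htDensity x₀ x := lintegral_indicator_le _ _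
    _ = volume (Metric.ball (0 : Coord n) 1) *
        ∫⁻ x in S, F.htDensity x₀ x ∂(volume.restrict (extChartAt (𝓡 n) x₀).target) := by
      rw [lintegral_const_mul' _ _ hball1,
        Measure.restrict_restrict' (isOpen_extChartAt_target x₀).measurableSet]
    _ ≤ _ := by
      gcongr
      exact (withDensity_apply_le _ _).trans (Measure.le_map_apply hmap D)

theorem liouville_lt_top [MeasurableSpace M] [BorelSpace M] (hvol : F.htVolume < ⊤) :
    F.liouville n M {u | u ∈ slit n M ∧ F.toFun u < 1} < ⊤ := by
  set B : Set (TangentBundle (𝓡 n) M) := {u | u ∈ slit n M ∧ F.toFun u < 1} with hB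
  have hBm : MeasurableSet B :=
    (isOpen_slit.inter (isOpen_Iio.preimage F.continuous_toFun)).measurableSet
  rw [liouville, Measure.sum_apply _ hBm]
  have h1 : ∀ i, ((F.chartLiouville (chartSeq n M i)).restrict
      ((fun u : TangentBundle (𝓡 n) M => u.1) ⁻¹' cell n M i)) B ≤
      volume (Metric.ball (0 : Coord n) 1) * F.htMeasure (cell n M i) := by
    intro i
    rw [Measure.restrict_apply hBm,
      F.chartLiouville_apply _ (hBm.inter (measurableSet_proj_cell i))]
    refine (F.chartLiouville_cell_le _ (measurableSet_cell i)).trans ?_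
    gcongr
    exact le_iSup (fun x => F.htChartMeasure x) (chartSeq n M i)
  refine (ENNReal.tsum_le_tsum h1).trans_lt ?_
  rw [ENNReal.tsum_mul_left, ← measure_iUnion pairwise_disjoint_cell measurableSet_cell,
    iUnion_cell]
  exact ENNReal.mul_lt_top measure_ball_lt_top hvol

end FinslerMetric

end Liouville

/-- An open and closed condition propagates along the connected interval. -/
lemma Icc_subset_of_eventually {a b t₀ : ℝ} {s : Set ℝ} (hcl : IsClosed (Icc a b ∩ s))
    (ht₀ : t₀ ∈ Icc a b) (h₀ : t₀ ∈ s)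
    (hop : ∀ t ∈ Icc a b, t ∈ s → ∀ᶠ r in 𝓝[Icc a b] t, r ∈ s) : Icc a b ⊆ s := by
  have : PreconnectedSpace (Icc a b) := Subtype.preconnectedSpace isPreconnected_Icc
  have h1 : IsClopen ((↑) ⁻¹' s : Set (Icc a b)) := by
    refine ⟨?_, isOpen_iff_mem_nhds.2 fun t ht => ?_⟩
    · have h2 := hcl.preimage (continuous_subtype_val (p := (· ∈ Icc a b)))
      convert h2 using 1
      ext t
      exact ⟨fun h => ⟨t.2, h⟩, fun h => h.2⟩
    · exact preimage_coe_mem_nhds_subtype.2 (hop t t.2 ht)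
  have h2 := h1.eq_univ ⟨⟨t₀, ht₀⟩, h₀⟩
  intro t ht
  have h3 : (⟨t, ht⟩ : Icc a b) ∈ ((↑) ⁻¹' s : Set (Icc a b)) := by rw [h2]; trivial
  exact h3

/-! ### Constant speed, uniqueness of geodesics and the geodesic flow. -/

namespace FinslerMetric

variable {n : ℕ} {M : Type*} [TopologicalSpace M] [ChartedSpace (Coord n) M]
  [IsManifold (𝓡 n) ∞ M] (F : FinslerMetric n M)

lemma continuousOn_of_isMIntegralCurveOn {γ : ℝ → TangentBundle (𝓡 n) M} {s : Set ℝ}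
    (h : IsMIntegralCurveOn γ F.spray s) : ContinuousOn γ s := fun t ht =>
  (F.hasMFDerivWithinAt_iff.1 (h t ht)).1

lemma eventually_tangentChart {γ : ℝ → TangentBundle (𝓡 n) M} {s : Set ℝ}
    (h : IsMIntegralCurveOn γ F.spray s) {t : ℝ} (ht : t ∈ s) {x₀ : M}
    (hx₀ : (γ t).1 ∈ (extChartAt (𝓡 n) x₀).source) {W : Set (Coord n × Coord n)}
    (hW : W ∈ 𝓝 (tangentChart x₀ (γ t))) :
    ∀ᶠ r in 𝓝[s] t, (γ r).1 ∈ (extChartAt (𝓡 n) x₀).source ∧ tangentChart x₀ (γ r) ∈ W := by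
  have h1 := F.continuousOn_of_isMIntegralCurveOn h t ht
  have h2 : γ t ∈ (tangentChart x₀).source := mem_tangentChart_source.2 hx₀
  have h3 : ContinuousAt (tangentChart x₀) (γ t) :=
    (continuousOn_tangentChart x₀).continuousAt ((isOpen_tangentChart_source x₀).mem_nhds h2)
  filter_upwards [h1.eventually ((isOpen_tangentChart_source x₀).mem_nhds h2),
    h1.eventually (h3.eventually hW)] with r hr hr'
  exact ⟨mem_tangentChart_source.1 hr, hr'⟩

/-- Geodesics have constant speed. -/
lemma toFun_eq_of_isMIntegralCurveOn {γ : ℝ → TangentBundle (𝓡 n) M} {a b t₀ : ℝ}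
    (h : IsMIntegralCurveOn γ F.spray (Icc a b)) (ht₀ : t₀ ∈ Icc a b) (h₀ : γ t₀ ∈ slit n M)
    {t : ℝ} (ht : t ∈ Icc a b) : F.toFun (γ t) = F.toFun (γ t₀) := by
  have hc := F.continuousOn_of_isMIntegralCurveOn h
  have hpos : ∀ u ∈ slit n M, 0 < F.toFun u := fun u hu => F.pos u.1 u.2 hu
  refine Icc_subset_of_eventually (s := {r | F.toFun (γ r) = F.toFun (γ t₀)}) ?_ ht₀ rfl
    (fun r hr hrs => ?_) ht
  · exact (F.continuous_toFun.comp_continuousOn hc).preimage_isClosed_of_isClosed isClosed_Icc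
      isClosed_singleton
  · have hslit : γ r ∈ slit n M := fun h0 => by
      have h1 : F.toFun (γ r) = F.toFun (γ t₀) := hrs
      rw [F.toFun_eq_zero h0] at h1
      exact (hpos _ h₀).ne h1
    have hx₀ : (γ r).1 ∈ (extChartAt (𝓡 n) (γ r).1).source := mem_extChartAt_source _
    have hev := F.eventually_tangentChart h hr hx₀ ((isOpen_regularSet _).mem_nhds
      ((tangentChart_mem_regularSet hx₀).2 hslit))
    obtain ⟨δ, hδ, hδs⟩ := Metric.mem_nhdsWithin_iff.1 hev
    refine Metric.mem_nhdsWithin_iff.2 ⟨δ, hδ, fun τ hτ => ?_⟩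
    have hconv : Convex ℝ (Metric.ball r δ ∩ Icc a b) :=
      (convex_ball r δ).inter (convex_Icc a b)
    have h1 := hconv.norm_image_sub_le_of_norm_hasDerivWithin_le
      (f := fun r' => F.energy (γ r).1 (tangentChart (γ r).1 (γ r'))) (f' := fun _ => 0) (C := 0)
      (fun r' hr' => by
        have h2 := hδs hr'
        have h3 := (F.hasDerivWithinAt_tangentChart h hr'.2 h2.1).mono
          (inter_subset_right : Metric.ball r δ ∩ Icc a b ⊆ Icc a b)
        have h4 := ((contDiffAt_two (isOpen_regularSet _) (F.contDiffOn_energy (γ r).1)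
          h2.2).differentiableAt two_ne_zero).hasFDerivAt.comp_hasDerivWithinAt r' h3
        exact h4.congr_deriv (F.fderiv_energy_chartSpray h2.2))
      (fun _ _ => by simp) ⟨Metric.mem_ball_self hδ, hr⟩ hτ
    rw [zero_mul, norm_le_zero_iff, sub_eq_zero] at h1
    have h2 := hδs hτ
    simp only [energy] at h1
    rw [F.coord_tangentChart h2.1, F.coord_tangentChart hx₀] at h1
    have h3 := hpos _ ((tangentChart_mem_regularSet h2.1).1 h2.2)
    exact (((sq_eq_sq₀ h3.le (hpos _ hslit).le).1 h1)).trans hrs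

lemma mem_slit_of_isMIntegralCurveOn {γ : ℝ → TangentBundle (𝓡 n) M} {a b t₀ : ℝ}
    (h : IsMIntegralCurveOn γ F.spray (Icc a b)) (ht₀ : t₀ ∈ Icc a b) (h₀ : γ t₀ ∈ slit n M)
    {t : ℝ} (ht : t ∈ Icc a b) : γ t ∈ slit n M := fun h0 => by
  have h1 := F.toFun_eq_of_isMIntegralCurveOn h ht₀ h₀ ht
  rw [F.toFun_eq_zero h0] at h1
  exact (F.pos (γ t₀).1 (γ t₀).2 h₀).ne h1

/-- Geodesics with nonzero velocity are determined by their velocity at one time. -/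
lemma eqOn_of_isMIntegralCurveOn [T2Space M] {γ γ' : ℝ → TangentBundle (𝓡 n) M} {a b t₀ : ℝ}
    (h : IsMIntegralCurveOn γ F.spray (Icc a b)) (h' : IsMIntegralCurveOn γ' F.spray (Icc a b))
    (ht₀ : t₀ ∈ Icc a b) (h₀ : γ t₀ ∈ slit n M) (heq : γ t₀ = γ' t₀) :
    EqOn γ γ' (Icc a b) := by
  have hc := F.continuousOn_of_isMIntegralCurveOn h
  have hc' := F.continuousOn_of_isMIntegralCurveOn h'
  refine Icc_subset_of_eventually (s := {r | γ r = γ' r}) ?_ ht₀ heq (fun r hr hrs => ?_)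
  · exact (hc.prodMk hc').preimage_isClosed_of_isClosed isClosed_Icc isClosed_diagonal
  have hrs : γ r = γ' r := hrs
  have hslit := F.mem_slit_of_isMIntegralCurveOn h ht₀ h₀ hr
  set x₀ := (γ r).1 with hx₀d
  have hx₀ : (γ r).1 ∈ (extChartAt (𝓡 n) x₀).source := mem_extChartAt_source _
  have hp := (tangentChart_mem_regularSet hx₀).2 hslit
  obtain ⟨K, W, hW, hK⟩ := (((F.contDiffOn_chartSpray x₀).contDiffAt
    ((isOpen_regularSet x₀).mem_nhds hp)).of_le
      (show (1 : WithTop ℕ∞) ≤ ∞ by exact_mod_cast le_top)).exists_lipschitzOnWith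
  have hev := (F.eventually_tangentChart h hr hx₀ hW).and
    (F.eventually_tangentChart h' hr (x₀ := x₀) (W := W) (by rw [← hrs]; exact hx₀)
      (by rw [← hrs]; exact hW))
  obtain ⟨δ, hδ, hδs⟩ := Metric.mem_nhdsWithin_iff.1 hev
  refine Metric.mem_nhdsWithin_iff.2 ⟨δ, hδ, fun τ hτ => ?_⟩
  have hsub : ∀ σ ∈ uIcc r τ, σ ∈ Metric.ball r δ ∩ Icc a b := fun σ hσ =>
    ((convex_ball r δ).inter (convex_Icc a b)).ordConnected.uIcc_subset
      ⟨Metric.mem_ball_self hδ, hr⟩ hτ hσ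
  have hd : ∀ σ ∈ uIcc r τ, HasDerivWithinAt (fun t => tangentChart x₀ (γ t))
      (F.chartSpray x₀ (tangentChart x₀ (γ σ))) (uIcc r τ) σ := fun σ hσ =>
    (F.hasDerivWithinAt_tangentChart h (hsub σ hσ).2 (hδs (hsub σ hσ)).1.1).mono
      fun t ht => (hsub t ht).2
  have hd' : ∀ σ ∈ uIcc r τ, HasDerivWithinAt (fun t => tangentChart x₀ (γ' t))
      (F.chartSpray x₀ (tangentChart x₀ (γ' σ))) (uIcc r τ) σ := fun σ hσ =>
    (F.hasDerivWithinAt_tangentChart h' (hsub σ hσ).2 (hδs (hsub σ hσ)).2.1).mono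
      fun t ht => (hsub t ht).2
  have hend : tangentChart x₀ (γ τ) = tangentChart x₀ (γ' τ) := by
    -- Local uniqueness from `r` in both directions of time; the backward case later gives
    -- injectivity of the flow.
    rcases le_total r τ with hle | hle
    · rw [uIcc_of_le hle] at hsub hd hd'
      exact ODE_solution_unique_of_mem_Icc_right (v := fun _ => F.chartSpray x₀) (s := fun _ => W)
        (K := K) (fun _ _ => hK) (fun t ht => (hd t ht).continuousWithinAt)
        (fun t ht => hasDerivWithinAt_Ici_of_Icc (hd t (Ico_subset_Icc_self ht)) ht)
        (fun t ht => (hδs (hsub t (Ico_subset_Icc_self ht))).1.2)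
        (fun t ht => (hd' t ht).continuousWithinAt)
        (fun t ht => hasDerivWithinAt_Ici_of_Icc (hd' t (Ico_subset_Icc_self ht)) ht)
        (fun t ht => (hδs (hsub t (Ico_subset_Icc_self ht))).2.2)
        (by simp only [hrs]) (right_mem_Icc.2 hle)
    · rw [uIcc_of_ge hle] at hsub hd hd'
      exact ODE_solution_unique_of_mem_Icc_left (v := fun _ => F.chartSpray x₀) (s := fun _ => W)
        (K := K) (fun _ _ => hK) (fun t ht => (hd t ht).continuousWithinAt)
        (fun t ht => hasDerivWithinAt_Iic_of_Icc (hd t (Ioc_subset_Icc_self ht)) ht)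
        (fun t ht => (hδs (hsub t (Ioc_subset_Icc_self ht))).1.2)
        (fun t ht => (hd' t ht).continuousWithinAt)
        (fun t ht => hasDerivWithinAt_Iic_of_Icc (hd' t (Ioc_subset_Icc_self ht)) ht)
        (fun t ht => (hδs (hsub t (Ioc_subset_Icc_self ht))).2.2)
        (by simp only [hrs]) (left_mem_Icc.2 hle)
  exact (tangentChart x₀).injOn (mem_tangentChart_source.2 (hδs hτ).1.1)
    (mem_tangentChart_source.2 (hδs hτ).2.1) hend

section Flow

variable {F} (hcomplete : F.ForwardComplete)

/-- The geodesic flow of a forward complete Finsler metric. -/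
def flow (u : TangentBundle (𝓡 n) M) : ℝ → TangentBundle (𝓡 n) M := (hcomplete u).choose

lemma flow_zero (u : TangentBundle (𝓡 n) M) : flow hcomplete u 0 = u :=
  (hcomplete u).choose_spec.1

lemma isMIntegralCurveOn_flow (u : TangentBundle (𝓡 n) M) :
    IsMIntegralCurveOn (flow hcomplete u) F.spray (Ici 0) :=
  (hcomplete u).choose_spec.2

lemma isMIntegralCurveOn_flow_Icc (u : TangentBundle (𝓡 n) M) (b : ℝ) :
    IsMIntegralCurveOn (flow hcomplete u) F.spray (Icc 0 b) :=
  (isMIntegralCurveOn_flow hcomplete u).mono Icc_subset_Ici_self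

lemma flow_mem_slit {u : TangentBundle (𝓡 n) M} (hu : u ∈ slit n M) {t : ℝ} (ht : 0 ≤ t) :
    flow hcomplete u t ∈ slit n M :=
  F.mem_slit_of_isMIntegralCurveOn (isMIntegralCurveOn_flow_Icc hcomplete u t)
    (left_mem_Icc.2 ht) (by rwa [flow_zero]) (right_mem_Icc.2 ht)

lemma toFun_flow {u : TangentBundle (𝓡 n) M} (hu : u ∈ slit n M) {t : ℝ} (ht : 0 ≤ t) :
    F.toFun (flow hcomplete u t) = F.toFun u := by
  rw [F.toFun_eq_of_isMIntegralCurveOn (isMIntegralCurveOn_flow_Icc hcomplete u t)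
    (left_mem_Icc.2 ht) (by rwa [flow_zero]) (right_mem_Icc.2 ht), flow_zero]

variable [T2Space M]

lemma flow_eq {u : TangentBundle (𝓡 n) M} (hu : u ∈ slit n M) {γ : ℝ → TangentBundle (𝓡 n) M}
    {b : ℝ} (h : IsMIntegralCurveOn γ F.spray (Icc 0 b)) (h0 : γ 0 = u) {t : ℝ}
    (ht : t ∈ Icc 0 b) : flow hcomplete u t = γ t :=
  F.eqOn_of_isMIntegralCurveOn (isMIntegralCurveOn_flow_Icc hcomplete u b) h
    (left_mem_Icc.2 (ht.1.trans ht.2)) (by rwa [flow_zero]) (by rw [flow_zero, h0]) ht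

lemma flow_add {u : TangentBundle (𝓡 n) M} (hu : u ∈ slit n M) {s t : ℝ} (hs : 0 ≤ s)
    (ht : 0 ≤ t) : flow hcomplete u (s + t) = flow hcomplete (flow hcomplete u s) t := by
  have h1 : IsMIntegralCurveOn (flow hcomplete u ∘ (· + s)) F.spray (Icc 0 t) :=
    ((isMIntegralCurveOn_flow hcomplete u).comp_add s).mono fun r hr =>
      add_nonneg hr.1 hs
  have h2 := flow_eq hcomplete (flow_mem_slit hcomplete hu hs) h1
    (by simp only [Function.comp_apply, zero_add]) (right_mem_Icc.2 ht)
  rw [h2, Function.comp_apply, add_comm]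

/-- Forward completeness provides no inverse flow; orbits that meet at time `t` agree earlier by
uniqueness backwards from `t`. -/
lemma injOn_flow {t : ℝ} (ht : 0 ≤ t) : InjOn (fun u => flow hcomplete u t) (slit n M) := by
  intro u hu v hv huv
  have h := F.eqOn_of_isMIntegralCurveOn (isMIntegralCurveOn_flow_Icc hcomplete u t)
    (isMIntegralCurveOn_flow_Icc hcomplete v t) (right_mem_Icc.2 ht)
    (flow_mem_slit hcomplete hu ht) huv (left_mem_Icc.2 ht)
  rwa [flow_zero, flow_zero] at h

end Flow

end FinslerMetric

/-- A convex function on `[0, ∞)` which returns to its initial value is constant. -/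
lemma eq_of_convexOn_of_frequently {g : ℝ → ℝ} (hg : ConvexOn ℝ (Ici 0) g)
    (hrec : ∀ δ > 0, ∃ᶠ k : ℕ in Filter.atTop, |g k - g 0| < δ) {t : ℝ} (ht : 0 ≤ t) :
    g t = g 0 := by
  have hex : ∀ δ > 0, ∀ s : ℝ, ∃ k : ℕ, s < k ∧ |g k - g 0| < δ := by
    intro δ hδ s
    obtain ⟨k, hk, hk'⟩ := ((hrec δ hδ).and_eventually
      (Filter.eventually_gt_atTop ⌈s⌉₊)).exists
    exact ⟨k, (Nat.le_ceil s).trans_lt (by exact_mod_cast hk'), hk⟩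
  -- A time `s` lies between 0 and a late return time, and a convex function is at most the larger
  -- of its end values.
  have hle : ∀ s, 0 ≤ s → g s ≤ g 0 := by
    intro s hs
    refine le_of_forall_pos_le_add fun δ hδ => ?_
    obtain ⟨k, hk, hk'⟩ := hex δ hδ s
    have h1 := hg.le_max_of_mem_Icc (mem_Ici.2 le_rfl) (mem_Ici.2 (hs.trans hk.le)) ⟨hs, hk.le⟩
    refine h1.trans (max_le (by linarith) ?_)
    linarith [(abs_lt.1 hk').2]
  refine le_antisymm (hle t ht) (not_lt.1 fun hlt => ?_)
  obtain ⟨k, hk, hk'⟩ := hex (g 0 - g t) (sub_pos.2 hlt) t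
  have hgk : g t < g k := by linarith [(abs_lt.1 hk').1]
  -- A value below `g 0` would force a positive slope between `t` and a late return time `k`, hence
  -- at least linear growth afterwards. The time `m` is where the line of slope `σ` through `(k, g
  -- k)` reaches `g 0 + 1`.
  set σ := (g k - g t) / (k - t) with hσ
  have hkt : 0 < (k : ℝ) - t := sub_pos.2 hk
  have hσ0 : 0 < σ := div_pos (sub_pos.2 hgk) hkt
  set m := k + (g 0 - g k + 1) / σ with hm
  have hk0 : g k ≤ g 0 := hle k (ht.trans hk.le)
  have hmk : (k : ℝ) < m := by
    have : 0 < (g 0 - g k + 1) / σ := div_pos (by linarith) hσ0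
    linarith
  have h1 := hg.slope_mono_adjacent (mem_Ici.2 ht) (mem_Ici.2 (ht.trans (hk.trans hmk).le)) hk hmk
  rw [← hσ, le_div_iff₀ (sub_pos.2 hmk)] at h1
  have h2 : σ * (m - k) = g 0 - g k + 1 := by rw [hm]; field_simp; ring
  have h3 := hle m (ht.trans (hk.trans hmk).le)
  linarith

/-! ### Invariance of the Liouville measure, recurrence and constancy along geodesics. -/

namespace FinslerMetric

variable {n : ℕ} {M : Type*} [TopologicalSpace M] [ChartedSpace (Coord n) M]
  [IsManifold (𝓡 n) ∞ M] {F : FinslerMetric n M} [T2Space M] [SecondCountableTopology M]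
  [Nonempty M] (hcomplete : F.ForwardComplete)

/-- The time `t` map of the geodesic flow is continuous and preserves the Liouville measure
near `u`. -/
def PreservesLiouvilleAt (t : ℝ) (u : TangentBundle (𝓡 n) M) : Prop :=
  ∃ U : Set (TangentBundle (𝓡 n) M), IsOpen U ∧ u ∈ U ∧ U ⊆ slit n M ∧
    ContinuousOn (fun w => flow hcomplete w t) U ∧ ∀ A ⊆ U, MeasurableSet A →
      MeasurableSet ((fun w => flow hcomplete w t) '' A) ∧
      F.liouville n M ((fun w => flow hcomplete w t) '' A) = F.liouville n M A

/-- In a chart the flow is, by uniqueness, the local flow of the coordinate spray, which preserves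
`det g`. The time `T` is uniform near `u`, as the compactness argument for long times requires. -/
lemma exists_preservesLiouvilleAt {u : TangentBundle (𝓡 n) M} (hu : u ∈ slit n M) :
    ∃ U ∈ 𝓝 u, ∃ T > 0, ∀ w ∈ U, ∀ t ∈ Icc 0 T, PreservesLiouvilleAt hcomplete t w := by
  set x₀ := u.1 with hx₀
  have hus : u.1 ∈ (extChartAt (𝓡 n) x₀).source := mem_extChartAt_source _
  have hp : tangentChart x₀ u ∈ regularSet x₀ := (tangentChart_mem_regularSet hus).2 hu
  have hdet : ContDiffOn ℝ ∞ (fun p => (tensorOf (F.energy x₀) p).det) (regularSet x₀) :=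
    contDiffOn_det (contDiffOn_tensorOf (isOpen_regularSet x₀) (F.contDiffOn_energy x₀))
  obtain ⟨r, hr, T, hT, α, hα, hα'⟩ := exists_local_flow_preserving_density
    (volume : Measure (Coord n × Coord n)) (isOpen_regularSet x₀)
    ((F.contDiffOn_chartSpray x₀).of_le (by exact_mod_cast le_top))
    (hdet.differentiableOn (by simp)) (fun p hp => F.liouvilleDensity_pos hp)
    (fun p hp => divergence_sprayOf (isOpen_regularSet x₀) (F.contDiffOn_energy x₀)
      (fun p hp => F.hess_energy_pos hp) hp) hp
  set B := Metric.ball (tangentChart x₀ u) r with hB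
  have hBreg : B ⊆ regularSet x₀ := fun p hp => by
    have h := ((hα p hp).2 0 (left_mem_Icc.2 hT.le)).2
    rwa [(hα p hp).1] at h
  set U := (tangentChart x₀).source ∩ tangentChart x₀ ⁻¹' B with hU
  have hUo : IsOpen U := (continuousOn_tangentChart x₀).isOpen_inter_preimage
    (isOpen_tangentChart_source x₀) Metric.isOpen_ball
  have hUs : U ⊆ slit n M := fun w hw =>
    (tangentChart_mem_regularSet (mem_tangentChart_source.1 hw.1)).1 (hBreg hw.2)
  have hflow : ∀ w ∈ U, ∀ t ∈ Icc 0 T,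
      flow hcomplete w t = (tangentChart x₀).symm (α (tangentChart x₀ w) t) := by
    intro w hw t ht
    refine flow_eq hcomplete (hUs hw) (F.isMIntegralCurveOn_of_chart
      (fun s hs => ((hα _ hw.2).2 s hs).2.1) fun s hs => ((hα _ hw.2).2 s hs).1) ?_ ht
    rw [(hα _ hw.2).1, (tangentChart x₀).left_inv hw.1]
  refine ⟨U, hUo.mem_nhds ⟨mem_tangentChart_source.2 hus, Metric.mem_ball_self hr⟩, T, hT,
    fun w hw t ht => ⟨U, hUo, hw, hUs, ?_, fun A hAU hA => ?_⟩⟩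
  · have h1 : ContinuousOn (fun w => (tangentChart x₀).symm (α (tangentChart x₀ w) t)) U :=
      (continuousOn_tangentChart_symm x₀).comp ((hα' t ht).1.comp
        ((continuousOn_tangentChart x₀).mono inter_subset_left) fun w hw => hw.2)
        fun w hw => regularSet_subset_target x₀ ((hα _ hw.2).2 t ht).2
    exact h1.congr fun w hw => hflow w hw t ht
  · set A₀ := regularSet x₀ ∩ (tangentChart x₀).symm ⁻¹' A with hA₀
    have hA₀m : MeasurableSet A₀ := measurableSet_regularSet_inter x₀ hA
    have hA₀B : A₀ ⊆ B := fun p hp => by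
      have h1 := (hAU hp.2).2
      rwa [mem_preimage, (tangentChart x₀).right_inv (regularSet_subset_target x₀ hp.1)] at h1
    have hAA₀ : (tangentChart x₀).symm '' A₀ = A := by
      ext w
      constructor
      · rintro ⟨p, hp, rfl⟩; exact hp.2
      · exact fun hw => ⟨tangentChart x₀ w, ⟨hBreg (hAU hw).2, by
          rw [mem_preimage, (tangentChart x₀).left_inv (hAU hw).1]; exact hw⟩,
          (tangentChart x₀).left_inv (hAU hw).1⟩
    obtain ⟨h2, h3⟩ := (hα' t ht).2 A₀ hA₀B hA₀m
    have h4 : (fun w => flow hcomplete w t) '' A =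
        (tangentChart x₀).symm '' ((fun p => α p t) '' A₀) := by
      conv_lhs => rw [← hAA₀]
      rw [image_image, image_image]
      refine image_congr fun p hp => ?_
      have h5 : (tangentChart x₀).symm p ∈ U := hAU hp.2
      rw [hflow _ h5 t ht, (tangentChart x₀).right_inv (regularSet_subset_target x₀ hp.1)]
    have h6 : (fun p => α p t) '' A₀ ⊆ regularSet x₀ := by
      rintro _ ⟨p, hp, rfl⟩
      exact ((hα p (hA₀B hp)).2 t ht).2
    rw [h4]
    refine ⟨measurableSet_image_symm h2 h6, ?_⟩
    rw [F.liouville_image_symm h2 h6, ← hAA₀, F.liouville_image_symm hA₀m inter_subset_left]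
    exact h3

lemma PreservesLiouvilleAt.add {u : TangentBundle (𝓡 n) M} {s t : ℝ} (hs0 : 0 ≤ s) (ht0 : 0 ≤ t)
    (hs : PreservesLiouvilleAt hcomplete s u)
    (ht : PreservesLiouvilleAt hcomplete t (flow hcomplete u s)) :
    PreservesLiouvilleAt hcomplete (s + t) u := by
  obtain ⟨U, hUo, huU, hUs, hUc, hU⟩ := hs
  obtain ⟨W, hWo, huW, hWs, hWc, hW⟩ := ht
  have hadd : ∀ w ∈ U, flow hcomplete w (s + t) = flow hcomplete (flow hcomplete w s) t :=
    fun w hw => flow_add hcomplete (hUs hw) hs0 ht0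
  refine ⟨U ∩ (fun w => flow hcomplete w s) ⁻¹' W, hUc.isOpen_inter_preimage hUo hWo, ⟨huU, huW⟩,
    fun w hw => hUs hw.1, ?_, fun A hA hAm => ?_⟩
  · exact (hWc.comp (hUc.mono inter_subset_left) fun w hw => hw.2).congr fun w hw => hadd w hw.1
  · have h1 : (fun w => flow hcomplete w (s + t)) '' A =
        (fun w => flow hcomplete w t) '' ((fun w => flow hcomplete w s) '' A) := by
      rw [image_image]
      exact image_congr fun w hw => hadd w (hA hw).1
    obtain ⟨h2, h3⟩ := hU A (fun w hw => (hA hw).1) hAm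
    obtain ⟨h4, h5⟩ := hW _ (by rintro _ ⟨w, hw, rfl⟩; exact (hA hw).2) h2
    rw [h1]
    exact ⟨h4, h5.trans h3⟩

/-- The orbit over `[0, b]` is compact, so one `T` works along all of it; `N > b / T` steps of
length `b / N` are then composed. -/
lemma preservesLiouvilleAt {u : TangentBundle (𝓡 n) M} (hu : u ∈ slit n M) {b : ℝ} (hb : 0 ≤ b) :
    PreservesLiouvilleAt hcomplete b u := by
  have hcont : ContinuousOn (flow hcomplete u) (Icc 0 b) :=
    F.continuousOn_of_isMIntegralCurveOn (isMIntegralCurveOn_flow_Icc hcomplete u b)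
  obtain ⟨T, hT, hTu⟩ : ∃ T > 0, ∀ w ∈ flow hcomplete u '' Icc 0 b, ∀ t ∈ Icc 0 T,
      PreservesLiouvilleAt hcomplete t w := by
    refine (isCompact_Icc.image_of_continuousOn hcont).induction_on
      (p := fun K => ∃ T > 0, ∀ w ∈ K, ∀ t ∈ Icc 0 T, PreservesLiouvilleAt hcomplete t w)
      ⟨1, one_pos, fun w hw => hw.elim⟩ ?_ ?_ ?_
    · rintro K K' hKK' ⟨T, hT, h⟩
      exact ⟨T, hT, fun w hw => h w (hKK' hw)⟩
    · rintro K K' ⟨T, hT, h⟩ ⟨T', hT', h'⟩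
      refine ⟨min T T', lt_min hT hT', fun w hw t ht => ?_⟩
      rcases hw with hw | hw
      · exact h w hw t ⟨ht.1, ht.2.trans (min_le_left _ _)⟩
      · exact h' w hw t ⟨ht.1, ht.2.trans (min_le_right _ _)⟩
    · rintro _ ⟨s, hs, rfl⟩
      obtain ⟨U, hU, T, hT, h⟩ := exists_preservesLiouvilleAt hcomplete
        (flow_mem_slit hcomplete hu hs.1)
      exact ⟨U, mem_nhdsWithin_of_mem_nhds hU, T, hT, h⟩
  obtain ⟨N, hN⟩ := exists_nat_gt (b / T)
  have hN0 : 0 < (N : ℝ) := (div_nonneg hb hT.le).trans_lt hN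
  have hstep : ∀ k : ℕ, k ≤ N → PreservesLiouvilleAt hcomplete (k * (b / N)) u := by
    have hbN : 0 ≤ b / N := by positivity
    have hbNT : b / N ≤ T := by
      rw [div_le_iff₀ hN0]; rw [div_lt_iff₀ hT] at hN; linarith
    have hmem : ∀ k : ℕ, k ≤ N → k * (b / N) ∈ Icc 0 b := fun k hk => by
      refine ⟨by positivity, ?_⟩
      have : (k : ℝ) ≤ N := by exact_mod_cast hk
      calc k * (b / N) ≤ N * (b / N) := by gcongr
        _ = b := by field_simp
    intro k
    induction k with
    | zero =>
      intro _
      have h := hTu (flow hcomplete u 0) ⟨0, left_mem_Icc.2 hb, rfl⟩ 0 (left_mem_Icc.2 hT.le)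
      rw [flow_zero] at h
      simpa using h
    | succ k ih =>
      intro hk
      have h1 := ih (Nat.le_of_succ_le hk)
      have h2 := hmem k (Nat.le_of_succ_le hk)
      have h3 := PreservesLiouvilleAt.add hcomplete h2.1 hbN h1
        (hTu _ ⟨_, h2, rfl⟩ (b / N) ⟨hbN, hbNT⟩)
      have h4 : ((k + 1 : ℕ) : ℝ) * (b / N) = k * (b / N) + b / N := by push_cast; ring
      rwa [h4]
  have h := hstep N le_rfl
  rwa [mul_div_cancel₀ _ hN0.ne'] at h

lemma continuousOn_flow {t : ℝ} (ht : 0 ≤ t) :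
    ContinuousOn (fun w => flow hcomplete w t) (slit n M) := fun u hu => by
  obtain ⟨U, hUo, huU, -, hUc, -⟩ := preservesLiouvilleAt hcomplete hu ht
  exact (hUc.continuousAt (hUo.mem_nhds huU)).continuousWithinAt

/-- The geodesic flow preserves the Liouville measure. -/
lemma liouville_image_flow {t : ℝ} (ht : 0 ≤ t) {A : Set (TangentBundle (𝓡 n) M)}
    (hA : MeasurableSet A) (hAs : A ⊆ slit n M) :
    F.liouville n M ((fun w => flow hcomplete w t) '' A) = F.liouville n M A := by
  have hex : ∀ u : slit n M, ∃ U : Set (TangentBundle (𝓡 n) M), IsOpen U ∧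
      (u : TangentBundle _ _) ∈ U ∧ ∀ A ⊆ U, MeasurableSet A → MeasurableSet ((fun w => flow hcomplete w t) '' A) ∧
      F.liouville n M ((fun w => flow hcomplete w t) '' A) = F.liouville n M A := fun u => by
    obtain ⟨U, hUo, huU, -, -, hU⟩ := preservesLiouvilleAt hcomplete u.2 ht
    exact ⟨U, hUo, huU, hU⟩
  choose U hUo huU hU using hex
  -- Countably many of the local neighbourhoods suffice. The set is cut into disjoint measurable
  -- pieces inside them, whose images are disjoint because the flow is injective.
  obtain ⟨s, hs, hsU⟩ := TopologicalSpace.isOpen_iUnion_countable U hUo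
  have hcov : ⋃ u ∈ s, U u = ⋃ u, U u := hsU
  rcases A.eq_empty_or_nonempty with rfl | ⟨u₀, hu₀⟩
  · simp
  have hsne : s.Nonempty := by
    have h1 : u₀ ∈ ⋃ u ∈ s, U u := by
      rw [hcov]; exact mem_iUnion.2 ⟨⟨u₀, hAs hu₀⟩, huU _⟩
    simp only [mem_iUnion] at h1
    exact ⟨_, h1.choose_spec.choose⟩
  obtain ⟨e, rfl⟩ := hs.exists_eq_range hsne
  set D : ℕ → Set (TangentBundle (𝓡 n) M) := fun i => A ∩ disjointed (fun i => U (e i)) i with hD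
  have hDm : ∀ i, MeasurableSet (D i) := fun i =>
    hA.inter (MeasurableSet.disjointed (fun i => (hUo (e i)).measurableSet) i)
  have hDU : ∀ i, D i ⊆ U (e i) := fun i _ hu => disjointed_subset (fun i => U (e i)) i hu.2
  have hDd : Pairwise (Function.onFun Disjoint D) := fun i j hij =>
    (disjoint_disjointed _ hij).mono inter_subset_right inter_subset_right
  have hDA : ⋃ i, D i = A := by
    rw [← inter_iUnion, iUnion_disjointed, inter_eq_left]
    intro u hu
    have h1 : u ∈ ⋃ u, U u := mem_iUnion.2 ⟨⟨u, hAs hu⟩, huU _⟩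
    rw [← hcov] at h1
    simpa using h1
  have himd : Pairwise (Function.onFun Disjoint fun i => (fun w => flow hcomplete w t) '' D i) :=
    fun i j hij => by
      refine disjoint_left.2 ?_
      rintro _ ⟨u, hu, rfl⟩ ⟨v, hv, hvu⟩
      have := injOn_flow hcomplete ht (hAs hv.1) (hAs hu.1) hvu
      exact disjoint_left.1 (hDd hij) hu (this ▸ hv)
  conv_lhs => rw [← hDA]
  rw [image_iUnion, measure_iUnion himd fun i => (hU (e i) _ (hDU i) (hDm i)).1]
  conv_rhs => rw [← hDA]
  rw [measure_iUnion hDd hDm]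
  exact tsum_congr fun i => (hU (e i) _ (hDU i) (hDm i)).2

/-- The time one map of the geodesic flow on the nonzero vectors. -/
def timeOne (u : TangentBundle (𝓡 n) M) : TangentBundle (𝓡 n) M :=
  open scoped Classical in if u ∈ slit n M then flow hcomplete u 1 else u

lemma timeOne_eq {u : TangentBundle (𝓡 n) M} (hu : u ∈ slit n M) :
    timeOne hcomplete u = flow hcomplete u 1 := if_pos hu

lemma measurable_timeOne : Measurable (timeOne hcomplete) := by
  classical
  have h1 := (continuousOn_flow hcomplete zero_le_one).measurable_piecewise
    (g := id) continuousOn_id (isOpen_slit (n := n) (M := M)).measurableSet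
  exact h1

lemma timeOne_iterate {u : TangentBundle (𝓡 n) M} (hu : u ∈ slit n M) (k : ℕ) :
    (timeOne hcomplete)^[k] u = flow hcomplete u k := by
  induction k with
  | zero => simp [flow_zero]
  | succ k ih =>
    rw [Function.iterate_succ_apply', ih, timeOne_eq hcomplete
      (flow_mem_slit hcomplete hu (Nat.cast_nonneg k)),
      ← flow_add hcomplete hu (Nat.cast_nonneg k) zero_le_one, Nat.cast_succ]

variable (F) in
/-- The open unit ball bundle without its zero section. -/
def unitBallBundle : Set (TangentBundle (𝓡 n) M) := {u | u ∈ slit n M ∧ F.toFun u < 1}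

lemma isOpen_unitBallBundle : IsOpen F.unitBallBundle :=
  isOpen_slit.inter (isOpen_Iio.preimage F.continuous_toFun)

/-- The flow maps the preimage of `A` in the ball bundle into the part of `A` there, with equal
measure, so the pushforward is at most the measure. Both have the same finite mass, hence they
agree; surjectivity of the flow is not required. -/
lemma measurePreserving_timeOne [MeasurableSpace M] [BorelSpace M] (hvol : F.htVolume < ⊤) :
    MeasurePreserving (timeOne hcomplete) ((F.liouville n M).restrict F.unitBallBundle)
      ((F.liouville n M).restrict F.unitBallBundle) := by
  set μ := (F.liouville n M).restrict F.unitBallBundle with hμ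
  have hT := measurable_timeOne hcomplete
  have hfin : IsFiniteMeasure μ := ⟨by
    rw [hμ, Measure.restrict_apply_univ]; exact F.liouville_lt_top hvol⟩
  refine ⟨hT, Measure.eq_of_le_of_measure_univ_eq (Measure.le_iff.2 fun A hA => ?_) ?_⟩
  · rw [Measure.map_apply hT hA, hμ, Measure.restrict_apply (hT hA), Measure.restrict_apply hA]
    have hm : MeasurableSet (timeOne hcomplete ⁻¹' A ∩ F.unitBallBundle) :=
      (hT hA).inter isOpen_unitBallBundle.measurableSet
    rw [← liouville_image_flow hcomplete zero_le_one hm fun u hu => hu.2.1]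
    refine measure_mono ?_
    rintro _ ⟨u, ⟨huA, hu⟩, rfl⟩
    rw [mem_preimage, timeOne_eq hcomplete hu.1] at huA
    exact ⟨huA, flow_mem_slit hcomplete hu.1 zero_le_one, by
      simp only [toFun_flow hcomplete hu.1 zero_le_one]; exact hu.2⟩
  · rw [Measure.map_apply hT MeasurableSet.univ, preimage_univ]

lemma convexOn_comp_flow {f : M → ℝ} (hf : F.IsConvex f) (u : TangentBundle (𝓡 n) M) :
    ConvexOn ℝ (Ici 0) fun t => f (flow hcomplete u t).1 := by
  refine ⟨convex_Ici 0, fun s hs t ht a b ha hb hab => ?_⟩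
  have h := hf (fun t => (flow hcomplete u t).1) 0 (max s t) (le_max_of_le_left hs)
    ⟨_, isMIntegralCurveOn_flow_Icc hcomplete u _, fun _ _ => rfl⟩
  exact h.2 ⟨hs, le_max_left _ _⟩ ⟨ht, le_max_right _ _⟩ ha hb hab

/-- A finite measure-preserving system is conservative, so Poincaré recurrence makes `f` constant
along almost every orbit. The vectors violating the identity form an open set, which would have
positive measure if nonempty. -/
lemma apply_flow_one_eq [MeasurableSpace M] [BorelSpace M] (hvol : F.htVolume < ⊤) {f : M → ℝ}
    (hf : F.IsConvex f) {u : TangentBundle (𝓡 n) M} (hu : u ∈ F.unitBallBundle) :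
    f (flow hcomplete u 1).1 = f u.1 := by
  set μ := (F.liouville n M).restrict F.unitBallBundle with hμ
  have hfin : IsFiniteMeasure μ := ⟨by
    rw [hμ, Measure.restrict_apply_univ]; exact F.liouville_lt_top hvol⟩
  have hfc : Continuous fun u : TangentBundle (𝓡 n) M => f u.1 :=
    hf.continuous.comp continuous_tangentBundle_proj
  have hae : ∀ᵐ w ∂μ, f (flow hcomplete w 1).1 = f w.1 := by
    filter_upwards [(measurePreserving_timeOne hcomplete
        hvol).conservative.ae_frequently_mem_of_mem_nhds,
      ae_restrict_mem isOpen_unitBallBundle.measurableSet] with w hw hwB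
    have h1 := eq_of_convexOn_of_frequently (convexOn_comp_flow hcomplete hf w)
      (fun δ hδ => ?_) zero_le_one
    · simpa only [flow_zero] using h1
    · have h2 : {z : TangentBundle (𝓡 n) M | |f z.1 - f w.1| < δ} ∈ 𝓝 w :=
        hfc.continuousAt.eventually (Metric.ball_mem_nhds (f w.1) hδ)
      refine (hw _ h2).mono fun k hk => ?_
      rw [timeOne_iterate hcomplete hwB.1] at hk
      simp only [flow_zero]
      exact hk
  by_contra hne
  set O := F.unitBallBundle ∩ (fun w => (f (flow hcomplete w 1).1, f w.1)) ⁻¹' {q | q.1 ≠ q.2}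
    with hO
  have hOo : IsOpen O := by
    refine ContinuousOn.isOpen_inter_preimage ?_ isOpen_unitBallBundle
      (isOpen_ne_fun continuous_fst continuous_snd)
    exact (hfc.comp_continuousOn ((continuousOn_flow hcomplete zero_le_one).mono
      fun w hw => hw.1)).prodMk hfc.continuousOn
  refine (F.liouville_pos hOo (fun w hw => hw.1.1) ⟨u, hu, hne⟩).ne' ?_
  rw [hμ, ae_restrict_iff' isOpen_unitBallBundle.measurableSet] at hae
  refine measure_mono_null (fun w hw => ?_) (ae_iff.1 hae)
  exact fun h => hw.2 (h hw.1)

end FinslerMetric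

end Finsler

end

theorem theorem1p1 {n : ℕ} {M : Type*} [TopologicalSpace M] [T2Space M]
    [SecondCountableTopology M] [ChartedSpace (Finsler.Coord n) M] [IsManifold (𝓡 n) ∞ M]
    [MeasurableSpace M] [BorelSpace M] [ConnectedSpace M] [NoncompactSpace M]
    (F : Finsler.FinslerMetric n M) (hcomplete : F.ForwardComplete) (hvol : F.htVolume < ⊤)
    (f : M → ℝ) (hf : F.IsConvex f) :
    ∃ c : ℝ, ∀ x : M, f x = c := by
  have hlc : IsLocallyConstant f := by
    refine F.isLocallyConstant_of_forall_isMIntegralCurveOn fun u hu hu0 hu1 => ?_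
    -- The chosen flow and the given curve `u` agree up to time one by uniqueness for nonzero
    -- initial velocity.
    rw [← Finsler.FinslerMetric.apply_flow_one_eq hcomplete hvol hf ⟨hu0, hu1⟩,
      Finsler.FinslerMetric.flow_eq hcomplete hu0 hu rfl (Set.right_mem_Icc.2 zero_le_one)]
  obtain ⟨x₀⟩ := (inferInstance : Nonempty M)
  exact ⟨f x₀, fun x => hlc.apply_eq_of_isPreconnected isPreconnected_univ trivial trivial⟩
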